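/- A stack on the category of topological spaces is a (2-)functor $X$ from $\mathsf{Top}^{\mathsf{op}}$ to (essentially small) groupoids which satisfies descent for open covers; maps of stacks are (pseudo)natural transformations. A (separated) orbispace is a stack $X$ which admits a representable étale surjection $U\to X$ from a topological space $U$ and whose diagonal $X\to X\times X$ is representable, separated and proper. Its coarse space $|X|$ is the set of isomorphism classes of maps $*\to X$, where a subset is open iff its inverse image under every map $T\to X$ from a space $T$ is open. The isotropy group of a point $x:*\to X$ is $\operatorname{Aut}(x)$, and a map of stacks $f:X\to Y$ is injective on isotropy groups iff $\operatorname{Aut}(x)\to\operatorname{Aut}(f(x))$ is injective for every $x:*\to X$. An orbispace $X$ is called paracompact if every open cover of $|X|$ has a locally finite open refinement, coarsely finite-dimensional if every open cover of $|X|$ has a locally finite open refinement with finite-dimensional nerve, and $d$-dimensional if every open cover of $|X|$ has a locally finite open refinement whose nerve has dimension $\leq d$. A simplicial complex of groups $(Z,G)$ is a simplicial complex $Z$ with a group $G_\sigma$ for every simplex $\sigma$, an injective homomorphism $G_\tau\hookrightarrow G_\sigma$ for all $\sigma\subseteq\tau$, and for all $\rho\subseteq\sigma\subseteq\tau$ an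 element of $G_\rho$ conjugating $G_\tau\hookrightarrow G_\rho$ to $G_\tau\hookrightarrow G_\sigma\hookrightarrow G_\rho$, such that for all $\pi\subseteq\rho\subseteq\sigma\subseteq\tau$ the resulting product of elements of $G_\pi$, conjugating $G_\tau\hookrightarrow G_\pi$ to $G_\tau\hookrightarrow G_\rho\hookrightarrow G_\pi$ to $G_\tau\hookrightarrow G_\sigma\hookrightarrow G_\rho\hookrightarrow G_\pi$ to $G_\tau\hookrightarrow G_\sigma\hookrightarrow G_\pi$ and back to $G_\tau\hookrightarrow G_\pi$, is the identity. Its geometric realization $\|(Z,G)\|$ is the stack obtained by gluing the stacks $\sigma\times\mathbb B G_\sigma$ (over all simplices $\sigma$ of $Z$) via these data. Proposition. For every paracompact orbispace $X$ there exist a simplicial complex of groups $(Z,G)$, such that for every vertex $z$ of $Z$ the group $G_z$ is isomorphic to the isotropy group of some point of $X$, and a map of stacks $X\to\|(Z,G)\|$ which is injective on isotropy groups. If $X$ is coarsely finite-dimensional, then $(Z,G)$ and the map can be chosen with $Z$ finite-dimensional; if $X$ is $d$-dimensional ($d\geq 0$ an integer), they can be chosen with $Z$ of dimension $\leq d$.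 -/

import Mathlib

open CategoryTheory Opposite Topology

universe u v

namespace Orbispaces

/-! ### Stacks on topological spaces -/

/-- A 2-functor `Topᵒᵖ → Cat` (locally small). -/
abbrev TopPrestack := Pseudofunctor (LocallyDiscrete TopCat.{u}ᵒᵖ) Cat.{u, u + 1}

namespace TopPrestack

/-- The category `X(T)`; its objects are also thought of as maps `T → X`. -/
abbrev Fib (X : TopPrestack.{u}) (T : TopCat.{u}) : Type (u + 1) := X.obj ⟨op T⟩

/-- The pullback `f^* x` of `x ∈ X(T)` along `f : S → T`. -/
abbrev pull (X : TopPrestack.{u}) {S T : TopCat.{u}} (f : S ⟶ T) (x : X.Fib T) : X.Fib S :=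
  (X.map f.op.toLoc).toFunctor.obj x

/-- A stack (in groupoids) on the category of topological spaces, for open covers. -/
structure IsTopStack (X : TopPrestack.{u}) : Prop where
  isStack : X.IsStack TopCat.grothendieckTopology.{u}
  isGroupoid : ∀ T : TopCat.{u}, IsGroupoid (X.Fib T)

/-- For `x : S → X` and `y : T → X`, the space `W` with the projections `p`, `q` and the
isomorphism `θ : p^* x ≅ q^* y` represents the fibre product `S ×_X T`, whose `W'`-points are the
triples `(p' : W' → S, q' : W' → T, θ' : p'^* x ≅ q'^* y)`. -/
def IsFibreProduct (X : TopPrestack.{u}) {S T : TopCat.{u}} (x : X.Fib S) (y : X.Fib T)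
    (W : TopCat.{u}) (p : W ⟶ S) (q : W ⟶ T) (θ : X.pull p x ≅ X.pull q y) : Prop :=
  ∀ (W' : TopCat.{u}) (p' : W' ⟶ S) (q' : W' ⟶ T) (θ' : X.pull p' x ≅ X.pull q' y),
    ∃! k : W' ⟶ W, ∃ (hp : k ≫ p = p') (hq : k ≫ q = q'),
      Pseudofunctor.LocallyDiscreteOpToCat.pullHom θ.hom k p' q' hp hq = θ'.hom

/-- `u : U → X` is an étale atlas: a representable étale surjection from a space, i.e. for every
space `T` and `y : T → X` the fibre product `U ×_X T` is a space and its projection to `T` is a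
surjective local homeomorphism. -/
def IsEtaleAtlas (X : TopPrestack.{u}) {U : TopCat.{u}} (x : X.Fib U) : Prop :=
  ∀ (T : TopCat.{u}) (y : X.Fib T),
    ∃ (W : TopCat.{u}) (p : W ⟶ U) (q : W ⟶ T) (θ : X.pull p x ≅ X.pull q y),
      X.IsFibreProduct x y W p q θ ∧ IsLocalHomeomorph q ∧ Function.Surjective q

/-- For `(x, y) : T → X × X`, the space `W` with `q : W → T` and `θ : q^* x ≅ q^* y` represents the
pullback `T ×_{X × X} X` of the diagonal of `X`, whose `W'`-points are the pairs
`(q' : W' → T, θ' : q'^* x ≅ q'^* y)`. -/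
def IsDiagonalPullback (X : TopPrestack.{u}) {T : TopCat.{u}} (x y : X.Fib T)
    (W : TopCat.{u}) (q : W ⟶ T) (θ : X.pull q x ≅ X.pull q y) : Prop :=
  ∀ (W' : TopCat.{u}) (q' : W' ⟶ T) (θ' : X.pull q' x ≅ X.pull q' y),
    ∃! k : W' ⟶ W, ∃ hq : k ≫ q = q',
      Pseudofunctor.LocallyDiscreteOpToCat.pullHom θ.hom k q' q' hq hq = θ'.hom

/-- The diagonal `X → X × X` is representable, separated and proper. -/
def HasSeparatedProperDiagonal (X : TopPrestack.{u}) : Prop :=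
  ∀ (T : TopCat.{u}) (x y : X.Fib T),
    ∃ (W : TopCat.{u}) (q : W ⟶ T) (θ : X.pull q x ≅ X.pull q y),
      X.IsDiagonalPullback x y W q θ ∧ IsSeparatedMap q ∧ IsProperMap q

/-- A (separated) orbispace. -/
structure IsOrbispace (X : TopPrestack.{u}) : Prop extends X.IsTopStack where
  exists_atlas : ∃ (U : TopCat.{u}) (x : X.Fib U), X.IsEtaleAtlas x
  diagonal : X.HasSeparatedProperDiagonal

/-- The one-point space. -/
abbrev pt : TopCat.{u} := TopCat.of PUnit.{u + 1}

/-- The point `* → T → X` for `x : T → X` and `t ∈ T`. -/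
abbrev fibreAt (X : TopPrestack.{u}) {T : TopCat.{u}} (x : X.Fib T) (t : T) : X.Fib pt :=
  X.pull (TopCat.ofHom (ContinuousMap.const PUnit.{u + 1} t)) x

/-- The points of the coarse space `|X|`: isomorphism classes of maps `* → X`. -/
def Coarse (X : TopPrestack.{u}) : Type (u + 1) :=
  _root_.Quotient (isIsomorphicSetoid (X.Fib pt))

/-- The map `T → |X|` induced by `x : T → X`. -/
def toCoarse (X : TopPrestack.{u}) {T : TopCat.{u}} (x : X.Fib T) (t : T) : X.Coarse :=
  Quotient.mk (isIsomorphicSetoid (X.Fib pt)) (X.fibreAt x t)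

/-- A subset of `|X|` is open iff its preimage under every map `T → X` from a space is open. -/
instance (X : TopPrestack.{u}) : TopologicalSpace X.Coarse :=
  ⨆ (T : TopCat.{u}) (x : X.Fib T), TopologicalSpace.coinduced (X.toCoarse x) inferInstance

/-- The homomorphisms `Aut(x) → Aut(f(x))` induced by a map of stacks `f : X → Y` on the isotropy
groups of all points `x : * → X` are injective. -/
def InjectiveOnIsotropy {X Y : TopPrestack.{u}} (f : Pseudofunctor.StrongTrans X Y) : Prop :=
  ∀ x : X.Fib pt, Function.Injective fun a : Aut x => (f.app ⟨op pt⟩).toFunctor.mapIso a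

end TopPrestack

/-! ### Covering dimension -/

/-- The nerve of the family `t` of subsets has dimension `≤ d`. -/
def NerveDimLE {S : Type*} {β : Type*} (t : β → Set S) (d : ℕ) : Prop :=
  ∀ I : Finset β, (⋂ b ∈ I, t b).Nonempty → I.card ≤ d + 1

/-- `t` is a locally finite open cover refining `s`. -/
structure IsLocallyFiniteRefinement {S : Type*} [TopologicalSpace S] {α β : Type*}
    (s : α → Set S) (t : β → Set S) : Prop where
  isOpen : ∀ b, IsOpen (t b)
  cover : ⋃ b, t b = Set.univ
  locallyFinite : LocallyFinite t
  refines : ∀ b, ∃ a, t b ⊆ s a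

/-- Every open cover has a locally finite refinement with nerve of dimension `≤ d`. -/
def CoarseDimLE (S : Type v) [TopologicalSpace S] (d : ℕ) : Prop :=
  ∀ (α : Type v) (s : α → Set S), (∀ a, IsOpen (s a)) → ⋃ a, s a = Set.univ →
    ∃ (β : Type v) (t : β → Set S), IsLocallyFiniteRefinement s t ∧ NerveDimLE t d

/-- Every open cover has a locally finite refinement with finite-dimensional nerve. -/
def CoarselyFiniteDimensional (S : Type v) [TopologicalSpace S] : Prop :=
  ∀ (α : Type v) (s : α → Set S), (∀ a, IsOpen (s a)) → ⋃ a, s a = Set.univ →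
    ∃ (β : Type v) (t : β → Set S), IsLocallyFiniteRefinement s t ∧ ∃ d, NerveDimLE t d

/-! ### The stack presented by a topological groupoid -/

/-- A topological groupoid `M ⇉ O`; `comp a b` is `a` followed by `b`. -/
structure TopGroupoid where
  O : Type u
  M : Type u
  [topO : TopologicalSpace O]
  [topM : TopologicalSpace M]
  src : M → O
  tgt : M → O
  one : O → M
  inv : M → M
  comp : ∀ a b : M, tgt a = src b → M
  src_one : ∀ x, src (one x) = x
  tgt_one : ∀ x, tgt (one x) = x
  src_inv : ∀ a, src (inv a) = tgt a
  tgt_inv : ∀ a, tgt (inv a) = src a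
  src_comp : ∀ a b h, src (comp a b h) = src a
  tgt_comp : ∀ a b h, tgt (comp a b h) = tgt b
  one_comp : ∀ a h, comp (one (src a)) a h = a
  comp_one : ∀ a h, comp a (one (tgt a)) h = a
  comp_inv : ∀ a h, comp a (inv a) h = one (src a)
  inv_comp : ∀ a h, comp (inv a) a h = one (tgt a)
  assoc : ∀ a b c hab hbc h h', comp (comp a b hab) c h = comp a (comp b c hbc) h'
  continuous_src : Continuous src
  continuous_tgt : Continuous tgt
  continuous_one : Continuous one
  continuous_inv : Continuous inv
  continuous_comp : Continuous fun p : {p : M × M // tgt p.1 = src p.2} => comp p.1.1 p.1.2 p.2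

attribute [instance] TopGroupoid.topO TopGroupoid.topM

/-- An object of `[M ⇉ O](T)`: an open cover `U i` of `T` with maps `U i → O` and
`U i ∩ U j → M` satisfying the cocycle condition. -/
structure Cocycle (𝒢 : TopGroupoid.{u}) (T : Type u) [TopologicalSpace T] where
  ι : Type u
  U : ι → Set T
  isOpen_U : ∀ i, IsOpen (U i)
  cover : ∀ t, ∃ i, t ∈ U i
  obj : ∀ i t, t ∈ U i → 𝒢.O
  mor : ∀ i j t, t ∈ U i → t ∈ U j → 𝒢.M
  continuous_obj : ∀ i, Continuous fun t : U i => obj i t.1 t.2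
  continuous_mor : ∀ i j,
    Continuous fun t : {t : T // t ∈ U i ∧ t ∈ U j} => mor i j t.1 t.2.1 t.2.2
  src_mor : ∀ i j t hi hj, 𝒢.src (mor i j t hi hj) = obj i t hi
  tgt_mor : ∀ i j t hi hj, 𝒢.tgt (mor i j t hi hj) = obj j t hj
  mor_comp_mor : ∀ i j k t hi hj hk,
    𝒢.comp (mor i j t hi hj) (mor j k t hj hk)
      ((tgt_mor i j t hi hj).trans (src_mor j k t hj hk).symm) = mor i k t hi hk

namespace Cocycle

variable {𝒢 : TopGroupoid.{u}} {T : Type u} [TopologicalSpace T]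

/-- An isomorphism in `[M ⇉ O](T)`: maps `U i ∩ U' i' → M` compatible with the cocycles. -/
@[ext]
structure Hom (c c' : Cocycle 𝒢 T) where
  mor : ∀ i i' t, t ∈ c.U i → t ∈ c'.U i' → 𝒢.M
  continuous_mor : ∀ i i',
    Continuous fun t : {t : T // t ∈ c.U i ∧ t ∈ c'.U i'} => mor i i' t.1 t.2.1 t.2.2
  src_mor : ∀ i i' t hi hi', 𝒢.src (mor i i' t hi hi') = c.obj i t hi
  tgt_mor : ∀ i i' t hi hi', 𝒢.tgt (mor i i' t hi hi') = c'.obj i' t hi'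
  left_comp : ∀ i j i' t hi hj hi',
    𝒢.comp (c.mor i j t hi hj) (mor j i' t hj hi')
      ((c.tgt_mor i j t hi hj).trans (src_mor j i' t hj hi').symm) = mor i i' t hi hi'
  comp_right : ∀ i i' j' t hi hi' hj',
    𝒢.comp (mor i i' t hi hi') (c'.mor i' j' t hi' hj')
      ((tgt_mor i i' t hi hi').trans (c'.src_mor i' j' t hi' hj').symm) = mor i j' t hi hj'

/-- An index of a member of the cover containing `t`. -/
noncomputable def idx (c : Cocycle 𝒢 T) (t : T) : c.ι := (c.cover t).choose

theorem mem_idx (c : Cocycle 𝒢 T) (t : T) : t ∈ c.U (c.idx t) := (c.cover t).choose_spec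

theorem _root_.Orbispaces.TopGroupoid.comp_congr (𝒢 : TopGroupoid.{u}) {a a' b b' : 𝒢.M}
    (ha : a = a') (hb : b = b') (h : 𝒢.tgt a = 𝒢.src b) (h' : 𝒢.tgt a' = 𝒢.src b') :
    𝒢.comp a b h = 𝒢.comp a' b' h' := by
  subst ha hb; rfl

namespace Hom

theorem comp_indep {c c' c'' : Cocycle 𝒢 T} (f : Hom c c') (g : Hom c' c'') (i : c.ι)
    (j j' : c'.ι) (k : c''.ι) (t : T) (hi : t ∈ c.U i) (hj : t ∈ c'.U j) (hj' : t ∈ c'.U j')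
    (hk : t ∈ c''.U k) :
    𝒢.comp (f.mor i j t hi hj) (g.mor j k t hj hk)
        ((f.tgt_mor _ _ _ _ _).trans (g.src_mor _ _ _ _ _).symm) =
      𝒢.comp (f.mor i j' t hi hj') (g.mor j' k t hj' hk)
        ((f.tgt_mor _ _ _ _ _).trans (g.src_mor _ _ _ _ _).symm) := by
  have e1 := f.comp_right i j j' t hi hj hj'
  have e2 := g.left_comp j j' k t hj hj' hk
  rw [𝒢.comp_congr rfl e2.symm _ (by rw [f.tgt_mor, 𝒢.src_comp, c'.src_mor]),
    𝒢.comp_congr e1.symm rfl _ (by rw [𝒢.tgt_comp, c'.tgt_mor, g.src_mor])]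
  exact (𝒢.assoc _ _ _ _ _ _ _).symm

/-- The identity of a cocycle. -/
def id (c : Cocycle 𝒢 T) : Hom c c where
  mor := c.mor
  continuous_mor := c.continuous_mor
  src_mor := c.src_mor
  tgt_mor := c.tgt_mor
  left_comp := c.mor_comp_mor
  comp_right := c.mor_comp_mor

/-- Composition, computed on `U i ∩ U' j ∩ U'' k` as the product in `M`. -/
noncomputable def comp {c c' c'' : Cocycle 𝒢 T} (f : Hom c c') (g : Hom c' c'') : Hom c c'' where
  mor i k t hi hk := 𝒢.comp (f.mor i (c'.idx t) t hi (c'.mem_idx t))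
    (g.mor (c'.idx t) k t (c'.mem_idx t) hk)
    ((f.tgt_mor _ _ _ _ _).trans (g.src_mor _ _ _ _ _).symm)
  continuous_mor i k := by
    rw [continuous_iff_continuousAt]
    intro t₀
    have hop : IsOpen {t : {t : T // t ∈ c.U i ∧ t ∈ c''.U k} | t.1 ∈ c'.U (c'.idx t₀.1)} :=
      (c'.isOpen_U _).preimage continuous_subtype_val
    refine ContinuousOn.continuousAt (s := {t | t.1 ∈ c'.U (c'.idx t₀.1)}) ?_
      (hop.mem_nhds (c'.mem_idx _))
    rw [continuousOn_iff_continuous_domRestrict]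
    have h1 := (f.continuous_mor i (c'.idx t₀.1)).comp
      (f := fun t : {t : {t : T // t ∈ c.U i ∧ t ∈ c''.U k} | t.1 ∈ c'.U (c'.idx t₀.1)} =>
        ⟨t.1.1, t.1.2.1, t.2⟩) (by fun_prop)
    have h2 := (g.continuous_mor (c'.idx t₀.1) k).comp
      (f := fun t : {t : {t : T // t ∈ c.U i ∧ t ∈ c''.U k} | t.1 ∈ c'.U (c'.idx t₀.1)} =>
        ⟨t.1.1, t.2, t.1.2.2⟩) (by fun_prop)
    refine (𝒢.continuous_comp.comp ((h1.prodMk h2).subtype_mk fun t =>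
      (f.tgt_mor _ _ _ _ _).trans (g.src_mor _ _ _ _ _).symm)).congr fun t => ?_
    exact comp_indep f g _ _ _ _ _ _ _ _ _
  src_mor i k t hi hk := by rw [𝒢.src_comp, f.src_mor]
  tgt_mor i k t hi hk := by rw [𝒢.tgt_comp, g.tgt_mor]
  left_comp i j k t hi hj hk := by
    rw [← 𝒢.assoc (hab := (c.tgt_mor _ _ _ _ _).trans (f.src_mor _ _ _ _ _).symm)
      (h := by rw [𝒢.tgt_comp, f.tgt_mor, g.src_mor])]
    exact 𝒢.comp_congr (f.left_comp _ _ _ _ _ _ _) rfl _ _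
  comp_right i k l t hi hk hl := by
    rw [𝒢.assoc (hbc := (g.tgt_mor _ _ _ _ _).trans (c''.src_mor _ _ _ _ _).symm)
      (h' := by rw [𝒢.src_comp, f.tgt_mor, g.src_mor])]
    exact 𝒢.comp_congr rfl (g.comp_right _ _ _ _ _ _ _) _ _

theorem comp_mor {c c' c'' : Cocycle 𝒢 T} (f : Hom c c') (g : Hom c' c'') (i : c.ι) (j : c'.ι)
    (k : c''.ι) (t : T) (hi : t ∈ c.U i) (hj : t ∈ c'.U j) (hk : t ∈ c''.U k) :
    (f.comp g).mor i k t hi hk = 𝒢.comp (f.mor i j t hi hj) (g.mor j k t hj hk)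
      ((f.tgt_mor _ _ _ _ _).trans (g.src_mor _ _ _ _ _).symm) :=
  comp_indep f g _ _ _ _ _ _ _ _ _

end Hom

noncomputable instance : Category.{u} (Cocycle 𝒢 T) where
  Hom := Hom
  id := Hom.id
  comp := Hom.comp
  id_comp {c c'} f := by
    refine Hom.ext ?_
    funext i i' t hi hi'
    exact (Hom.comp_mor (Hom.id c) f i i i' t hi hi hi').trans (f.left_comp _ _ _ _ _ _ _)
  comp_id {c c'} f := by
    refine Hom.ext ?_
    funext i i' t hi hi'
    exact (Hom.comp_mor f (Hom.id c') i i' i' t hi hi' hi').trans (f.comp_right _ _ _ _ _ _ _)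
  assoc {c c' c'' c'''} f g h := by
    refine Hom.ext ?_
    funext i l t hi hl
    exact 𝒢.assoc _ _ _ _ _ _ _

/-- Pullback of cocycles along a continuous map. -/
def pullback {S T : Type u} [TopologicalSpace S] [TopologicalSpace T] (f : C(S, T))
    (c : Cocycle 𝒢 T) : Cocycle 𝒢 S where
  ι := c.ι
  U i := f ⁻¹' c.U i
  isOpen_U i := (c.isOpen_U i).preimage f.continuous
  cover s := c.cover (f s)
  obj i s h := c.obj i (f s) h
  mor i j s hi hj := c.mor i j (f s) hi hj
  continuous_obj i := by
    have h : Continuous fun s : f ⁻¹' c.U i => (⟨f s.1, s.2⟩ : c.U i) := by fun_prop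
    exact (c.continuous_obj i).comp h
  continuous_mor i j := by
    have h : Continuous fun s : {s : S // s ∈ f ⁻¹' c.U i ∧ s ∈ f ⁻¹' c.U j} =>
      (⟨f s.1, s.2⟩ : {t : T // t ∈ c.U i ∧ t ∈ c.U j}) := by fun_prop
    exact (c.continuous_mor i j).comp h
  src_mor i j s := c.src_mor i j (f s)
  tgt_mor i j s := c.tgt_mor i j (f s)
  mor_comp_mor i j k s := c.mor_comp_mor i j k (f s)

/-- Pullback of isomorphisms of cocycles along a continuous map. -/
def Hom.pullback {S T : Type u} [TopologicalSpace S] [TopologicalSpace T] (f : C(S, T))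
    {c c' : Cocycle 𝒢 T} (φ : Hom c c') : Hom (c.pullback f) (c'.pullback f) where
  mor i j s hi hj := φ.mor i j (f s) hi hj
  continuous_mor i j := by
    have h : Continuous fun s : {s : S // s ∈ f ⁻¹' c.U i ∧ s ∈ f ⁻¹' c'.U j} =>
      (⟨f s.1, s.2⟩ : {t : T // t ∈ c.U i ∧ t ∈ c'.U j}) := by fun_prop
    exact (φ.continuous_mor i j).comp h
  src_mor i j s := φ.src_mor i j (f s)
  tgt_mor i j s := φ.tgt_mor i j (f s)
  left_comp i j k s := φ.left_comp i j k (f s)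
  comp_right i j k s := φ.comp_right i j k (f s)

/-- Pullback as a functor. -/
def pullbackFunctor (𝒢 : TopGroupoid.{u}) {S T : Type u} [TopologicalSpace S]
    [TopologicalSpace T] (f : C(S, T)) : Cocycle 𝒢 T ⥤ Cocycle 𝒢 S where
  obj := pullback f
  map := Hom.pullback f

end Cocycle

/-- The stack `[M ⇉ O]` presented by a topological groupoid. -/
noncomputable def TopGroupoid.stack (𝒢 : TopGroupoid.{u}) : TopPrestack.{u} :=
  Functor.toPseudofunctor'
    { obj := fun T => Cat.of (Cocycle 𝒢 T.unop)
      map := fun f => (Cocycle.pullbackFunctor 𝒢 f.unop.hom).toCatHom : TopCat.{u}ᵒᵖ ⥤ Cat.{u, u + 1} }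

end Orbispaces

namespace Orbispaces

/-! ### Simplicial complexes and systems of sets on them -/

section Systems

variable {V : Type u} (Z : AbstractSimplicialComplex V)

/-- A point of the geometric realization `‖Z‖`: barycentric coordinates, positive exactly on the
vertices of the simplex `supp`. -/
structure RealPt where
  supp : Z
  coord : V → ℝ
  coord_pos : ∀ v ∈ supp.1, 0 < coord v
  coord_eq_zero : ∀ v ∉ supp.1, coord v = 0
  sum_coord : ∑ v ∈ supp.1, coord v = 1

/-- The part of the closed simplex `τ` on which the coordinates of all vertices in `B` are
positive. -/
structure Cell (τ : Z) (B : Set V) where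
  pt : RealPt Z
  le : pt.supp ≤ τ
  base_le : B ⊆ (pt.supp.1 : Set V)

/-- The usual topology on (a part of) the closed simplex `τ`. -/
instance (τ : Z) (B : Set V) : TopologicalSpace (Cell Z τ B) :=
  TopologicalSpace.induced (fun p => p.pt.coord) inferInstance

/-- A family of contravariant functors from simplices to sets, the `b`-th one being defined on the
simplices containing `base b` (the open star of `base b`). -/
structure CellSystem where
  B : Type u
  base : B → Set V
  F : ∀ (b : B) (τ : Z), base b ⊆ (τ.1 : Set V) → Type u
  res : ∀ {b : B} {ρ τ : Z} (h : ρ ≤ τ) (hρ : base b ⊆ (ρ.1 : Set V)),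
    F b τ (hρ.trans (Finset.coe_subset.2 h)) → F b ρ hρ
  res_refl : ∀ {b : B} {τ : Z} (hτ : base b ⊆ (τ.1 : Set V)) (a : F b τ hτ), res le_rfl hτ a = a
  res_res : ∀ {b : B} {ρ σ τ : Z} (h : ρ ≤ σ) (h' : σ ≤ τ) (hρ : base b ⊆ (ρ.1 : Set V))
    (a : F b τ (hρ.trans (Finset.coe_subset.2 (h.trans h')))),
    res h hρ (res h' (hρ.trans (Finset.coe_subset.2 h)) a) = res (h.trans h') hρ a

namespace CellSystem

variable {Z} (S S' : CellSystem Z)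

/-- The realization of a system `F` of sets: the points of the open stars, together with an element
of `F` of the supporting simplex. -/
structure Realization where
  b : S.B
  p : RealPt Z
  base_le : S.base b ⊆ (p.supp.1 : Set V)
  a : S.F b p.supp base_le

theorem Realization.a_inj {S : CellSystem Z} {b : S.B} {p : RealPt Z}
    {h : S.base b ⊆ (p.supp.1 : Set V)} {a a' : S.F b p.supp h}
    (e : (⟨b, p, h, a⟩ : S.Realization) = ⟨b, p, h, a'⟩) : a = a' := by
  simpa using e

/-- The cell over the simplex `τ` labelled by `a ∈ F(τ)`, glued to the cells over the faces of `τ`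
by restricting labels. -/
def chart (b : S.B) (τ : Z) (hτ : S.base b ⊆ (τ.1 : Set V)) (a : S.F b τ hτ) :
    Cell Z τ (S.base b) → S.Realization :=
  fun p => ⟨b, p.pt, p.base_le, S.res p.le p.base_le a⟩

/-- The strongest topology for which all cells are continuous. -/
instance : TopologicalSpace S.Realization :=
  ⨆ (b : S.B) (τ : Z) (hτ : S.base b ⊆ (τ.1 : Set V)) (a : S.F b τ hτ),
    TopologicalSpace.coinduced (S.chart b τ hτ a) inferInstance

variable {S S'}

theorem isOpen_iff (A : Set S.Realization) :
    IsOpen A ↔ ∀ b τ hτ a, IsOpen (S.chart b τ hτ a ⁻¹' A) := by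
  simp only [isOpen_iSup_iff, isOpen_coinduced]

theorem isOpen_supp_ge (τ : Z) (B : Set V) (ρ : Z) :
    IsOpen {p : Cell Z τ B | ρ ≤ p.pt.supp} := by
  have : {p : Cell Z τ B | ρ ≤ p.pt.supp} =
      ⋂ v ∈ ρ.1, {p : Cell Z τ B | 0 < p.pt.coord v} := by
    ext p
    simp only [Set.mem_ofPred_eq, Set.mem_iInter]
    constructor
    · intro h v hv
      exact p.pt.coord_pos v (h hv)
    · intro h v hv
      by_contra hn
      exact (h v hv).ne' (p.pt.coord_eq_zero v hn)
  rw [this]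
  refine isOpen_biInter_finset fun v _ => ?_
  exact isOpen_lt continuous_const ((continuous_apply v).comp continuous_induced_dom)

/-- The set of points near the label `a ∈ F(ρ)`. -/
def near (b : S.B) (ρ : Z) (hρ : S.base b ⊆ (ρ.1 : Set V)) (a : S.F b ρ hρ) : Set S.Realization :=
  {x | ∃ (p : RealPt Z) (h : ρ ≤ p.supp)
    (a' : S.F b p.supp (hρ.trans (Finset.coe_subset.2 h))), S.res h hρ a' = a ∧ x = ⟨b, p, _, a'⟩}

theorem isOpen_near (b : S.B) (ρ : Z) (hρ : S.base b ⊆ (ρ.1 : Set V)) (a : S.F b ρ hρ) :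
    IsOpen (near b ρ hρ a) := by
  rw [isOpen_iff]
  intro b' τ hτ a'
  by_cases hb : b' = b
  · subst hb
    by_cases h : ∃ h : ρ ≤ τ, S.res h hρ a' = a
    · obtain ⟨hρτ, rfl⟩ := h
      convert isOpen_supp_ge τ (S.base b') ρ using 1
      ext p
      constructor
      · rintro ⟨q, hq, a'', -, e⟩
        obtain rfl : p.pt = q := congrArg Realization.p e
        exact hq
      · intro hp
        exact ⟨p.pt, hp, S.res p.le p.base_le a', S.res_res _ _ _ _, rfl⟩
    · convert isOpen_empty
      ext p
      simp only [Set.mem_preimage, Set.mem_empty_iff_false, iff_false]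
      rintro ⟨q, hq, a'', h1, e⟩
      obtain ⟨p, hp1, hp2⟩ := p
      obtain rfl : p = q := congrArg Realization.p e
      have e' : S.res hp1 hp2 a' = a'' := by
        simpa [chart] using e
      subst e'
      exact h ⟨hq.trans hp1, by rw [← h1, S.res_res]⟩
  · convert isOpen_empty
    ext p
    simp only [Set.mem_preimage, Set.mem_empty_iff_false, iff_false]
    rintro ⟨q, hq, a'', h1, e⟩
    exact hb (congrArg Realization.b e)

theorem mem_near (x : S.Realization) : x ∈ near x.b x.p.supp x.base_le x.a :=
  ⟨x.p, le_rfl, x.a, S.res_refl _ _, rfl⟩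

variable (S S')

/-- A natural transformation of systems of sets. -/
structure Map where
  f : S.B → S'.B
  base_le : ∀ b, S'.base (f b) ⊆ S.base b
  F : ∀ {b : S.B} {τ : Z} (hτ : S.base b ⊆ (τ.1 : Set V)),
    S.F b τ hτ → S'.F (f b) τ ((base_le b).trans hτ)
  res : ∀ {b : S.B} {ρ τ : Z} (h : ρ ≤ τ) (hρ : S.base b ⊆ (ρ.1 : Set V))
    (a : S.F b τ (hρ.trans (Finset.coe_subset.2 h))),
    S'.res h ((base_le b).trans hρ) (F _ a) = F hρ (S.res h hρ a)

namespace Map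

variable {S S'} (Φ : Map S S')

/-- The map of realizations induced by a natural transformation. -/
def real (x : S.Realization) : S'.Realization :=
  ⟨Φ.f x.b, x.p, (Φ.base_le x.b).trans x.base_le, Φ.F x.base_le x.a⟩

theorem continuous_real : Continuous Φ.real := by
  refine continuous_def.2 fun A hA => ?_
  rw [isOpen_iff] at hA ⊢
  intro b τ hτ a
  have hc : Continuous (fun p : Cell Z τ (S.base b) =>
      (⟨p.pt, p.le, (Φ.base_le b).trans p.base_le⟩ : Cell Z τ (S'.base (Φ.f b)))) :=
    continuous_induced_rng.2 continuous_induced_dom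
  have := (hA (Φ.f b) τ _ (Φ.F hτ a)).preimage hc
  convert this using 1
  ext p
  have : Φ.real (S.chart b τ hτ a p) = S'.chart (Φ.f b) τ _ (Φ.F hτ a)
      ⟨p.pt, p.le, (Φ.base_le b).trans p.base_le⟩ := by
    simp only [real, chart]
    congr 1
    exact (Φ.res _ _ _).symm
  simp only [Set.mem_preimage, this]

/-- Restriction along `ρ ⊆ τ` is bijective relatively to the target. -/
structure Etale : Prop where
  inj : ∀ {b : S.B} {ρ τ : Z} (h : ρ ≤ τ) (hρ : S.base b ⊆ (ρ.1 : Set V))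
    (a a' : S.F b τ (hρ.trans (Finset.coe_subset.2 h))),
    S.res h hρ a = S.res h hρ a' → Φ.F _ a = Φ.F _ a' → a = a'
  surj : ∀ {b : S.B} {ρ τ : Z} (h : ρ ≤ τ) (hρ : S.base b ⊆ (ρ.1 : Set V))
    (a : S.F b ρ hρ) (c : S'.F (Φ.f b) τ (((Φ.base_le b).trans hρ).trans (Finset.coe_subset.2 h))),
    S'.res h ((Φ.base_le b).trans hρ) c = Φ.F hρ a →
    ∃ a' : S.F b τ (hρ.trans (Finset.coe_subset.2 h)), S.res h hρ a' = a ∧ Φ.F _ a' = c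

variable {Φ}

theorem Etale.isOpenMap (hΦ : Φ.Etale) : IsOpenMap Φ.real := by
  intro A hA
  rw [isOpen_iff]
  intro b' τ hτ c
  rw [isOpen_iff_mem_nhds]
  rintro p₀ ⟨⟨b, p, hb, a⟩, hxA, hx⟩
  obtain ⟨p₀, hp₀, hp₀'⟩ := p₀
  obtain rfl : Φ.f b = b' := congrArg Realization.b hx
  obtain rfl : p = p₀ := congrArg Realization.p hx
  have e : Φ.F hb a = S'.res hp₀ hp₀' c := by simpa [real, chart] using hx
  obtain ⟨a', rfl, rfl⟩ := hΦ.surj hp₀ hb a c e.symm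
  have hA' := (isOpen_iff A).1 hA b τ (hb.trans (Finset.coe_subset.2 hp₀)) a'
  obtain ⟨O, hO, hOe⟩ := isOpen_induced_iff.1 hA'
  have hopen := (isOpen_supp_ge τ (S'.base (Φ.f b)) p.supp).inter
    (hO.preimage (continuous_induced_dom (f := fun p : Cell Z τ (S'.base (Φ.f b)) => p.pt.coord)))
  refine Filter.mem_of_superset (hopen.mem_nhds ⟨le_refl p.supp, ?_⟩) ?_
  · have : (⟨p, hp₀, hb⟩ : Cell Z τ (S.base b)) ∈ S.chart b τ _ a' ⁻¹' A := hxA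
    rw [← hOe] at this
    exact this
  · rintro q ⟨hq1, hq2⟩
    have : (⟨q.pt, q.le, hb.trans (Finset.coe_subset.2 hq1)⟩ : Cell Z τ (S.base b)) ∈
        S.chart b τ _ a' ⁻¹' A := by
      rw [← hOe]; exact hq2
    refine ⟨_, this, ?_⟩
    simp only [real, chart]
    congr 1
    exact (Φ.res _ _ _).symm

theorem Etale.eq_of_mem_near (hΦ : Φ.Etale) {b : S.B} {ρ : Z} {hρ : S.base b ⊆ (ρ.1 : Set V)}
    {a : S.F b ρ hρ} {x y : S.Realization} (hx : x ∈ near b ρ hρ a) (hy : y ∈ near b ρ hρ a)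
    (h : Φ.real x = Φ.real y) : x = y := by
  obtain ⟨p, hp, a₁, h₁, rfl⟩ := hx
  obtain ⟨q, hq, a₂, h₂, rfl⟩ := hy
  obtain rfl : p = q := congrArg Realization.p h
  have e : Φ.F _ a₁ = Φ.F _ a₂ := by simpa [real] using h
  obtain rfl := hΦ.inj hp hρ a₁ a₂ (h₁.trans h₂.symm) e
  rfl

end Map

end CellSystem

end Systems

end Orbispaces

namespace Orbispaces

/-! ### Simplicial complexes of groups -/

/-- A simplicial complex of groups `(Z, G)` with vertex set `V`. -/
structure ComplexOfGroups (V : Type u) where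
  Z : AbstractSimplicialComplex V
  G : Z → Type u
  [group : ∀ σ, Group (G σ)]
  res : ∀ {σ τ : Z}, σ ≤ τ → (G τ →* G σ)
  res_injective : ∀ {σ τ : Z} (h : σ ≤ τ), Function.Injective (res h)
  tw : ∀ {ρ σ τ : Z}, ρ ≤ σ → σ ≤ τ → G ρ
  res_eq : ∀ {ρ σ τ : Z} (h : ρ ≤ σ) (h' : σ ≤ τ) (g : G τ),
    res (h.trans h') g = tw h h' * res h (res h' g) * (tw h h')⁻¹
  tw_cocycle : ∀ {π ρ σ τ : Z} (h₁ : π ≤ ρ) (h₂ : ρ ≤ σ) (h₃ : σ ≤ τ),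
    tw h₁ (h₂.trans h₃) * res h₁ (tw h₂ h₃) * (tw h₁ h₂)⁻¹ * (tw (h₁.trans h₂) h₃)⁻¹ = 1

attribute [instance] ComplexOfGroups.group

namespace ComplexOfGroups

variable {V : Type u} (𝒵 : ComplexOfGroups V)

/-- The vertex `v` as a simplex. -/
def vert (v : V) : 𝒵.Z := ⟨{v}, 𝒵.Z.singleton_mem v⟩

/-- The vertex group `G_v`. -/
abbrev vertexGroup (v : V) : Type u := 𝒵.G (𝒵.vert v)

/-- `Z` has dimension `≤ d`. -/
def DimLE (d : ℕ) : Prop := ∀ σ : 𝒵.Z, σ.1.card ≤ d + 1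

theorem vert_le {v : V} {τ : 𝒵.Z} (h : ({v} : Set V) ⊆ (τ.1 : Set V)) : 𝒵.vert v ≤ τ := by
  change ({v} : Finset V) ⊆ τ.1
  simpa using h

theorem tw_mul {π ρ σ τ : 𝒵.Z} (h₁ : π ≤ ρ) (h₂ : ρ ≤ σ) (h₃ : σ ≤ τ) :
    𝒵.tw (h₁.trans h₂) h₃ * 𝒵.tw h₁ h₂ = 𝒵.tw h₁ (h₂.trans h₃) * 𝒵.res h₁ (𝒵.tw h₂ h₃) := by
  have := 𝒵.tw_cocycle h₁ h₂ h₃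
  rw [mul_inv_eq_one, mul_inv_eq_iff_eq_mul] at this
  exact this.symm

theorem tw_self {σ τ : 𝒵.Z} (h : σ ≤ τ) : 𝒵.tw h le_rfl = 𝒵.res h (𝒵.tw le_rfl le_rfl) := by
  have := 𝒵.tw_mul h (le_refl τ) (le_refl τ)
  exact mul_left_cancel this

theorem res_mul_tw {ρ σ τ : 𝒵.Z} (h : ρ ≤ σ) (h' : σ ≤ τ) (g : 𝒵.G τ) :
    𝒵.res (h.trans h') g * 𝒵.tw h h' = 𝒵.tw h h' * 𝒵.res h (𝒵.res h' g) := by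
  rw [𝒵.res_eq h h']; group

theorem coset_refl {σ τ : 𝒵.Z} (h : σ ≤ τ) (g : 𝒵.G σ) :
    𝒵.res h (𝒵.tw le_rfl le_rfl)⁻¹ = (g * 𝒵.tw h le_rfl)⁻¹ * g := by
  rw [𝒵.tw_self h, map_inv]; group

theorem coset_res {π ρ σ τ : 𝒵.Z} (h₁ : π ≤ ρ) (h₂ : ρ ≤ σ) (h₃ : σ ≤ τ) (g : 𝒵.G π) :
    𝒵.res h₁ (𝒵.tw h₂ h₃)⁻¹ =
      (g * 𝒵.tw (h₁.trans h₂) h₃ * 𝒵.tw h₁ h₂)⁻¹ * (g * 𝒵.tw h₁ (h₂.trans h₃)) := by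
  rw [mul_assoc g, 𝒵.tw_mul, map_inv]; group

theorem coset_map {ρ σ τ : 𝒵.Z} (h : ρ ≤ σ) (h' : σ ≤ τ) (g : 𝒵.G ρ) (k : 𝒵.G τ) :
    𝒵.res h (𝒵.res h' k) =
      (g * 𝒵.tw h h')⁻¹ * (g * 𝒵.res (h.trans h') k * 𝒵.tw h h') := by
  rw [mul_assoc g, 𝒵.res_mul_tw]; group

/-- The charts of `‖(Z, G)‖`, one for each vertex `v`: the local development of the open star of
`v`, glued from one copy of (the part in the open star of `v` of) the simplex `τ` for every coset
in `G_v / G_τ`. -/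
def objSystem : CellSystem 𝒵.Z where
  B := V
  base v := {v}
  F v _ h := 𝒵.vertexGroup v ⧸ (𝒵.res (𝒵.vert_le h)).range
  res {v ρ τ} h hρ := Quotient.map' (fun g => g * 𝒵.tw (𝒵.vert_le hρ) h) (by
    intro a b hab
    rw [QuotientGroup.leftRel_apply] at hab ⊢
    obtain ⟨k, hk⟩ := hab
    obtain rfl : b = a * 𝒵.res ((𝒵.vert_le hρ).trans h) k := by rw [hk]; group
    exact ⟨𝒵.res h k, 𝒵.coset_map _ _ _ _⟩)
  res_refl {v τ} hτ a := by
    induction a using Quotient.inductionOn' with | _ a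
    refine Quotient.sound' ?_
    rw [QuotientGroup.leftRel_apply]
    exact ⟨(𝒵.tw le_rfl le_rfl)⁻¹, 𝒵.coset_refl _ _⟩
  res_res {v ρ σ τ} h h' hρ a := by
    induction a using Quotient.inductionOn' with | _ a
    refine Quotient.sound' ?_
    rw [QuotientGroup.leftRel_apply]
    exact ⟨(𝒵.tw h h')⁻¹, 𝒵.coset_res _ _ _ _⟩

/-- The morphisms between the charts at `v` and `w`, the fibre product of the two charts over
`‖(Z, G)‖`: over the simplex `τ ∋ v, w` these are the pairs of cosets in `G_v / G_τ` and
`G_w / G_τ` together with an identification of the underlying `G_τ`-orbits, i.e. the elements of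
`(G_v × G_w) / G_τ`. -/
def morSystem : CellSystem 𝒵.Z where
  B := V × V
  base b := {b.1} ∪ {b.2}
  F b _ h := (𝒵.vertexGroup b.1 × 𝒵.vertexGroup b.2) ⧸
    ((𝒵.res (𝒵.vert_le (Set.subset_union_left.trans h))).prod
      (𝒵.res (𝒵.vert_le (Set.subset_union_right.trans h)))).range
  res {b ρ τ} h hρ := Quotient.map' (fun g =>
      (g.1 * 𝒵.tw (𝒵.vert_le (Set.subset_union_left.trans hρ)) h,
        g.2 * 𝒵.tw (𝒵.vert_le (Set.subset_union_right.trans hρ)) h)) (by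
    intro a a' hab
    rw [QuotientGroup.leftRel_apply] at hab ⊢
    obtain ⟨k, hk⟩ := hab
    obtain rfl : a' = a * (𝒵.res _ k, 𝒵.res _ k) := by
      rw [← MonoidHom.prod_apply, hk]; group
    exact ⟨𝒵.res h k, Prod.ext (𝒵.coset_map _ _ _ _) (𝒵.coset_map _ _ _ _)⟩)
  res_refl {b τ} hτ a := by
    induction a using Quotient.inductionOn' with | _ a
    refine Quotient.sound' ?_
    rw [QuotientGroup.leftRel_apply]
    exact ⟨(𝒵.tw le_rfl le_rfl)⁻¹, Prod.ext (𝒵.coset_refl _ _) (𝒵.coset_refl _ _)⟩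
  res_res {b ρ σ τ} h h' hρ a := by
    induction a using Quotient.inductionOn' with | _ a
    refine Quotient.sound' ?_
    rw [QuotientGroup.leftRel_apply]
    exact ⟨(𝒵.tw h h')⁻¹, Prod.ext (𝒵.coset_res _ _ _ _) (𝒵.coset_res _ _ _ _)⟩

/-- The class in `G_v / G_τ` of an element of `G_v`. -/
def objMk {v : V} {τ : 𝒵.Z} (h : 𝒵.objSystem.base v ⊆ (τ.1 : Set V)) (g : 𝒵.vertexGroup v) :
    𝒵.objSystem.F v τ h := Quotient.mk'' g

/-- The class in `(G_v × G_w) / G_τ` of a pair. -/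
def morMk {b : V × V} {τ : 𝒵.Z} (h : 𝒵.morSystem.base b ⊆ (τ.1 : Set V)) (g : 𝒵.vertexGroup b.1)
    (g' : 𝒵.vertexGroup b.2) : 𝒵.morSystem.F b τ h := Quotient.mk'' (g, g')

theorem objMk_eq {v : V} {τ : 𝒵.Z} (h : 𝒵.objSystem.base v ⊆ (τ.1 : Set V))
    (g k : 𝒵.vertexGroup v) : 𝒵.objMk h g = 𝒵.objMk h k ↔
      ∃ x : 𝒵.G τ, k = g * 𝒵.res (𝒵.vert_le h) x := by
  refine Quotient.eq''.trans ?_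
  rw [QuotientGroup.leftRel_apply]
  constructor
  · rintro ⟨x, hx⟩
    exact ⟨x, by rw [hx]; group⟩
  · rintro ⟨x, rfl⟩
    exact ⟨x, by group⟩

theorem morMk_eq {b : V × V} {τ : 𝒵.Z} (h : 𝒵.morSystem.base b ⊆ (τ.1 : Set V))
    (g k : 𝒵.vertexGroup b.1) (g' k' : 𝒵.vertexGroup b.2) :
    𝒵.morMk h g g' = 𝒵.morMk h k k' ↔
      ∃ x : 𝒵.G τ, k = g * 𝒵.res (𝒵.vert_le (Set.subset_union_left.trans h)) x ∧
        k' = g' * 𝒵.res (𝒵.vert_le (Set.subset_union_right.trans h)) x := by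
  refine Quotient.eq''.trans ?_
  rw [QuotientGroup.leftRel_apply]
  constructor
  · rintro ⟨x, hx⟩
    have h1 := congrArg Prod.fst hx
    have h2 := congrArg Prod.snd hx
    simp only [MonoidHom.prod_apply, Prod.fst_mul, Prod.fst_inv, Prod.snd_mul, Prod.snd_inv]
      at h1 h2
    exact ⟨x, by rw [h1]; group, by rw [h2]; group⟩
  · rintro ⟨x, rfl, rfl⟩
    exact ⟨x, Prod.ext (by simp) (by simp)⟩

theorem objMk_surj {v : V} {τ : 𝒵.Z} {h : 𝒵.objSystem.base v ⊆ (τ.1 : Set V)}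
    (a : 𝒵.objSystem.F v τ h) : ∃ g, a = 𝒵.objMk h g := by
  induction a using Quotient.inductionOn' with | _ a
  exact ⟨a, rfl⟩

theorem morMk_surj {b : V × V} {τ : 𝒵.Z} {h : 𝒵.morSystem.base b ⊆ (τ.1 : Set V)}
    (a : 𝒵.morSystem.F b τ h) : ∃ g g', a = 𝒵.morMk h g g' := by
  induction a using Quotient.inductionOn' with | _ a
  exact ⟨a.1, a.2, rfl⟩

theorem objRes_mk {v : V} {ρ τ : 𝒵.Z} (h : ρ ≤ τ) (hρ : 𝒵.objSystem.base v ⊆ (ρ.1 : Set V))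
    (g : 𝒵.vertexGroup v) :
    𝒵.objSystem.res h hρ (𝒵.objMk _ g) = 𝒵.objMk hρ (g * 𝒵.tw (𝒵.vert_le hρ) h) := rfl

theorem morRes_mk {b : V × V} {ρ τ : 𝒵.Z} (h : ρ ≤ τ)
    (hρ : 𝒵.morSystem.base b ⊆ (ρ.1 : Set V)) (g : 𝒵.vertexGroup b.1) (g' : 𝒵.vertexGroup b.2) :
    𝒵.morSystem.res h hρ (𝒵.morMk _ g g') =
      𝒵.morMk hρ (g * 𝒵.tw (𝒵.vert_le (Set.subset_union_left.trans hρ)) h)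
        (g' * 𝒵.tw (𝒵.vert_le (Set.subset_union_right.trans hρ)) h) := rfl

/-- The source `[g, g'] ↦ [g]`. -/
def srcMap : 𝒵.morSystem.Map 𝒵.objSystem where
  f := Prod.fst
  base_le _ := Set.subset_union_left
  F {b τ} hτ := Quotient.map' Prod.fst (by
    intro a a' h
    rw [QuotientGroup.leftRel_apply] at h ⊢
    obtain ⟨k, hk⟩ := h
    exact ⟨k, congrArg Prod.fst hk⟩)
  res h hρ a := by
    obtain ⟨g, g', rfl⟩ := 𝒵.morMk_surj a
    rfl

/-- The target `[g, g'] ↦ [g']`. -/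
def tgtMap : 𝒵.morSystem.Map 𝒵.objSystem where
  f := Prod.snd
  base_le _ := Set.subset_union_right
  F {b τ} hτ := Quotient.map' Prod.snd (by
    intro a a' h
    rw [QuotientGroup.leftRel_apply] at h ⊢
    obtain ⟨k, hk⟩ := h
    exact ⟨k, congrArg Prod.snd hk⟩)
  res h hρ a := by
    obtain ⟨g, g', rfl⟩ := 𝒵.morMk_surj a
    rfl

/-- The identities `[g] ↦ [g, g]`. -/
def oneMap : 𝒵.objSystem.Map 𝒵.morSystem where
  f v := (v, v)
  base_le _ := Set.union_subset subset_rfl subset_rfl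
  F {b τ} hτ := Quotient.map' (fun g => (g, g)) (by
    intro a a' h
    rw [QuotientGroup.leftRel_apply] at h ⊢
    obtain ⟨k, hk⟩ := h
    exact ⟨k, Prod.ext hk hk⟩)
  res h hρ a := by
    obtain ⟨g, rfl⟩ := 𝒵.objMk_surj a
    rfl

/-- The inverses `[g, g'] ↦ [g', g]`. -/
def invMap : 𝒵.morSystem.Map 𝒵.morSystem where
  f := Prod.swap
  base_le _ := (Set.union_comm _ _).subset
  F {b τ} hτ := Quotient.map' Prod.swap (by
    intro a a' h
    rw [QuotientGroup.leftRel_apply] at h ⊢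
    obtain ⟨k, hk⟩ := h
    exact ⟨k, congrArg Prod.swap hk⟩)
  res h hρ a := by
    obtain ⟨g, g', rfl⟩ := 𝒵.morMk_surj a
    rfl

theorem etale_srcMap : 𝒵.srcMap.Etale where
  inj {b ρ τ} h hρ a a' h1 h2 := by
    obtain ⟨g, g', rfl⟩ := 𝒵.morMk_surj a
    obtain ⟨k, k', rfl⟩ := 𝒵.morMk_surj a'
    obtain ⟨x, rfl⟩ := (𝒵.objMk_eq _ g k).1 h2
    obtain ⟨y, hy1, hy2⟩ := (𝒵.morMk_eq _ _ _ _ _).1 h1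
    rw [mul_assoc, mul_assoc, 𝒵.res_mul_tw, mul_right_inj, mul_right_inj] at hy1
    obtain rfl := 𝒵.res_injective _ hy1
    rw [mul_assoc, ← 𝒵.res_mul_tw, ← mul_assoc, mul_left_inj] at hy2
    exact (𝒵.morMk_eq _ _ _ _ _).2 ⟨x, rfl, hy2⟩
  surj {b ρ τ} h hρ a c hc := by
    obtain ⟨g, g', rfl⟩ := 𝒵.morMk_surj a
    obtain ⟨k, rfl⟩ := 𝒵.objMk_surj c
    obtain ⟨x, hx⟩ := (𝒵.objMk_eq _ _ _).1 hc
    refine ⟨𝒵.morMk _ k (g' * (𝒵.res (𝒵.vert_le (Set.subset_union_right.trans hρ)) x)⁻¹ *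
      (𝒵.tw (𝒵.vert_le (Set.subset_union_right.trans hρ)) h)⁻¹), ?_, rfl⟩
    exact (𝒵.morMk_eq _ _ _ _ _).2 ⟨x, hx, by group⟩

/-- The composition relation `[g, g'] · [g', g''] = [g, g'']`. -/
inductive IsComp : 𝒵.morSystem.Realization → 𝒵.morSystem.Realization →
    𝒵.morSystem.Realization → Prop
  | mk (v w u : V) (p : RealPt 𝒵.Z) (hvw : 𝒵.morSystem.base (v, w) ⊆ (p.supp.1 : Set V))
      (hwu : 𝒵.morSystem.base (w, u) ⊆ (p.supp.1 : Set V))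
      (hvu : 𝒵.morSystem.base (v, u) ⊆ (p.supp.1 : Set V))
      (g : 𝒵.vertexGroup v) (g' : 𝒵.vertexGroup w) (g'' : 𝒵.vertexGroup u) :
      IsComp ⟨(v, w), p, hvw, 𝒵.morMk hvw g g'⟩ ⟨(w, u), p, hwu, 𝒵.morMk hwu g' g''⟩
        ⟨(v, u), p, hvu, 𝒵.morMk hvu g g''⟩

theorem exists_isComp (a b : 𝒵.morSystem.Realization) (h : 𝒵.tgtMap.real a = 𝒵.srcMap.real b) :
    ∃ c, 𝒵.IsComp a b c := by
  obtain ⟨⟨v, w⟩, p, hvw, a⟩ := a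
  obtain ⟨⟨w', u⟩, q, hwu, b⟩ := b
  obtain rfl : w = w' := congrArg CellSystem.Realization.b h
  obtain rfl : p = q := congrArg CellSystem.Realization.p h
  obtain ⟨g, g', rfl⟩ := 𝒵.morMk_surj a
  obtain ⟨k', k, rfl⟩ := 𝒵.morMk_surj b
  have e : 𝒵.objMk (v := w) (Set.subset_union_right.trans hvw) g' = 𝒵.objMk _ k' :=
    CellSystem.Realization.a_inj (S := 𝒵.objSystem) h
  obtain ⟨x, rfl⟩ := (𝒵.objMk_eq _ _ _).1 e
  have hvu : 𝒵.morSystem.base (v, u) ⊆ (p.supp.1 : Set V) :=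
    Set.union_subset (Set.subset_union_left.trans hvw) (Set.subset_union_right.trans hwu)
  have e2 : 𝒵.morMk hvw g g' = 𝒵.morMk hvw
      (g * 𝒵.res (𝒵.vert_le (Set.subset_union_left.trans hvw)) x)
      (g' * 𝒵.res (𝒵.vert_le (Set.subset_union_right.trans hvw)) x) :=
    (𝒵.morMk_eq _ _ _ _ _).2 ⟨x, rfl, rfl⟩
  rw [e2]
  exact ⟨_, IsComp.mk v w u p hvw hwu hvu _ _ _⟩

variable {𝒵}

theorem IsComp.src {a b c : 𝒵.morSystem.Realization} (h : 𝒵.IsComp a b c) :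
    𝒵.srcMap.real c = 𝒵.srcMap.real a := by
  cases h; rfl

theorem IsComp.tgt {a b c : 𝒵.morSystem.Realization} (h : 𝒵.IsComp a b c) :
    𝒵.tgtMap.real c = 𝒵.tgtMap.real b := by
  cases h; rfl

/-- Composition is compatible with restriction. -/
theorem IsComp.near {a b c : 𝒵.morSystem.Realization} (h : 𝒵.IsComp a b c)
    {a' b' c' : 𝒵.morSystem.Realization} (h' : 𝒵.IsComp a' b' c')
    (ha : a' ∈ CellSystem.near a.b a.p.supp a.base_le a.a)
    (hb : b' ∈ CellSystem.near b.b b.p.supp b.base_le b.a) :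
    c' ∈ CellSystem.near c.b c.p.supp c.base_le c.a := by
  cases h with | mk v w u p hvw hwu hvu g g' g''
  cases h' with | mk v' w' u' q hvw' hwu' hvu' k k' k''
  obtain ⟨p₁, hp₁, a₁, ha₁, ea⟩ := ha
  obtain ⟨p₂, hp₂, b₁, hb₁, eb⟩ := hb
  obtain rfl : q = p₁ := congrArg CellSystem.Realization.p ea
  obtain rfl : q = p₂ := congrArg CellSystem.Realization.p eb
  have e1 := congrArg CellSystem.Realization.b ea
  have e2 := congrArg CellSystem.Realization.b eb
  dsimp only at e1 e2
  obtain ⟨rfl, rfl⟩ := Prod.mk.inj e1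
  obtain ⟨-, rfl⟩ := Prod.mk.inj e2
  have ea' : 𝒵.morMk hvw' k k' = a₁ := CellSystem.Realization.a_inj ea
  have eb' : 𝒵.morMk hwu' k' k'' = b₁ := CellSystem.Realization.a_inj eb
  subst ea' eb'
  obtain ⟨x, hx1, hx2⟩ := (𝒵.morMk_eq _ _ _ _ _).1 ha₁
  obtain ⟨y, hy1, hy2⟩ := (𝒵.morMk_eq _ _ _ _ _).1 hb₁
  obtain rfl : x = y := by
    apply 𝒵.res_injective (𝒵.vert_le (Set.subset_union_right.trans hvw))
    have := hx2.symm.trans hy1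
    exact mul_left_cancel this
  exact ⟨q, hp₁, 𝒵.morMk hvu' k k'', (𝒵.morMk_eq _ _ _ _ _).2 ⟨x, hx1, hy2⟩, rfl⟩

theorem IsComp.unique {a b c c' : 𝒵.morSystem.Realization} (h : 𝒵.IsComp a b c)
    (h' : 𝒵.IsComp a b c') : c = c' :=
  𝒵.etale_srcMap.eq_of_mem_near
    (h.near h (CellSystem.mem_near _) (CellSystem.mem_near _))
    (h.near h' (CellSystem.mem_near _) (CellSystem.mem_near _)) (h.src.trans h'.src.symm)

variable (𝒵)

/-- Composition of morphisms. -/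
noncomputable def comp (a b : 𝒵.morSystem.Realization)
    (h : 𝒵.tgtMap.real a = 𝒵.srcMap.real b) : 𝒵.morSystem.Realization :=
  (𝒵.exists_isComp a b h).choose

theorem isComp_comp (a b : 𝒵.morSystem.Realization) (h : 𝒵.tgtMap.real a = 𝒵.srcMap.real b) :
    𝒵.IsComp a b (𝒵.comp a b h) :=
  (𝒵.exists_isComp a b h).choose_spec

theorem eq_comp {a b c : 𝒵.morSystem.Realization} (h : 𝒵.tgtMap.real a = 𝒵.srcMap.real b)
    (h' : 𝒵.IsComp a b c) : 𝒵.comp a b h = c :=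
  (𝒵.isComp_comp a b h).unique h'

theorem exists_eq_mk (a : 𝒵.morSystem.Realization) : ∃ v w p hvw g g',
    a = ⟨(v, w), p, hvw, 𝒵.morMk hvw g g'⟩ := by
  obtain ⟨⟨v, w⟩, p, hvw, a⟩ := a
  obtain ⟨g, g', rfl⟩ := 𝒵.morMk_surj a
  exact ⟨v, w, p, hvw, g, g', rfl⟩

theorem assoc' {a b c ab bc : 𝒵.morSystem.Realization} (h1 : 𝒵.IsComp a b ab)
    (h2 : 𝒵.IsComp b c bc) : ∃ abc, 𝒵.IsComp ab c abc ∧ 𝒵.IsComp a bc abc := by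
  obtain ⟨c1, hc1⟩ := 𝒵.exists_isComp ab c (h1.tgt.trans (by cases h2; rfl))
  obtain ⟨c2, hc2⟩ := 𝒵.exists_isComp a bc (Eq.trans (by cases h1; rfl) h2.src.symm)
  refine ⟨c1, hc1, ?_⟩
  convert hc2
  cases h1 with | mk v w u p hvw hwu hvu g g' g''
  obtain ⟨⟨u', z⟩, q, hcb, c0⟩ := c
  have e : 𝒵.tgtMap.real ⟨(w, u), p, hwu, 𝒵.morMk hwu g' g''⟩ =
    𝒵.srcMap.real ⟨(u', z), q, hcb, c0⟩ := by
    generalize hb : (⟨(w, u), p, hwu, 𝒵.morMk hwu g' g''⟩ : 𝒵.morSystem.Realization) = b at h2 ⊢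
    generalize hc : (⟨(u', z), q, hcb, c0⟩ : 𝒵.morSystem.Realization) = c at h2 ⊢
    cases h2; rfl
  obtain rfl : u = u' := congrArg CellSystem.Realization.b e
  obtain rfl : p = q := congrArg CellSystem.Realization.p e
  obtain ⟨k', k, rfl⟩ := 𝒵.morMk_surj c0
  have e' : 𝒵.objMk (v := u) (Set.subset_union_right.trans hwu) g'' = 𝒵.objMk _ k' :=
    CellSystem.Realization.a_inj (S := 𝒵.objSystem) e
  obtain ⟨x, rfl⟩ := (𝒵.objMk_eq _ _ _).1 e'
  have ec : 𝒵.morMk hcb (g'' * 𝒵.res (𝒵.vert_le (Set.subset_union_left.trans hcb)) x) k =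
      𝒵.morMk hcb g''
        (k * (𝒵.res (𝒵.vert_le (Set.subset_union_right.trans hcb)) x)⁻¹) :=
    (𝒵.morMk_eq _ _ _ _ _).2 ⟨x⁻¹, by rw [map_inv]; group, by rw [map_inv]⟩
  rw [ec] at hc1 h2
  have hwz : 𝒵.morSystem.base (w, z) ⊆ (p.supp.1 : Set V) :=
    Set.union_subset (Set.subset_union_left.trans hwu) (Set.subset_union_right.trans hcb)
  have hvz : 𝒵.morSystem.base (v, z) ⊆ (p.supp.1 : Set V) :=
    Set.union_subset (Set.subset_union_left.trans hvu) (Set.subset_union_right.trans hcb)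
  obtain rfl := h2.unique (IsComp.mk w u z p hwu hcb hwz g' g'' _)
  obtain rfl := hc1.unique (IsComp.mk v u z p hvu hcb hvz g g'' _)
  exact (hc2.unique (IsComp.mk v w z p hvw hwz hvz g g' _)).symm

theorem continuous_comp : Continuous fun x : {x : 𝒵.morSystem.Realization ×
    𝒵.morSystem.Realization // 𝒵.tgtMap.real x.1 = 𝒵.srcMap.real x.2} =>
      𝒵.comp x.1.1 x.1.2 x.2 := by
  refine continuous_def.2 fun W hW => isOpen_iff_mem_nhds.2 ?_
  rintro ⟨⟨a, b⟩, h⟩ hc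
  have hab := 𝒵.isComp_comp a b h
  set c := 𝒵.comp a b h with hcdef
  have hW' := 𝒵.etale_srcMap.isOpenMap _
    (hW.inter (CellSystem.isOpen_near c.b c.p.supp c.base_le c.a))
  have hopen : IsOpen {x : {x : 𝒵.morSystem.Realization × 𝒵.morSystem.Realization //
      𝒵.tgtMap.real x.1 = 𝒵.srcMap.real x.2} |
      (x.1.1 ∈ CellSystem.near a.b a.p.supp a.base_le a.a ∧
        x.1.2 ∈ CellSystem.near b.b b.p.supp b.base_le b.a) ∧
        𝒵.srcMap.real x.1.1 ∈ 𝒵.srcMap.real ''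
          (W ∩ CellSystem.near c.b c.p.supp c.base_le c.a)} := by
    refine IsOpen.inter (IsOpen.inter ?_ ?_) ?_
    · exact (CellSystem.isOpen_near _ _ _ _).preimage (by fun_prop)
    · exact (CellSystem.isOpen_near _ _ _ _).preimage (by fun_prop)
    · exact hW'.preimage (𝒵.srcMap.continuous_real.comp (by fun_prop))
  refine Filter.mem_of_superset (hopen.mem_nhds
    ⟨⟨CellSystem.mem_near a, CellSystem.mem_near b⟩,
      c, ⟨hc, CellSystem.mem_near c⟩, hab.src⟩) ?_
  rintro ⟨⟨a', b'⟩, h'⟩ ⟨⟨ha, hb⟩, c', ⟨hc'W, hc'⟩, hs⟩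
  have hab' := 𝒵.isComp_comp a' b' h'
  have := 𝒵.etale_srcMap.eq_of_mem_near hc' (hab.near hab' ha hb) (hs.trans hab'.src.symm)
  change 𝒵.comp a' b' h' ∈ W
  rwa [← this]

/-- The topological groupoid presenting `‖(Z, G)‖`. -/
noncomputable def groupoid : TopGroupoid.{u} where
  O := 𝒵.objSystem.Realization
  M := 𝒵.morSystem.Realization
  src := 𝒵.srcMap.real
  tgt := 𝒵.tgtMap.real
  one := 𝒵.oneMap.real
  inv := 𝒵.invMap.real
  comp := 𝒵.comp
  src_one x := by
    obtain ⟨v, p, h, a⟩ := x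
    obtain ⟨g, rfl⟩ := 𝒵.objMk_surj a
    rfl
  tgt_one x := by
    obtain ⟨v, p, h, a⟩ := x
    obtain ⟨g, rfl⟩ := 𝒵.objMk_surj a
    rfl
  src_inv a := by
    obtain ⟨v, w, p, hvw, g, g', rfl⟩ := 𝒵.exists_eq_mk a
    rfl
  tgt_inv a := by
    obtain ⟨v, w, p, hvw, g, g', rfl⟩ := 𝒵.exists_eq_mk a
    rfl
  src_comp a b h := (𝒵.isComp_comp a b h).src
  tgt_comp a b h := (𝒵.isComp_comp a b h).tgt
  one_comp a h := by
    obtain ⟨v, w, p, hvw, g, g', rfl⟩ := 𝒵.exists_eq_mk a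
    exact 𝒵.eq_comp _ (IsComp.mk v v w p _ _ _ g g g')
  comp_one a h := by
    obtain ⟨v, w, p, hvw, g, g', rfl⟩ := 𝒵.exists_eq_mk a
    exact 𝒵.eq_comp _ (IsComp.mk v w w p _ _ _ g g' g')
  comp_inv a h := by
    obtain ⟨v, w, p, hvw, g, g', rfl⟩ := 𝒵.exists_eq_mk a
    exact 𝒵.eq_comp _ (IsComp.mk v w v p _ _ _ g g' g)
  inv_comp a h := by
    obtain ⟨v, w, p, hvw, g, g', rfl⟩ := 𝒵.exists_eq_mk a
    exact 𝒵.eq_comp _ (IsComp.mk w v w p _ _ _ g' g g')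
  assoc a b c hab hbc h h' := by
    obtain ⟨abc, h1, h2⟩ := 𝒵.assoc' (𝒵.isComp_comp a b hab) (𝒵.isComp_comp b c hbc)
    rw [𝒵.eq_comp h h1, 𝒵.eq_comp h' h2]
  continuous_src := 𝒵.srcMap.continuous_real
  continuous_tgt := 𝒵.tgtMap.continuous_real
  continuous_one := 𝒵.oneMap.continuous_real
  continuous_inv := 𝒵.invMap.continuous_real
  continuous_comp := 𝒵.continuous_comp

/-- The stack `‖(Z, G)‖`. -/
noncomputable def realization : TopPrestack.{u} := 𝒵.groupoid.stack

end ComplexOfGroups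

/-- Every vertex group of `(Z, G)` is isomorphic to the isotropy group of some point of `X`. -/
def ComplexOfGroups.VertexGroupsAreIsotropyOf {V : Type u} (𝒵 : ComplexOfGroups V)
    (X : TopPrestack.{u}) : Prop :=
  ∀ v : V, ∃ x : X.Fib TopPrestack.pt, Nonempty (𝒵.vertexGroup v ≃* Aut x)

end Orbispaces

/-!
# Orbispaces map to complexes of groups

An étale atlas `U → X` presents `X` by the topological groupoid `𝒰 = (U ×_X U ⇉ U)`. It is étale,
its diagonal is separated and proper, and its orbit space is `|X|`. Local lifts to the atlas give a
map of stacks `Presentation.toStack` from `X` to the stack of `𝒰` which is faithful on points, so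
that it is enough to construct a functor from `𝒰`, defined on an open cover, to the groupoid of a
complex of groups, which is injective on the arrows with given ends
(`Presentation.exists_injectiveOnIsotropy`).

*Local structure.* Isotropy groups are finite, and every point `i` has a neighbourhood `Y i` on
whose arrows there is a locally constant homomorphism `hol` to the isotropy group `Γ i` of `i`, with
trivial kernel (`IsEtaleProper.nonempty_chart`). A *frame* of `i` at `y` is an arrow from `y` to a
point of `Y i`. Two frames `m` and `m'` at `y` differ by `diff m m' = hol (m⁻¹ m') ∈ Γ i`, and they
are equal if their difference is trivial. Near a point `x` where frames of `i` and `j` exist, the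
isotropy group of `x` embeds into `Γ i` and `Γ j`, compatibly with differences of frames
(`LocalModel`). So a frame of `i` and a frame of `j` at the same point have a *relative position*
`LocalModel.rel m m' ⊆ Γ i × Γ j`, which is a translate of the image of this group. It is invariant
under arrows and locally constant.

*Globalization.* As `|X|` is paracompact and Hausdorff, there is an open cover such that, over each
locally finite refinement `t`, these data form a `FramedCover`
(`IsEtaleProper.exists_framedCover`): for every member of `t` a group `Γ a`, which is an isotropy
group, and notions of frames, differences and relative positions, together with a partition of
unity `φ` on `|X|` subordinate to `t`.

*The complex of groups.* For a finite set `τ` of members of `t` whose intersection contains the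
image of a point `y`, the relative positions of frames at `y` form a `Family`, well-defined up to
the action of `∏ a ∈ τ, Γ a`. The pairs of a set `τ` and such an isomorphism class form a partially
ordered set, and the simplices of the complex are its chains. So the dimension is at most that of
the nerve of `t` (`TypeSystem.card_le_card_top`). The group of a chain is the automorphism group of
the family at the top of the chain (`TypeSystem.complexOfGroups`), except that the group of a single
vertex is one of the groups `Γ a`. The restriction maps are injective because an automorphism of a
relative position is determined by either of its two components (`FramedCover.rel_free`).

*The map.* The partition of unity sends a point `y` to a point of a simplex whose vertices are the
sets of the `a` with largest `φ a y`, with the isomorphism class of the relative positions at `y`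
(`FramedCover.pt`). Over this point, frames at `y` can be compared with the family of the simplex,
so that pairs of frames at the ends of an arrow give an arrow in the groupoid of the complex of
groups. This is the functor `FramedCover.cechFunctor`; it is injective on the arrows with given ends
since a frame is determined by its difference to another one.
-/

namespace Orbispaces

open Pseudofunctor.LocallyDiscreteOpToCat

/-! ### Germs of morphisms in a prestack -/

namespace TopPrestack

variable (X : TopPrestack.{u})

/-- The inclusion of the point `t` into `T`. -/
abbrev ptMap {T : TopCat.{u}} (t : T) : pt.{u} ⟶ T :=
  TopCat.ofHom (ContinuousMap.const PUnit.{u + 1} t)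

variable {X}

section

variable {S T R : TopCat.{u}} {M₁ : X.Fib S} {M₂ : X.Fib T} {M₃ : X.Fib R} {Y : TopCat.{u}}
  {f₁ : Y ⟶ S} {f₂ : Y ⟶ T} {f₃ : Y ⟶ R}

theorem pullHom_comp (φ : X.pull f₁ M₁ ⟶ X.pull f₂ M₂) (ψ : X.pull f₂ M₂ ⟶ X.pull f₃ M₃)
    {Y' : TopCat.{u}} (g : Y' ⟶ Y) (g₁ : Y' ⟶ S) (g₂ : Y' ⟶ T) (g₃ : Y' ⟶ R)
    (h₁ : g ≫ f₁ = g₁) (h₂ : g ≫ f₂ = g₂) (h₃ : g ≫ f₃ = g₃) :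
    pullHom (φ ≫ ψ) g g₁ g₃ h₁ h₃ = pullHom φ g g₁ g₂ h₁ h₂ ≫ pullHom ψ g g₂ g₃ h₂ h₃ := by
  simp [pullHom]

theorem pullHom_id' {Y' : TopCat.{u}} (g : Y' ⟶ Y) (g₁ : Y' ⟶ S)
    (h₁ : g ≫ f₁ = g₁) :
    pullHom (F := X) (𝟙 (X.pull f₁ M₁)) g g₁ g₁ h₁ h₁ = 𝟙 _ := by
  simp [pullHom]

/-- The value at `y ∈ Y` of a morphism between pullbacks to `Y`. -/
def germ (φ : X.pull f₁ M₁ ⟶ X.pull f₂ M₂) (y : Y) (s : S) (t : T) (hs : f₁ y = s)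
    (ht : f₂ y = t) : X.fibreAt M₁ s ⟶ X.fibreAt M₂ t :=
  pullHom φ (ptMap y) (ptMap s) (ptMap t) (by subst hs; rfl) (by subst ht; rfl)

theorem germ_comp (φ : X.pull f₁ M₁ ⟶ X.pull f₂ M₂) (ψ : X.pull f₂ M₂ ⟶ X.pull f₃ M₃)
    (y : Y) (s : S) (t : T) (r : R) (hs : f₁ y = s) (ht : f₂ y = t) (hr : f₃ y = r) :
    germ (φ ≫ ψ) y s r hs hr = germ φ y s t hs ht ≫ germ ψ y t r ht hr :=
  pullHom_comp _ _ _ _ _ _ _ _ _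

theorem germ_id (y : Y) (s : S) (hs : f₁ y = s) :
    germ (𝟙 (X.pull f₁ M₁)) y s s hs hs = 𝟙 _ :=
  pullHom_id' _ _ _

theorem germ_pullHom (φ : X.pull f₁ M₁ ⟶ X.pull f₂ M₂) {Y' : TopCat.{u}} (g : Y' ⟶ Y)
    (g₁ : Y' ⟶ S) (g₂ : Y' ⟶ T) (h₁ : g ≫ f₁ = g₁) (h₂ : g ≫ f₂ = g₂) (y : Y') (s : S) (t : T)
    (hs : g₁ y = s) (ht : g₂ y = t) :
    germ (pullHom φ g g₁ g₂ h₁ h₂) y s t hs ht =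
      germ φ (g y) s t (by subst h₁; exact hs) (by subst h₂; exact ht) := by
  unfold germ
  rw [pullHom_pullHom]
  rfl

theorem germ_inv [∀ T, IsGroupoid (X.Fib T)] (φ : X.pull f₁ M₁ ⟶ X.pull f₂ M₂)
    (y : Y) (s : S) (t : T) (hs : f₁ y = s) (ht : f₂ y = t) :
    germ (CategoryTheory.inv φ) y t s ht hs = CategoryTheory.inv (germ φ y s t hs ht) := by
  rw [← cancel_epi (germ φ y s t hs ht), ← germ_comp]
  simp [germ_id]

end

end TopPrestack

/-! ### The groupoid presented by an atlas -/

namespace TopPrestack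

/-- A map `x : U → X` from a space together with a space `M` representing `U ×_X U`. -/
structure Presentation (X : TopPrestack.{u}) where
  U : TopCat.{u}
  x : X.Fib U
  M : TopCat.{u}
  p : M ⟶ U
  q : M ⟶ U
  θ : X.pull p x ≅ X.pull q x
  isFibreProduct : X.IsFibreProduct x x M p q θ

namespace Presentation

variable {X : TopPrestack.{u}} [∀ T : TopCat.{u}, IsGroupoid (X.Fib T)] (P : X.Presentation)

/-- The isomorphism `x_u ⟶ x_v` of points of `X` which corresponds to a point of `M`. -/
def arr (a : P.M) (u v : P.U) (hu : P.p a = u) (hv : P.q a = v) :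
    X.fibreAt P.x u ⟶ X.fibreAt P.x v :=
  germ P.θ.hom a u v hu hv

theorem existsUnique_lift {Y : TopCat.{u}} (y y' : Y ⟶ P.U) (ψ : X.pull y P.x ⟶ X.pull y' P.x) :
    ∃! k : Y ⟶ P.M, ∃ (hp : k ≫ P.p = y) (hq : k ≫ P.q = y'),
      pullHom P.θ.hom k y y' hp hq = ψ :=
  P.isFibreProduct Y y y' (asIso ψ)

theorem arr_surjective {u v : P.U} (ψ : X.fibreAt P.x u ⟶ X.fibreAt P.x v) :
    ∃ (a : P.M) (hu : P.p a = u) (hv : P.q a = v), P.arr a u v hu hv = ψ := by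
  obtain ⟨k, ⟨hp, hq, h⟩, -⟩ := P.existsUnique_lift (ptMap u) (ptMap v) ψ
  exact ⟨k PUnit.unit, congrArg (fun f : pt ⟶ P.U => f PUnit.unit) hp,
    congrArg (fun f : pt ⟶ P.U => f PUnit.unit) hq, h⟩

theorem arr_injective {u v : P.U} {a b : P.M} (hu : P.p a = u) (hv : P.q a = v)
    (hu' : P.p b = u) (hv' : P.q b = v) (h : P.arr a u v hu hv = P.arr b u v hu' hv') :
    a = b := by
  have := (P.existsUnique_lift (ptMap u) (ptMap v) (P.arr a u v hu hv)).unique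
    (y₁ := ptMap a) (y₂ := ptMap b)
    ⟨by subst hu; rfl, by subst hv; rfl, rfl⟩
    ⟨by subst hu'; rfl, by subst hv'; rfl, h.symm⟩
  exact congrArg (fun f : pt ⟶ P.M => f PUnit.unit) this

/-- The point of `M` which corresponds to an isomorphism `x_u ⟶ x_v`. -/
noncomputable def ofHom {u v : P.U} (ψ : X.fibreAt P.x u ⟶ X.fibreAt P.x v) : P.M :=
  (P.arr_surjective ψ).choose

variable {P}

theorem p_ofHom {u v : P.U} (ψ : X.fibreAt P.x u ⟶ X.fibreAt P.x v) : P.p (P.ofHom ψ) = u :=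
  (P.arr_surjective ψ).choose_spec.choose

theorem q_ofHom {u v : P.U} (ψ : X.fibreAt P.x u ⟶ X.fibreAt P.x v) : P.q (P.ofHom ψ) = v :=
  (P.arr_surjective ψ).choose_spec.choose_spec.choose

theorem arr_ofHom {u v : P.U} (ψ : X.fibreAt P.x u ⟶ X.fibreAt P.x v) :
    P.arr (P.ofHom ψ) u v (p_ofHom ψ) (q_ofHom ψ) = ψ :=
  (P.arr_surjective ψ).choose_spec.choose_spec.choose_spec

theorem ofHom_arr {u v : P.U} (a : P.M) (hu : P.p a = u) (hv : P.q a = v) :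
    P.ofHom (P.arr a u v hu hv) = a :=
  P.arr_injective _ _ _ _ (arr_ofHom _)

theorem ofHom_injective {u v : P.U} {ψ ψ' : X.fibreAt P.x u ⟶ X.fibreAt P.x v}
    (h : P.ofHom ψ = P.ofHom ψ') : ψ = ψ' := by
  rw [← arr_ofHom ψ, ← arr_ofHom ψ']
  congr 1

/-- A map to `M` is continuous if it classifies the values of a morphism over a space. -/
theorem continuous_ofHom {Y : TopCat.{u}} {y y' : Y ⟶ P.U} (ψ : X.pull y P.x ⟶ X.pull y' P.x)
    (m : Y → P.M) (hm : ∀ t, m t = P.ofHom (germ ψ t (y t) (y' t) rfl rfl)) : Continuous m := by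
  obtain ⟨k, ⟨hp, hq, h⟩, -⟩ := P.existsUnique_lift y y' ψ
  convert k.hom.continuous using 1
  funext t
  rw [hm]
  refine P.arr_injective (u := y t) (v := y' t) (p_ofHom _) (q_ofHom _)
    (congrArg (fun f : Y ⟶ P.U => f t) hp) (congrArg (fun f : Y ⟶ P.U => f t) hq) ?_
  rw [arr_ofHom, ← h, germ_pullHom]
  rfl

theorem ofHom_arr_comp_arr {a b : P.M} {u v w : P.U} {f : X.fibreAt P.x u ⟶ X.fibreAt P.x v}
    {g : X.fibreAt P.x v ⟶ X.fibreAt P.x w} (ha : a = P.ofHom f) (hb : b = P.ofHom g)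
    (h : P.q a = P.p b) :
    P.ofHom (P.arr a _ _ rfl rfl ≫ P.arr b _ _ h.symm rfl) = P.ofHom (f ≫ g) := by
  have key : ∀ (u' v' w' : P.U) (hu : P.p a = u') (hv : P.q a = v')
      (hv' : P.p b = v') (hw : P.q b = w'), u = u' → v = v' → w = w' →
      P.ofHom (P.arr a u' v' hu hv ≫ P.arr b v' w' hv' hw) = P.ofHom (f ≫ g) := by
    rintro _ _ _ hu hv hv' hw rfl rfl rfl
    subst ha hb
    rw [arr_ofHom, arr_ofHom]
  exact key _ _ _ _ _ _ _ (by rw [ha, p_ofHom]) (by rw [ha, q_ofHom]) (by rw [hb, q_ofHom])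

variable (P)

/-- The topological groupoid `U ×_X U ⇉ U` of an atlas `U → X`. -/
noncomputable def groupoid : TopGroupoid.{u} where
  O := P.U
  M := P.M
  src := P.p
  tgt := P.q
  one u := P.ofHom (𝟙 (X.fibreAt P.x u))
  inv a := P.ofHom (inv (P.arr a _ _ rfl rfl))
  comp a b h := P.ofHom (P.arr a (P.p a) (P.q a) rfl rfl ≫ P.arr b (P.q a) (P.q b) h.symm rfl)
  src_one _ := p_ofHom _
  tgt_one _ := q_ofHom _
  src_inv _ := p_ofHom _
  tgt_inv _ := q_ofHom _
  src_comp _ _ _ := p_ofHom _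
  tgt_comp _ _ _ := q_ofHom _
  one_comp a h := by
    refine (ofHom_arr_comp_arr rfl (ofHom_arr a rfl rfl).symm h).trans ?_
    rw [Category.id_comp, ofHom_arr]
  comp_one a h := by
    refine (ofHom_arr_comp_arr (ofHom_arr a rfl rfl).symm rfl h).trans ?_
    rw [Category.comp_id, ofHom_arr]
  comp_inv a h := by
    refine (ofHom_arr_comp_arr (ofHom_arr a rfl rfl).symm rfl h).trans ?_
    rw [IsIso.hom_inv_id]
  inv_comp a h := by
    refine (ofHom_arr_comp_arr rfl (ofHom_arr a rfl rfl).symm h).trans ?_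
    rw [IsIso.inv_hom_id]
  assoc a b c hab hbc h h' := by
    have ha := (ofHom_arr a rfl rfl).symm
    have hb := (ofHom_arr b hab.symm rfl).symm
    have hc := (ofHom_arr c hbc.symm rfl).symm
    refine (ofHom_arr_comp_arr rfl hc h).trans (Eq.trans ?_
      (ofHom_arr_comp_arr ha (ofHom_arr_comp_arr hb hc hbc) h').symm)
    rw [Category.assoc]
  continuous_src := P.p.hom.continuous
  continuous_tgt := P.q.hom.continuous
  continuous_one := continuous_ofHom (𝟙 (X.pull (𝟙 P.U) P.x)) _ fun t => by
    rw [germ_id]; rfl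
  continuous_inv := continuous_ofHom (inv P.θ.hom) _ fun a => by
    rw [germ_inv]; rfl
  continuous_comp := by
    let D : TopCat.{u} := TopCat.of {p : P.M × P.M // P.q p.1 = P.p p.2}
    let k₁ : D ⟶ P.M := TopCat.ofHom ⟨fun d => d.1.1, by fun_prop⟩
    let k₂ : D ⟶ P.M := TopCat.ofHom ⟨fun d => d.1.2, by fun_prop⟩
    have e : k₂ ≫ P.p = k₁ ≫ P.q := by
      ext d; exact d.2.symm
    refine continuous_ofHom (Y := D) (pullHom P.θ.hom k₁ (k₁ ≫ P.p) (k₁ ≫ P.q) rfl rfl ≫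
      pullHom P.θ.hom k₂ (k₁ ≫ P.q) (k₂ ≫ P.q) e rfl) _ fun d => ?_
    rw [germ_comp _ _ _ _ ((k₁ ≫ P.q) d) _ rfl rfl rfl, germ_pullHom, germ_pullHom]
    rfl

end Presentation

end TopPrestack

/-! ### Cocycles of local lifts to an atlas -/

namespace TopPrestack

namespace Presentation

variable {X : TopPrestack.{u}} [∀ T : TopCat.{u}, IsGroupoid (X.Fib T)] (P : X.Presentation)

/-- The inclusion of a subset. -/
abbrev incl {T : TopCat.{u}} (N : Set T) : TopCat.of N ⟶ T :=
  TopCat.ofHom ⟨Subtype.val, continuous_subtype_val⟩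

/-- A lift of the map `z : T → X` to the atlas `U`, over an open subset of `T`. -/
structure LocalLift {T : TopCat.{u}} (z : X.Fib T) where
  N : Set T
  isOpen : IsOpen N
  y : TopCat.of N ⟶ P.U
  φ : X.pull y P.x ⟶ X.pull (incl N) z

/-- Maps to `X` lift locally to the atlas. -/
def HasLifts : Prop :=
  ∀ {T : TopCat.{u}} (z : X.Fib T) (t : T), ∃ i : P.LocalLift z, t ∈ i.N

variable {P}

/-- The value at `t` of a local lift. -/
def LocalLift.val {T : TopCat.{u}} {z : X.Fib T} (i : P.LocalLift z) (t : T) (h : t ∈ i.N) :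
    X.fibreAt P.x (i.y ⟨t, h⟩) ⟶ X.fibreAt z t :=
  germ i.φ ⟨t, h⟩ _ t rfl rfl

variable {R S T : TopCat.{u}} {z : X.Fib S} {z' : X.Fib T} {f : S ⟶ T}

theorem one_apply (s : S) : (𝟙 S : S ⟶ S) s = s := rfl

/-- The transition between two local lifts along a morphism `Φ : z ⟶ f^* z'`. Its source is written
`id^* z`, so that `Φ` has germs. -/
noncomputable def transition (Φ : X.pull (𝟙 S) z ⟶ X.pull f z') (i : P.LocalLift z)
    (i' : P.LocalLift z') (s : S) (t : T) (hst : f s = t) (hi : s ∈ i.N) (hi' : t ∈ i'.N) : P.M :=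
  P.ofHom (i.val s hi ≫ germ Φ s s t (one_apply s) hst ≫ inv (i'.val t hi'))

theorem continuous_transition (Φ : X.pull (𝟙 S) z ⟶ X.pull f z') (i : P.LocalLift z)
    (i' : P.LocalLift z') : Continuous fun s : {s : S // s ∈ i.N ∧ f s ∈ i'.N} =>
      transition Φ i i' s.1 (f s.1) rfl s.2.1 s.2.2 := by
  let D : TopCat.{u} := TopCat.of {s : S // s ∈ i.N ∧ f s ∈ i'.N}
  let k : D ⟶ TopCat.of i.N := TopCat.ofHom ⟨fun s => ⟨s.1, s.2.1⟩, by fun_prop⟩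
  let k' : D ⟶ TopCat.of i'.N := TopCat.ofHom ⟨fun s => ⟨f s.1, s.2.2⟩, by fun_prop⟩
  let j : D ⟶ S := TopCat.ofHom ⟨Subtype.val, continuous_subtype_val⟩
  refine continuous_ofHom (Y := D) (pullHom i.φ k (k ≫ i.y) j rfl rfl ≫
    pullHom Φ j j (j ≫ f) (Category.comp_id j) rfl ≫
      inv (pullHom i'.φ k' (k' ≫ i'.y) (j ≫ f) rfl rfl)) _ fun d => ?_
  rw [germ_comp _ _ _ _ (j d) _ rfl rfl rfl, germ_comp _ _ _ _ ((j ≫ f) d) _ rfl rfl rfl,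
    germ_inv, germ_pullHom, germ_pullHom, germ_pullHom]
  rfl

theorem comp_transition {A : TopCat.{u}} {w : X.Fib A} {g : T ⟶ A}
    {Φ : X.pull (𝟙 S) z ⟶ X.pull f z'}
    {Ψ : X.pull (𝟙 T) z' ⟶ X.pull g w} {h : S ⟶ A}
    {Θ : X.pull (𝟙 S) z ⟶ X.pull h w} {i : P.LocalLift z}
    {i' : P.LocalLift z'} {i'' : P.LocalLift w} {s : S} {t : T} {a : A}
    {hst : f s = t} {hta : g t = a} {hsa : h s = a} {hi : s ∈ i.N} {hi' : t ∈ i'.N}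
    {hi'' : a ∈ i''.N}
    (H : germ Θ s s a (one_apply s) hsa =
      germ Φ s s t (one_apply s) hst ≫ germ Ψ t t a (one_apply t) hta)
    (e : P.groupoid.tgt (transition Φ i i' s t hst hi hi') =
      P.groupoid.src (transition Ψ i' i'' t a hta hi' hi'')) :
    P.groupoid.comp (transition Φ i i' s t hst hi hi') (transition Ψ i' i'' t a hta hi' hi'') e =
      transition Θ i i'' s a hsa hi hi'' := by
  refine (ofHom_arr_comp_arr rfl rfl e).trans ?_
  unfold transition
  rw [H]
  simp

theorem transition_injective {Φ Ψ : X.pull (𝟙 S) z ⟶ X.pull f z'} {i : P.LocalLift z}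
    {i' : P.LocalLift z'} {s : S} {t : T} {hst : f s = t} {hi : s ∈ i.N} {hi' : t ∈ i'.N}
    (h : transition Φ i i' s t hst hi hi' = transition Ψ i i' s t hst hi hi') :
    germ Φ s s t (one_apply s) hst = germ Ψ s s t (one_apply s) hst := by
  have := ofHom_injective h
  rwa [cancel_epi, cancel_mono] at this

variable (P) in
/-- The cocycle of transitions between the local lifts of `z`. -/
noncomputable def cocycle (hP : P.HasLifts) (z : X.Fib S) : Cocycle P.groupoid S where
  ι := P.LocalLift z
  U i := i.N
  isOpen_U i := i.isOpen
  cover := hP z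
  obj i t h := i.y ⟨t, h⟩
  mor i j t hi hj := transition (𝟙 (X.pull (𝟙 S) z)) i j t t rfl hi hj
  continuous_obj i := i.y.hom.continuous
  continuous_mor i j := continuous_transition (𝟙 (X.pull (𝟙 S) z)) i j
  src_mor _ _ _ _ _ := p_ofHom _
  tgt_mor _ _ _ _ _ := q_ofHom _
  mor_comp_mor i j k t hi hj hk := by
    refine comp_transition ?_ _
    rw [germ_id t t (one_apply t), Category.comp_id]

/-- The morphism of cocycles given by `Φ : z ⟶ f^* z'`. -/
noncomputable def transitionHom (hP : P.HasLifts) (Φ : X.pull (𝟙 S) z ⟶ X.pull f z') :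
    Cocycle.Hom (P.cocycle hP z) ((P.cocycle hP z').pullback f.hom) where
  mor i i' s hi hi' := transition Φ i i' s (f s) rfl hi hi'
  continuous_mor i i' := continuous_transition Φ i i'
  src_mor _ _ _ _ _ := p_ofHom _
  tgt_mor _ _ _ _ _ := q_ofHom _
  left_comp i j k t hi hj hk := by
    refine comp_transition (g := f) (h := f) (Φ := 𝟙 (X.pull (𝟙 S) z)) ?_ _
    rw [germ_id t t (one_apply t), Category.id_comp]
  comp_right i j k t hi hj hk := by
    refine comp_transition (f := f) (g := 𝟙 T) (h := f) (Ψ := 𝟙 (X.pull (𝟙 T) z')) ?_ _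
    rw [germ_id (f t) (f t) (one_apply _)]
    exact (Category.comp_id _).symm

end Presentation

end TopPrestack

/-! ### Cocycles form groupoids -/

namespace TopGroupoid

variable (𝒢 : TopGroupoid.{u})

theorem inv_comp_cancel (a b : 𝒢.M) (h : 𝒢.tgt a = 𝒢.src b) :
    𝒢.comp (𝒢.inv a) (𝒢.comp a b h) ((𝒢.tgt_inv a).trans (𝒢.src_comp a b h).symm) = b := by
  rw [← 𝒢.assoc (𝒢.inv a) a b (𝒢.tgt_inv a) h ((𝒢.tgt_comp _ _ _).trans h)]
  refine (𝒢.comp_congr ((𝒢.inv_comp a _).trans (by rw [h])) rfl _ ?_).trans (𝒢.one_comp b ?_)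
  all_goals exact 𝒢.tgt_one _

theorem comp_inv_cancel (a b : 𝒢.M) (h : 𝒢.tgt a = 𝒢.src b) :
    𝒢.comp (𝒢.comp a b h) (𝒢.inv b) ((𝒢.tgt_comp a b h).trans (𝒢.src_inv b).symm) = a := by
  rw [𝒢.assoc a b (𝒢.inv b) h (𝒢.src_inv b).symm _ (h.trans (𝒢.src_comp _ _ _).symm)]
  refine (𝒢.comp_congr rfl ((𝒢.comp_inv b _).trans (by rw [h])) _ ?_).trans (𝒢.comp_one a ?_)
  all_goals exact (𝒢.src_one _).symm

theorem comp_left_cancel {a b b' : 𝒢.M} {h : 𝒢.tgt a = 𝒢.src b} {h' : 𝒢.tgt a = 𝒢.src b'}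
    (e : 𝒢.comp a b h = 𝒢.comp a b' h') : b = b' := by
  rw [← 𝒢.inv_comp_cancel a b h, ← 𝒢.inv_comp_cancel a b' h']
  exact 𝒢.comp_congr rfl e _ _

theorem comp_right_cancel {a a' b : 𝒢.M} {h : 𝒢.tgt a = 𝒢.src b} {h' : 𝒢.tgt a' = 𝒢.src b}
    (e : 𝒢.comp a b h = 𝒢.comp a' b h') : a = a' := by
  rw [← 𝒢.comp_inv_cancel a b h, ← 𝒢.comp_inv_cancel a' b h']
  exact 𝒢.comp_congr e rfl _ _

end TopGroupoid

namespace Cocycle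

variable {𝒢 : TopGroupoid.{u}} {T : Type u} [TopologicalSpace T]

/-- The inverse of a morphism of cocycles. -/
def Hom.inverse {c c' : Cocycle 𝒢 T} (f : Hom c c') : Hom c' c where
  mor i' i t hi' hi := 𝒢.inv (f.mor i i' t hi hi')
  continuous_mor i' i := by
    have h : Continuous fun t : {t : T // t ∈ c'.U i' ∧ t ∈ c.U i} =>
      (⟨t.1, t.2.2, t.2.1⟩ : {t : T // t ∈ c.U i ∧ t ∈ c'.U i'}) := by fun_prop
    exact 𝒢.continuous_inv.comp ((f.continuous_mor i i').comp h)
  src_mor i' i t hi' hi := by rw [𝒢.src_inv, f.tgt_mor]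
  tgt_mor i' i t hi' hi := by rw [𝒢.tgt_inv, f.src_mor]
  left_comp i' j' i t hi' hj' hi := by
    apply 𝒢.comp_right_cancel (b := f.mor i j' t hi hj')
      (h := by simp only [𝒢.tgt_comp, 𝒢.tgt_inv, f.src_mor])
      (h' := by simp only [𝒢.tgt_inv, f.src_mor])
    rw [𝒢.assoc (hbc := by rw [𝒢.tgt_inv]) (h' := by rw [c'.tgt_mor, 𝒢.src_comp, 𝒢.src_inv,
      f.tgt_mor])]
    refine (𝒢.comp_congr rfl (𝒢.inv_comp _ _) _ ?_).trans ?_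
    · rw [𝒢.src_one, c'.tgt_mor, f.tgt_mor]
    refine Eq.trans ?_ (𝒢.inv_comp_cancel (f.mor i i' t hi hi') (c'.mor i' j' t hi' hj')
      (by rw [f.tgt_mor, c'.src_mor])).symm |>.trans ?_
    · refine (𝒢.comp_congr rfl ?_ _ ?_).trans (𝒢.comp_one _ ?_)
      · rw [c'.tgt_mor, f.tgt_mor]
      all_goals rw [𝒢.src_one]
    · exact 𝒢.comp_congr rfl (f.comp_right _ _ _ _ _ _ _) _ _
  comp_right i' i j t hi' hi hj := by
    apply 𝒢.comp_left_cancel (a := f.mor i i' t hi hi')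
      (h := by rw [𝒢.src_comp, 𝒢.src_inv]) (h' := by rw [f.tgt_mor, 𝒢.src_inv, f.tgt_mor])
    rw [← 𝒢.assoc (hab := by rw [𝒢.src_inv]) (h := by rw [𝒢.tgt_comp, 𝒢.tgt_inv, c.src_mor,
      f.src_mor])]
    refine (𝒢.comp_congr (𝒢.comp_inv _ _) rfl _ ?_).trans ?_
    · rw [𝒢.tgt_one, c.src_mor, f.src_mor]
    refine Eq.trans ?_ (𝒢.comp_inv_cancel (c.mor i j t hi hj) (f.mor j i' t hj hi')
      (by rw [f.src_mor, c.tgt_mor])).symm |>.trans ?_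
    · refine (𝒢.comp_congr ?_ rfl _ ?_).trans (𝒢.one_comp _ ?_)
      · rw [c.src_mor, f.src_mor]
      all_goals rw [𝒢.tgt_one]
    · exact 𝒢.comp_congr (f.left_comp _ _ _ _ _ _ _) rfl _ _

theorem Hom.comp_inverse {c c' : Cocycle 𝒢 T} (f : Hom c c') : f.comp f.inverse = Hom.id c := by
  refine Hom.ext ?_
  funext i j t hi hj
  rw [Hom.comp_mor f f.inverse i (c'.idx t) j t hi (c'.mem_idx t) hj]
  apply 𝒢.comp_right_cancel (b := f.mor j (c'.idx t) t hj (c'.mem_idx t))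
    (h := by rw [𝒢.tgt_comp, f.inverse.tgt_mor, f.src_mor])
    (h' := by rw [(Hom.id c).tgt_mor, f.src_mor])
  refine Eq.trans ?_ (f.left_comp i j _ t hi hj (c'.mem_idx t)).symm
  refine (𝒢.assoc _ (𝒢.inv (f.mor j (c'.idx t) t hj (c'.mem_idx t))) _ _ (𝒢.tgt_inv _) _
    (by rw [𝒢.src_comp, 𝒢.src_inv, f.tgt_mor, f.tgt_mor])).trans ?_
  refine (𝒢.comp_congr rfl (𝒢.inv_comp _ _) _ ?_).trans ?_
  · rw [𝒢.src_one, f.tgt_mor, f.tgt_mor]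
  · refine (𝒢.comp_congr rfl ?_ _ ?_).trans (𝒢.comp_one _ ?_)
    · rw [f.tgt_mor, f.tgt_mor]
    all_goals rw [𝒢.src_one]

theorem Hom.inverse_comp {c c' : Cocycle 𝒢 T} (f : Hom c c') : f.inverse.comp f = Hom.id c' := by
  refine Eq.trans ?_ f.inverse.comp_inverse
  congr 1
  refine Hom.ext ?_
  funext i j t hi hj
  have h := 𝒢.inv_comp_cancel (𝒢.inv (f.mor i j t hi hj)) (f.mor i j t hi hj) (𝒢.tgt_inv _)
  refine h.symm.trans ((𝒢.comp_congr rfl (𝒢.inv_comp _ _) _ ?_).trans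
    ((𝒢.comp_congr rfl ?_ _ ?_).trans (𝒢.comp_one _ ?_)))
  · rw [𝒢.src_one, 𝒢.tgt_inv, 𝒢.src_inv]
  · rw [𝒢.tgt_inv, 𝒢.src_inv]
  all_goals rw [𝒢.src_one]

instance : IsGroupoid (Cocycle 𝒢 T) where
  all_isIso f := ⟨Hom.inverse f, Hom.comp_inverse f, Hom.inverse_comp f⟩

end Cocycle

/-! ### The map to the stack of an atlas -/

namespace TopGroupoid

variable (𝒢 : TopGroupoid.{u})

theorem stack_mapId_hom_app (a : LocallyDiscrete TopCat.{u}ᵒᵖ) (c : Cocycle 𝒢 a.as.unop) :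
    (𝒢.stack.mapId a).hom.toNatTrans.app c = 𝟙 c := by
  have : (𝒢.stack.mapId a).hom.toNatTrans.app c = eqToHom rfl :=
    Cat.eqToHom_app (𝒢.stack.map (𝟙 a)) (𝟙 (𝒢.stack.obj a)) rfl c
  exact this

theorem stack_mapComp_hom_app {a b c : LocallyDiscrete TopCat.{u}ᵒᵖ} (f : a ⟶ b) (g : b ⟶ c)
    (x : Cocycle 𝒢 a.as.unop) :
    (𝒢.stack.mapComp f g).hom.toNatTrans.app x = 𝟙 ((𝒢.stack.map (f ≫ g)).toFunctor.obj x) := by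
  have : (𝒢.stack.mapComp f g).hom.toNatTrans.app x = eqToHom rfl :=
    Cat.eqToHom_app (𝒢.stack.map (f ≫ g)) (𝒢.stack.map f ≫ 𝒢.stack.map g) rfl x
  exact this

end TopGroupoid

namespace TopPrestack

variable {X : TopPrestack.{u}}

theorem germ_map {S T : TopCat.{u}} {z z' : X.Fib T} (f : S ⟶ T) (θ : z ⟶ z') (s : S) (t : T)
    (h : f s = t) : germ ((X.map f.op.toLoc).toFunctor.map θ) s t t h h =
      (X.map (ptMap t).op.toLoc).toFunctor.map θ := by
  unfold germ pullHom
  have := (X.mapComp' f.op.toLoc (ptMap s).op.toLoc (ptMap t).op.toLoc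
    (by subst h; rfl)).hom.toNatTrans.naturality θ
  dsimp at this
  rw [← reassoc_of% this]
  simp [← Cat.Hom₂.comp_app]

/-- The canonical isomorphism `id^* f^* z ≅ f^* z`. -/
abbrev can {S T : TopCat.{u}} (f : S ⟶ T) (z : X.Fib T) :
    X.pull (𝟙 S) (X.pull f z) ⟶ X.pull f z :=
  (X.mapId ⟨op S⟩).hom.toNatTrans.app (X.pull f z)

theorem germ_can {S T : TopCat.{u}} (f : S ⟶ T) (z : X.Fib T) (s : S) (t : T) (h : f s = t)
    (hs : (𝟙 S : S ⟶ S) s = s) :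
    germ (can f z) s s t hs h = (X.mapComp' f.op.toLoc (ptMap s).op.toLoc (ptMap t).op.toLoc
      (by subst h; rfl)).inv.toNatTrans.app z := by
  have e : (X.mapComp' (𝟙 S : S ⟶ S).op.toLoc (ptMap s).op.toLoc (ptMap s).op.toLoc
      rfl).hom.toNatTrans.app (X.pull f z) ≫
        (X.map (ptMap s).op.toLoc).toFunctor.map (can f z) = 𝟙 _ := by
    have h1 := Pseudofunctor.mapComp'_id_comp_hom_app X (ptMap s).op.toLoc (X.pull f z)
    refine (congrArg (· ≫ (X.map (ptMap s).op.toLoc).toFunctor.map (can f z)) h1).trans ?_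
    refine (Functor.map_comp _ _ _).symm.trans ?_
    refine (congrArg _ (Cat.Hom.inv_hom_id_toNatTrans_app (X.mapId ⟨op S⟩) (X.pull f z))).trans ?_
    exact CategoryTheory.Functor.map_id _ _
  unfold germ pullHom
  exact (reassoc_of% e) _

namespace Presentation

variable [∀ T : TopCat.{u}, IsGroupoid (X.Fib T)] {P : X.Presentation}

theorem transitionHom_comp {R S T : TopCat.{u}} {z : X.Fib R} {z' : X.Fib S} {w : X.Fib T}
    {f : R ⟶ S} {g : S ⟶ T} {h : R ⟶ T} (hP : P.HasLifts)
    {Φ : X.pull (𝟙 R) z ⟶ X.pull f z'} {Ψ : X.pull (𝟙 S) z' ⟶ X.pull g w}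
    {Θ : X.pull (𝟙 R) z ⟶ X.pull h w} (hfg : f ≫ g = h)
    (H : ∀ r, germ Θ r r (h r) rfl rfl =
      germ Φ r r (f r) rfl rfl ≫ germ Ψ (f r) (f r) (h r) rfl (by subst hfg; rfl))
    (i : P.LocalLift z) (j : P.LocalLift w) (r : R) (hi : r ∈ i.N) (hj : h r ∈ j.N) :
    ((transitionHom hP Φ).comp ((transitionHom hP Ψ).pullback f.hom)).mor i j r hi
      (by subst hfg; exact hj) = (transitionHom hP Θ).mor i j r hi hj := by
  subst hfg
  obtain ⟨i', hi'⟩ := hP z' (f r)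
  refine (Cocycle.Hom.comp_mor (transitionHom hP Φ) ((transitionHom hP Ψ).pullback f.hom)
    i i' j r hi hi' hj).trans ?_
  exact comp_transition (H r) _

/-- The functor sending a map to `X` to the cocycle of transitions between its local lifts. -/
noncomputable def cocycleFunctor (hP : P.HasLifts) (T : TopCat.{u}) :
    X.Fib T ⥤ Cocycle P.groupoid T where
  obj z := P.cocycle hP z
  map {z z'} θ := transitionHom hP (f := 𝟙 T) ((X.map (𝟙 T : T ⟶ T).op.toLoc).toFunctor.map θ)
  map_id z := by
    rw [CategoryTheory.Functor.map_id]
    rfl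
  map_comp {z z' z''} θ θ' := by
    refine Cocycle.Hom.ext ?_
    funext i j t hi hj
    refine (transitionHom_comp (f := 𝟙 T) (g := 𝟙 T) (h := 𝟙 T) hP (Category.comp_id _)
      (fun t => ?_) i j t hi hj).symm
    rw [Functor.map_comp]
    exact germ_comp _ _ _ _ _ _ _ _ _

/-- Pullback is compatible with the cocycle of transitions. -/
noncomputable def cocycleFunctorPullback (hP : P.HasLifts) {S T : TopCat.{u}} (f : S ⟶ T) :
    (X.map f.op.toLoc).toFunctor ⋙ cocycleFunctor hP S ≅
      cocycleFunctor hP T ⋙ Cocycle.pullbackFunctor P.groupoid f.hom :=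
  NatIso.ofComponents (fun z => @asIso (Cocycle P.groupoid S) _ (P.cocycle hP (X.pull f z))
      ((P.cocycle hP z).pullback f.hom) (transitionHom hP (f := f) (can f z)) _) (by
    intro z z' θ
    refine Cocycle.Hom.ext ?_
    funext i j s hi hj
    refine (transitionHom_comp (f := 𝟙 S) (g := f) (h := f) hP
      (Φ := (X.map (𝟙 S : S ⟶ S).op.toLoc).toFunctor.map ((X.map f.op.toLoc).toFunctor.map θ))
      (Ψ := can f z')
      (Θ := (X.map (𝟙 S : S ⟶ S).op.toLoc).toFunctor.map ((X.map f.op.toLoc).toFunctor.map θ) ≫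
        can f z') (Category.id_comp _) (fun t => germ_comp _ _ _ _ _ _ _ _ _) i j s hi hj).trans ?_
    refine (transitionHom_comp (f := f) (g := 𝟙 T) (h := f) hP
      (Φ := can f z)
      (Ψ := (X.map (𝟙 T : T ⟶ T).op.toLoc).toFunctor.map θ) (Category.comp_id _)
        (fun t => ?_) i j s hi hj).symm
    have e : (X.map (𝟙 S : S ⟶ S).op.toLoc).toFunctor.map ((X.map f.op.toLoc).toFunctor.map θ) ≫
      can f z' = can f z ≫ (X.map f.op.toLoc).toFunctor.map θ :=
      (X.mapId ⟨op S⟩).hom.toNatTrans.naturality _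
    refine (congrArg (fun ψ => germ ψ t t (f t) rfl rfl) e).trans
      ((germ_comp _ _ _ _ (f t) _ rfl rfl rfl).trans (congrArg _ ?_))
    exact (germ_map f θ t (f t) rfl).trans (germ_map (𝟙 T) θ (f t) (f t) rfl).symm)

/-- The two ways to remove a pullback along the identity from `id^* id^* z` agree. -/
theorem map_mapId_hom_app {S : TopCat.{u}} (z : X.Fib S) :
    (X.map (𝟙 S : S ⟶ S).op.toLoc).toFunctor.map ((X.mapId ⟨op S⟩).hom.toNatTrans.app z) =
      can (𝟙 S) z := by
  have e : (X.map (𝟙 S : S ⟶ S).op.toLoc).toFunctor.map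
      ((X.mapId ⟨op S⟩).hom.toNatTrans.app z) ≫ (X.mapId ⟨op S⟩).hom.toNatTrans.app z =
      can (𝟙 S) z ≫ (X.mapId ⟨op S⟩).hom.toNatTrans.app z :=
    (X.mapId ⟨op S⟩).hom.toNatTrans.naturality ((X.mapId ⟨op S⟩).hom.toNatTrans.app z)
  have h := IsGroupoid.all_isIso (C := X.Fib S) ((X.mapId ⟨op S⟩).hom.toNatTrans.app z)
  exact (@cancel_mono _ _ _ _ _ _ (@IsIso.mono_of_iso _ _ _ _ _ h) _ _).1 e

theorem germ_mapComp_inv {R S T : TopCat.{u}} (g : R ⟶ S) (f : S ⟶ T) (z : X.Fib T) (r : R) :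
    germ (M₁ := X.pull f z) (M₂ := z) (f₁ := g) (f₂ := g ≫ f)
      ((X.mapComp f.op.toLoc g.op.toLoc).inv.toNatTrans.app z) r (g r) (f (g r)) rfl rfl =
      germ (can f z) (g r) (g r) (f (g r)) rfl rfl := by
  refine Eq.trans ?_ (germ_can f z (g r) (f (g r)) rfl rfl).symm
  unfold germ pullHom
  have := X.mapComp'_inv_whiskerRight_mapComp'₀₂₃_inv_app f.op.toLoc g.op.toLoc (ptMap r).op.toLoc
    (f.op.toLoc ≫ g.op.toLoc) (ptMap (g r)).op.toLoc (ptMap (f (g r))).op.toLoc rfl rfl rfl z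
  rw [Pseudofunctor.mapComp'_eq_mapComp] at this
  refine (congrArg (fun ψ => (X.mapComp' g.op.toLoc (ptMap r).op.toLoc
    (ptMap (g r)).op.toLoc rfl).hom.toNatTrans.app (X.pull f z) ≫ ψ) this).trans ?_
  exact Cat.Hom.hom_inv_id_toNatTrans_app_assoc _ _ _

theorem transitionHom_congr {S T : TopCat.{u}} {z : X.Fib S} {z' : X.Fib T} {f : S ⟶ T}
    (hP : P.HasLifts) {Φ Ψ : X.pull (𝟙 S) z ⟶ X.pull f z'} (h : Φ = Ψ) :
    transitionHom hP Φ = transitionHom hP Ψ := by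
  rw [h]

/-- The maps `transitionHom` of the canonical isomorphisms are compatible with composition of
maps of spaces. -/
theorem transitionHom_can_comp (hP : P.HasLifts) {R S T : TopCat.{u}} (g : R ⟶ S) (f : S ⟶ T)
    (z : X.Fib T) :
    transitionHom hP (f := g ≫ f) (can (g ≫ f) z) =
      Cocycle.Hom.comp (transitionHom hP (f := 𝟙 R) ((X.map (𝟙 R : R ⟶ R).op.toLoc).toFunctor.map
        ((X.mapComp f.op.toLoc g.op.toLoc).hom.toNatTrans.app z)))
      (Cocycle.Hom.comp (transitionHom hP (f := g) (can g (X.pull f z)))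
        ((transitionHom hP (f := f) (can f z)).pullback g.hom)) := by
  let m : X.pull (g ≫ f) z ⟶ X.pull g (X.pull f z) :=
    (X.mapComp f.op.toLoc g.op.toLoc).hom.toNatTrans.app z
  let n : X.pull g (X.pull f z) ⟶ X.pull (g ≫ f) z :=
    (X.mapComp f.op.toLoc g.op.toLoc).inv.toNatTrans.app z
  have hmn : m ≫ n = 𝟙 _ :=
    Cat.Hom.hom_inv_id_toNatTrans_app (X.mapComp f.op.toLoc g.op.toLoc) z
  have e : (X.map (𝟙 R : R ⟶ R).op.toLoc).toFunctor.map m ≫ can g (X.pull f z) ≫ n =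
      can (g ≫ f) z := by
    have h : (X.map (𝟙 R : R ⟶ R).op.toLoc).toFunctor.map m ≫ can g (X.pull f z) =
      can (g ≫ f) z ≫ m := (X.mapId ⟨op R⟩).hom.toNatTrans.naturality m
    refine (Category.assoc _ _ _).symm.trans ((congrArg (· ≫ n) h).trans ?_)
    exact (Category.assoc _ _ _).trans ((congrArg (_ ≫ ·) hmn).trans (Category.comp_id _))
  have h2 : Cocycle.Hom.comp (transitionHom hP (f := g) (can g (X.pull f z)))
      ((transitionHom hP (f := f) (can f z)).pullback g.hom) =
      transitionHom hP (f := g ≫ f) (can g (X.pull f z) ≫ n) := by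
    refine Cocycle.Hom.ext ?_
    funext i j r hi hj
    refine transitionHom_comp (h := g ≫ f) hP rfl (fun r => ?_) i j r hi hj
    refine (germ_comp (can g (X.pull f z)) n r r (g r) (f (g r)) rfl rfl rfl).trans
      (congrArg _ ?_)
    exact germ_mapComp_inv g f z r
  refine Eq.trans ?_ (congrArg (Cocycle.Hom.comp (transitionHom hP (f := 𝟙 R)
    ((X.map (𝟙 R : R ⟶ R).op.toLoc).toFunctor.map m))) h2).symm
  refine Cocycle.Hom.ext ?_
  funext i j r hi hj
  refine (transitionHom_comp (f := 𝟙 R) (g := g ≫ f) (h := g ≫ f) hP (Category.id_comp _)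
    (fun r => ?_) i j r hi hj).symm
  refine (congrArg (fun ψ => germ ψ r r (f (g r)) rfl rfl) e.symm).trans ?_
  exact germ_comp _ _ _ _ _ _ _ _ _

/-- A form in which the identities inserted by coherence isomorphisms of `Cat` can be removed
without rewriting. -/
theorem _root_.CategoryTheory.comp_id_eq_of_eq {C : Type*} [Category C] {a b c d : C} {A : a ⟶ d}
    {B : d ⟶ d} {D : a ⟶ b} {k₁ : b ⟶ b} {E : b ⟶ c} {k₂ : c ⟶ c} {F : c ⟶ d} {k₃ : d ⟶ d}
    (hB : B = 𝟙 d) (h₁ : k₁ = 𝟙 b) (h₂ : k₂ = 𝟙 c) (h₃ : k₃ = 𝟙 d) (h : A = D ≫ E ≫ F) :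
    A ≫ B = D ≫ k₁ ≫ E ≫ k₂ ≫ F ≫ k₃ := by
  subst hB h₁ h₂ h₃ h
  simp

theorem _root_.CategoryTheory.comp_id_eq_of_eq' {C : Type*} [Category C] {a b : C} {A : a ⟶ b}
    {B : b ⟶ b} {D : a ⟶ b} {k₁ : b ⟶ b} {k₂ : b ⟶ b}
    (hB : B = 𝟙 b) (h₁ : k₁ = 𝟙 b) (h₂ : k₂ = 𝟙 b) (h : A = D) :
    A ≫ B = D ≫ k₁ ≫ k₂ := by
  subst hB h₁ h₂ h
  simp

/-- The map from `X` to the stack presented by the groupoid of an atlas. -/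
noncomputable def toStack (hP : P.HasLifts) : Pseudofunctor.StrongTrans X P.groupoid.stack where
  app a := (cocycleFunctor hP a.as.unop).toCatHom
  naturality {a b} f := Cat.Hom.isoMk (cocycleFunctorPullback hP f.as.unop)
  naturality_naturality {a b f g} η := by
    obtain rfl : f = g := LocallyDiscrete.eq_of_hom η
    obtain rfl : η = 𝟙 _ := Subsingleton.elim _ _
    have h1 : Bicategory.whiskerRight (X.map₂ (𝟙 f)) (cocycleFunctor hP b.as.unop).toCatHom =
        𝟙 _ :=
      (congrArg (fun η => Bicategory.whiskerRight η _) (PrelaxFunctor.map₂_id _ _)).trans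
        (Bicategory.id_whiskerRight _ _)
    have h2 : Bicategory.whiskerLeft (cocycleFunctor hP a.as.unop).toCatHom
        (P.groupoid.stack.map₂ (𝟙 f)) = 𝟙 _ :=
      (congrArg _ (PrelaxFunctor.map₂_id _ _)).trans (Bicategory.whiskerLeft_id _ _)
    refine (congrArg (· ≫ _) h1).trans ((Category.id_comp _).trans ?_)
    exact ((congrArg (_ ≫ ·) h2).trans (Category.comp_id _)).symm
  naturality_id a := by
    refine Cat.Hom₂.ext (NatTrans.ext (funext fun z => ?_))
    have h1 := P.groupoid.stack_mapId_hom_app a (P.cocycle hP z)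
    have h2 : transitionHom hP (f := 𝟙 a.as.unop) (can (𝟙 a.as.unop) z) =
      transitionHom hP (f := 𝟙 a.as.unop)
        ((X.map (𝟙 a.as.unop : a.as.unop ⟶ a.as.unop).op.toLoc).toFunctor.map
          ((X.mapId a).hom.toNatTrans.app z)) :=
      transitionHom_congr hP (map_mapId_hom_app (S := a.as.unop) z).symm
    exact comp_id_eq_of_eq' (C := Cocycle P.groupoid a.as.unop) h1 rfl rfl h2
  naturality_comp {a b c} f g := by
    refine Cat.Hom₂.ext (NatTrans.ext (funext fun z => ?_))
    have h1 := P.groupoid.stack_mapComp_hom_app f g (P.cocycle hP z)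
    have h2 := transitionHom_can_comp hP g.as.unop f.as.unop z
    exact comp_id_eq_of_eq (C := Cocycle P.groupoid c.as.unop) h1 rfl rfl rfl h2

end Presentation

end TopPrestack

/-! ### The coarse space and the diagonal in terms of an atlas -/

namespace TopPrestack

variable {X : TopPrestack.{u}}

/-- The canonical isomorphism `h^* g^* z ≅ f^* z` for `f = g ∘ h`. -/
abbrev composite {R S T : TopCat.{u}} (h : R ⟶ S) (g : S ⟶ T) (f : R ⟶ T) (e : h ≫ g = f)
    (z : X.Fib T) : X.pull h (X.pull g z) ≅ X.pull f z :=
  (Cat.Hom.toNatIso (X.mapComp' g.op.toLoc h.op.toLoc f.op.toLoc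
    (by subst e; rfl))).symm.app z

theorem pullHom_composite_hom {Q R S T : TopCat.{u}} (h : R ⟶ S) (g : S ⟶ T) (f : R ⟶ T)
    (e : h ≫ g = f) (z : X.Fib T) (k : Q ⟶ R) (h' : Q ⟶ S) (f' : Q ⟶ T) (eh : k ≫ h = h')
    (ef : k ≫ f = f') :
    pullHom (F := X) (M₁ := X.pull g z) (M₂ := z) (composite h g f e z).hom k h' f' eh ef =
      (composite h' g f' (by rw [← eh, ← ef, ← e, Category.assoc]) z).hom := by
  subst e eh ef
  unfold pullHom
  have := X.mapComp'_inv_whiskerRight_mapComp'₀₂₃_inv_app g.op.toLoc h.op.toLoc k.op.toLoc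
    (g.op.toLoc ≫ h.op.toLoc) (h.op.toLoc ≫ k.op.toLoc) (g.op.toLoc ≫ h.op.toLoc ≫ k.op.toLoc)
    rfl rfl rfl z
  refine (congrArg (fun ψ => (X.mapComp' h.op.toLoc k.op.toLoc
    (k ≫ h).op.toLoc rfl).hom.toNatTrans.app (X.pull g z) ≫ ψ) this).trans ?_
  exact Cat.Hom.hom_inv_id_toNatTrans_app_assoc _ _ _

theorem pullHom_inv {S T Y Y' : TopCat.{u}} {M₁ : X.Fib S} {M₂ : X.Fib T} {f₁ : Y ⟶ S}
    {f₂ : Y ⟶ T} (φ : X.pull f₁ M₁ ≅ X.pull f₂ M₂) (g : Y' ⟶ Y) (g₁ : Y' ⟶ S)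
    (g₂ : Y' ⟶ T) (h₁ : g ≫ f₁ = g₁) (h₂ : g ≫ f₂ = g₂)
    (ψ : X.pull g₁ M₁ ≅ X.pull g₂ M₂) (hψ : pullHom φ.hom g g₁ g₂ h₁ h₂ = ψ.hom) :
    pullHom φ.inv g g₂ g₁ h₂ h₁ = ψ.inv := by
  rw [← cancel_epi ψ.hom, ← hψ, ← pullHom_comp, φ.hom_inv_id, pullHom_id', hψ, ψ.hom_inv_id]

theorem pullHom_composite_inv {Q R S T : TopCat.{u}} (h : R ⟶ S) (g : S ⟶ T) (f : R ⟶ T)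
    (e : h ≫ g = f) (z : X.Fib T) (k : Q ⟶ R) (h' : Q ⟶ S) (f' : Q ⟶ T) (eh : k ≫ h = h')
    (ef : k ≫ f = f') :
    pullHom (F := X) (M₁ := z) (M₂ := X.pull g z) (composite h g f e z).inv k f' h' ef eh =
      (composite h' g f' (by rw [← eh, ← ef, ← e, Category.assoc]) z).inv :=
  pullHom_inv (M₁ := X.pull g z) (M₂ := z) _ _ _ _ _ _ _
    (pullHom_composite_hom _ _ _ _ _ _ _ _ _ _)

theorem pullHom_self {S T Y : TopCat.{u}} {M₁ : X.Fib S} {M₂ : X.Fib T} {f₁ : Y ⟶ S}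
    {f₂ : Y ⟶ T} (φ : X.pull f₁ M₁ ⟶ X.pull f₂ M₂) :
    pullHom φ (𝟙 Y) f₁ f₂ (Category.id_comp _) (Category.id_comp _) = φ := by
  exact pullHom_id φ

theorem toCoarse_eq_iff {S T : TopCat.{u}} (z : X.Fib S) (w : X.Fib T) (s : S) (t : T) :
    X.toCoarse z s = X.toCoarse w t ↔ Nonempty (X.fibreAt z s ≅ X.fibreAt w t) :=
  Quotient.eq (r := isIsomorphicSetoid (X.Fib pt))

theorem continuous_toCoarse {T : TopCat.{u}} (z : X.Fib T) : Continuous (X.toCoarse z) :=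
  continuous_iff_coinduced_le.2
    (le_iSup_of_le T (le_iSup (fun z : X.Fib T => TopologicalSpace.coinduced (X.toCoarse z) _) z))

theorem isOpen_coarse_iff {W : Set X.Coarse} :
    IsOpen W ↔ ∀ (T : TopCat.{u}) (z : X.Fib T), IsOpen (X.toCoarse z ⁻¹' W) := by
  refine ⟨fun h T z => h.preimage (continuous_toCoarse z), fun h => ?_⟩
  refine isOpen_iSup_iff.2 fun T => isOpen_iSup_iff.2 fun z => ?_
  exact isOpen_coinduced.2 (h T z)

/-- Every point `z` of `X` is the value of the map `z : * → X` at the point of `*`. -/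
noncomputable def fibreAtPt (z : X.Fib pt.{u}) : X.fibreAt z PUnit.unit ≅ z :=
  (Cat.Hom.toNatIso (X.mapId ⟨op pt⟩)).app z

theorem map_pt_injective {z z' : X.Fib pt.{u}} {θ θ' : z ⟶ z'}
    (h : (X.map (ptMap PUnit.unit : pt.{u} ⟶ pt.{u}).op.toLoc).toFunctor.map θ =
      (X.map (ptMap PUnit.unit : pt.{u} ⟶ pt.{u}).op.toLoc).toFunctor.map θ') : θ = θ' := by
  have e : ∀ θ : z ⟶ z', (X.map (ptMap PUnit.unit : pt.{u} ⟶ pt.{u}).op.toLoc).toFunctor.map θ ≫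
      (fibreAtPt z').hom = (fibreAtPt z).hom ≫ θ := fun θ =>
    (X.mapId ⟨op pt⟩).hom.toNatTrans.naturality θ
  rw [← cancel_epi (fibreAtPt z).hom, ← e, ← e, h]

namespace Presentation

variable [∀ T : TopCat.{u}, IsGroupoid (X.Fib T)] {P : X.Presentation}

/-- The map from `X` to the stack of an atlas is faithful on points. -/
theorem toStack_map_injective (hP : P.HasLifts) {z z' : X.Fib pt.{u}} :
    Function.Injective fun θ : z ⟶ z' => ((toStack hP).app ⟨op pt⟩).toFunctor.map θ := by
  intro θ θ' h
  obtain ⟨i, hi⟩ := hP z PUnit.unit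
  obtain ⟨j, hj⟩ := hP z' PUnit.unit
  have h1 := congrArg (fun φ : Cocycle.Hom (P.cocycle hP z) (P.cocycle hP z') =>
    φ.mor i j PUnit.unit hi hj) h
  have h2 := transition_injective h1
  refine map_pt_injective ?_
  exact (germ_map (𝟙 pt) θ PUnit.unit PUnit.unit rfl).symm.trans
    (h2.trans (germ_map (𝟙 pt) θ' PUnit.unit PUnit.unit rfl))

theorem toCoarse_eq_toCoarse_iff (u v : P.U) :
    X.toCoarse P.x u = X.toCoarse P.x v ↔ ∃ m : P.M, P.p m = u ∧ P.q m = v := by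
  rw [toCoarse_eq_iff]
  constructor
  · rintro ⟨ψ⟩
    exact ⟨P.ofHom ψ.hom, p_ofHom _, q_ofHom _⟩
  · rintro ⟨m, hu, hv⟩
    exact ⟨asIso (P.arr m u v hu hv)⟩

theorem toCoarse_val {T : TopCat.{u}} {z : X.Fib T} (i : P.LocalLift z) (t : T) (h : t ∈ i.N) :
    X.toCoarse P.x (i.y ⟨t, h⟩) = X.toCoarse z t :=
  (toCoarse_eq_iff _ _ _ _).2 ⟨asIso (i.val t h)⟩

theorem toCoarse_surjective (hP : P.HasLifts) : Function.Surjective (X.toCoarse P.x) := by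
  intro c
  induction c using Quotient.inductionOn with | _ z
  obtain ⟨i, hi⟩ := hP z PUnit.unit
  refine ⟨i.y ⟨PUnit.unit, hi⟩, (toCoarse_val i _ hi).trans ?_⟩
  exact Quotient.sound ⟨fibreAtPt z⟩

/-- The map from an atlas to the coarse space is open: saturations of open sets are open, and every
map to `X` lifts locally to the atlas. -/
theorem isOpenMap_toCoarse (hP : P.HasLifts) (hq : IsOpenMap P.q) :
    IsOpenMap (X.toCoarse P.x) := by
  intro V hV
  have e : X.toCoarse P.x ⁻¹' (X.toCoarse P.x '' V) = P.q '' (P.p ⁻¹' V) := by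
    ext v
    simp only [Set.mem_preimage, Set.mem_image, toCoarse_eq_toCoarse_iff]
    constructor
    · rintro ⟨u, hu, m, rfl, rfl⟩
      exact ⟨m, hu, rfl⟩
    · rintro ⟨m, hm, rfl⟩
      exact ⟨_, hm, m, rfl, rfl⟩
  have ho : IsOpen (X.toCoarse P.x ⁻¹' (X.toCoarse P.x '' V)) := by
    rw [e]
    exact hq _ (hV.preimage P.p.hom.continuous)
  refine isOpen_coarse_iff.2 fun T z => isOpen_iff_mem_nhds.2 fun t ht => ?_
  obtain ⟨i, hi⟩ := hP z t
  have := i.isOpen.isOpenMap_subtype_val _ (ho.preimage i.y.hom.continuous)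
  refine Filter.mem_of_superset (this.mem_nhds ⟨⟨t, hi⟩, ?_, rfl⟩) ?_
  · exact (congrArg (· ∈ X.toCoarse P.x '' V) (toCoarse_val i t hi)).mpr ht
  · rintro _ ⟨⟨s, hs⟩, hs', rfl⟩
    exact (congrArg (· ∈ X.toCoarse P.x '' V) (toCoarse_val i s hs)).mp hs'

end Presentation

theorem IsEtaleAtlas.hasLifts [∀ T : TopCat.{u}, IsGroupoid (X.Fib T)] {P : X.Presentation}
    (h : X.IsEtaleAtlas P.x) : P.HasLifts := by
  intro T z t
  obtain ⟨W, p, q, θ, -, hq, hs⟩ := h T z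
  obtain ⟨w, rfl⟩ := hs t
  obtain ⟨e, hw, he⟩ := hq w
  let s : TopCat.of e.target ⟶ W :=
    TopCat.ofHom ⟨fun t => e.symm t.1,
      continuousOn_iff_continuous_domRestrict.1 e.continuousOn_symm⟩
  have hsq : s ≫ q = Presentation.incl e.target := by
    ext t
    change q (e.symm t.1) = t.1
    rw [he]
    exact e.right_inv t.2
  refine ⟨⟨e.target, e.open_target, s ≫ p, pullHom θ.hom s (s ≫ p) _ rfl hsq⟩, ?_⟩
  rw [he]
  exact e.map_source hw

theorem _root_.CategoryTheory.Iso.hom_comp_conj_comp_inv {C : Type*} [Category C] {a b c d : C}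
    (f : a ≅ b) (g : c ≅ d) (h : a ⟶ c) : f.hom ≫ (f.inv ≫ h ≫ g.hom) ≫ g.inv = h := by
  simp

/-- The fibre product of two maps is the pullback of the diagonal along their product. -/
theorem exists_homeomorph_diagonal {S T : TopCat.{u}} {x : X.Fib S} {y : X.Fib T} {W : TopCat.{u}}
    {p : W ⟶ S} {q : W ⟶ T} {θ : X.pull p x ≅ X.pull q y} (h : X.IsFibreProduct x y W p q θ)
    {D : TopCat.{u}} {d : D ⟶ TopCat.of (S × T)}
    {δ : X.pull d (X.pull (TopCat.ofHom (ContinuousMap.fst : C(S × T, S))) x) ≅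
      X.pull d (X.pull (TopCat.ofHom (ContinuousMap.snd : C(S × T, T))) y)}
    (hD : X.IsDiagonalPullback _ _ D d δ) :
    ∃ e : W ≃ₜ D, ∀ w, d (e w) = (p w, q w) := by
  let f : TopCat.of (S × T) ⟶ S := TopCat.ofHom (ContinuousMap.fst : C(S × T, S))
  let g : TopCat.of (S × T) ⟶ T := TopCat.ofHom (ContinuousMap.snd : C(S × T, T))
  let c : W ⟶ TopCat.of (S × T) := TopCat.ofHom ⟨fun w => (p w, q w), by fun_prop⟩
  let θ' : X.pull c (X.pull f x) ≅ X.pull c (X.pull g y) :=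
    composite c f p rfl x ≪≫ θ ≪≫ (composite c g q rfl y).symm
  let δ' : X.pull (d ≫ f) x ≅ X.pull (d ≫ g) y :=
    (composite d f (d ≫ f) rfl x).symm ≪≫ δ ≪≫ composite d g (d ≫ g) rfl y
  obtain ⟨k, ⟨hk, hk'⟩, -⟩ := hD W c θ'
  obtain ⟨l, ⟨hl₁, hl₂, hl'⟩, -⟩ := h D (d ≫ f) (d ≫ g) δ'
  have hkl : k ≫ l = 𝟙 W := by
    refine (h W p q θ).unique ⟨?_, ?_, ?_⟩ ⟨Category.id_comp _, Category.id_comp _, pullHom_self _⟩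
    · rw [Category.assoc, hl₁, reassoc_of% hk]; rfl
    · rw [Category.assoc, hl₂, reassoc_of% hk]; rfl
    · refine (pullHom_pullHom (F := X) θ.hom l (d ≫ f) (d ≫ g) k p q hl₁ hl₂
        (by rw [reassoc_of% hk]; rfl) (by rw [reassoc_of% hk]; rfl)).symm.trans ?_
      rw [hl']
      refine (pullHom_comp (X := X) (M₁ := x) (M₂ := X.pull f x) (M₃ := y)
        _ _ k p c q _ hk _).trans ?_
      refine (congrArg (_ ≫ ·) (pullHom_comp (X := X) (M₁ := X.pull f x) (M₂ := X.pull g y)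
        (M₃ := y) _ _ k c c q hk hk _)).trans ?_
      rw [hk']
      erw [pullHom_composite_hom, pullHom_composite_inv]
      · simp [θ']
      · rfl
  have hlk : l ≫ k = 𝟙 D := by
    have hlc : l ≫ c = d := by
      ext w
      · exact congrArg (fun j : D ⟶ S => j w) hl₁
      · exact congrArg (fun j : D ⟶ T => j w) hl₂
    refine (hD D d δ).unique ⟨?_, ?_⟩ ⟨Category.id_comp _, pullHom_self _⟩
    · rw [Category.assoc, hk, hlc]
    · refine (pullHom_pullHom (F := X) δ.hom k c c l d d hk hk hlc hlc).symm.trans ?_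
      rw [hk']
      refine (pullHom_comp (X := X) (M₁ := X.pull f x) (M₂ := x) (M₃ := X.pull g y)
        _ _ l d (d ≫ f) d hlc hl₁ hlc).trans ?_
      refine (congrArg (_ ≫ ·) (pullHom_comp (X := X) (M₁ := x) (M₂ := y) (M₃ := X.pull g y)
        _ _ l (d ≫ f) (d ≫ g) d hl₁ hl₂ hlc)).trans ?_
      rw [hl']
      erw [pullHom_composite_hom, pullHom_composite_inv]
      · exact Iso.hom_comp_conj_comp_inv (composite d f (d ≫ f) rfl x)
          (composite d g (d ≫ g) rfl y) δ.hom
      · rfl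
  refine ⟨⟨⟨k, l, fun w => congrArg (fun j : W ⟶ W => j w) hkl,
    fun w => congrArg (fun j : D ⟶ D => j w) hlk⟩, k.hom.continuous, l.hom.continuous⟩, fun w => ?_⟩
  exact congrArg (fun j : W ⟶ TopCat.of (S × T) => j w) hk

/-- The groupoid of an étale atlas inherits étaleness, and a separated and proper diagonal. -/
theorem IsOrbispace.exists_presentation (hX : X.IsOrbispace) :
    haveI := hX.isGroupoid
    ∃ P : X.Presentation, P.HasLifts ∧ IsLocalHomeomorph P.q ∧
      IsSeparatedMap (fun m : P.M => (P.p m, P.q m)) ∧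
      IsProperMap (fun m : P.M => (P.p m, P.q m)) := by
  have := hX.isGroupoid
  obtain ⟨U, x, hx⟩ := hX.exists_atlas
  obtain ⟨M, p, q, θ, hM, hq, -⟩ := hx U x
  obtain ⟨D, d, δ, hD, hsep, hprop⟩ := hX.diagonal (TopCat.of (U × U))
    (X.pull (TopCat.ofHom (ContinuousMap.fst : C(U × U, U))) x)
    (X.pull (TopCat.ofHom (ContinuousMap.snd : C(U × U, U))) x)
  obtain ⟨e, he⟩ := exists_homeomorph_diagonal hM hD
  have hde : (fun m : M => (p m, q m)) = d ∘ e := funext fun m => (he m).symm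
  refine ⟨⟨U, x, M, p, q, θ, hM⟩, hx.hasLifts (P := ⟨U, x, M, p, q, θ, hM⟩), hq, ?_, ?_⟩
  · change IsSeparatedMap (fun m : M => (p m, q m))
    rw [hde]
    exact IsSeparatedMap.comp_right hsep e.continuous e.injective
  · change IsProperMap (fun m : M => (p m, q m))
    rw [hde]
    exact hprop.comp e.isProperMap

end TopPrestack

/-! ### Functors defined on an open cover -/

/-- A functor to `𝒢` from the Čech groupoid of an open cover `N` of the objects of `𝒰`: it has a
value `obj k y` for every member `N k` of the cover containing `y`, and a value `mor k k' r` for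
every arrow `r` and all members `N k` and `N k'` of the cover containing its ends. -/
structure CechFunctor (𝒰 𝒢 : TopGroupoid.{u}) where
  K : Type u
  N : K → Set 𝒰.O
  isOpen_N : ∀ k, IsOpen (N k)
  cover : ∀ y, ∃ k, y ∈ N k
  obj : ∀ k y, y ∈ N k → 𝒢.O
  mor : ∀ k k' r, 𝒰.src r ∈ N k → 𝒰.tgt r ∈ N k' → 𝒢.M
  continuous_obj : ∀ k, Continuous fun y : N k => obj k y.1 y.2
  continuous_mor : ∀ k k', Continuous fun r : {r : 𝒰.M // 𝒰.src r ∈ N k ∧ 𝒰.tgt r ∈ N k'} =>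
    mor k k' r.1 r.2.1 r.2.2
  src_mor : ∀ k k' r h h', 𝒢.src (mor k k' r h h') = obj k (𝒰.src r) h
  tgt_mor : ∀ k k' r h h', 𝒢.tgt (mor k k' r h h') = obj k' (𝒰.tgt r) h'
  comp_mor : ∀ k k' k'' r r' (e : 𝒰.tgt r = 𝒰.src r') h₁ h₂ h₁' h₂'
    (H : 𝒢.tgt (mor k k' r h₁ h₂) = 𝒢.src (mor k' k'' r' h₁' h₂')) h h',
    𝒢.comp (mor k k' r h₁ h₂) (mor k' k'' r' h₁' h₂') H = mor k k'' (𝒰.comp r r' e) h h'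

namespace CechFunctor

variable {𝒰 𝒢 : TopGroupoid.{u}} (F : CechFunctor 𝒰 𝒢) {T : Type u} [TopologicalSpace T]

theorem obj_congr {k : F.K} {y y' : 𝒰.O} (e : y = y') (h : y ∈ F.N k) (h' : y' ∈ F.N k) :
    F.obj k y h = F.obj k y' h' := by
  subst e; rfl

theorem comp_mor' {k k' k'' : F.K} {r r' r'' : 𝒰.M} (e : 𝒰.tgt r = 𝒰.src r')
    (e' : 𝒰.comp r r' e = r'') (h₁ : 𝒰.src r ∈ F.N k) (h₂ : 𝒰.tgt r ∈ F.N k')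
    (h₁' : 𝒰.src r' ∈ F.N k') (h₂' : 𝒰.tgt r' ∈ F.N k'') (h₁'' : 𝒰.src r'' ∈ F.N k)
    (h₂'' : 𝒰.tgt r'' ∈ F.N k'')
    (H : 𝒢.tgt (F.mor k k' r h₁ h₂) = 𝒢.src (F.mor k' k'' r' h₁' h₂')) :
    𝒢.comp (F.mor k k' r h₁ h₂) (F.mor k' k'' r' h₁' h₂') H = F.mor k k'' r'' h₁'' h₂'' := by
  subst e'
  exact F.comp_mor _ _ _ _ _ _ _ _ _ _ _ _ _

/-- The image of a cocycle. -/
def cocycle (c : Cocycle 𝒰 T) : Cocycle 𝒢 T where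
  ι := c.ι × F.K
  U i := {t | ∃ h : t ∈ c.U i.1, c.obj i.1 t h ∈ F.N i.2}
  isOpen_U i := by
    have := (c.isOpen_U i.1).isOpenMap_subtype_val _
      ((F.isOpen_N i.2).preimage (c.continuous_obj i.1))
    convert this using 1
    ext t
    simp
  cover t := by
    obtain ⟨i, hi⟩ := c.cover t
    obtain ⟨k, hk⟩ := F.cover (c.obj i t hi)
    exact ⟨(i, k), hi, hk⟩
  obj i t h := F.obj i.2 (c.obj i.1 t h.1) h.2
  mor i j t hi hj := F.mor i.2 j.2 (c.mor i.1 j.1 t hi.1 hj.1)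
    (by rw [c.src_mor]; exact hi.2) (by rw [c.tgt_mor]; exact hj.2)
  continuous_obj i := by
    have h : Continuous fun t : {t | ∃ h : t ∈ c.U i.1, c.obj i.1 t h ∈ F.N i.2} =>
      c.obj i.1 t.1 t.2.1 := (c.continuous_obj i.1).comp (by fun_prop :
        Continuous fun t : {t | ∃ h : t ∈ c.U i.1, c.obj i.1 t h ∈ F.N i.2} =>
          (⟨t.1, t.2.1⟩ : c.U i.1))
    exact (F.continuous_obj i.2).comp (h.subtype_mk fun t => t.2.2)
  continuous_mor i j := by
    have h := (c.continuous_mor i.1 j.1).comp (by fun_prop : Continuous fun t : {t //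
      (∃ h : t ∈ c.U i.1, c.obj i.1 t h ∈ F.N i.2) ∧ ∃ h : t ∈ c.U j.1, c.obj j.1 t h ∈ F.N j.2} =>
        (⟨t.1, t.2.1.1, t.2.2.1⟩ : {t // t ∈ c.U i.1 ∧ t ∈ c.U j.1}))
    exact (F.continuous_mor i.2 j.2).comp (h.subtype_mk fun t =>
      ⟨by dsimp; rw [c.src_mor]; exact t.2.1.2, by dsimp; rw [c.tgt_mor]; exact t.2.2.2⟩)
  src_mor i j t hi hj := (F.src_mor _ _ _ _ _).trans (F.obj_congr (c.src_mor _ _ _ _ _) _ _)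
  tgt_mor i j t hi hj := (F.tgt_mor _ _ _ _ _).trans (F.obj_congr (c.tgt_mor _ _ _ _ _) _ _)
  mor_comp_mor i j k t hi hj hk := F.comp_mor' _ (c.mor_comp_mor _ _ _ _ _ _ _) _ _ _ _ _ _ _

/-- The image of an isomorphism of cocycles. -/
def hom {c c' : Cocycle 𝒰 T} (φ : Cocycle.Hom c c') : Cocycle.Hom (F.cocycle c) (F.cocycle c') where
  mor i j t hi hj := F.mor i.2 j.2 (φ.mor i.1 j.1 t hi.1 hj.1)
    (by rw [φ.src_mor]; exact hi.2) (by rw [φ.tgt_mor]; exact hj.2)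
  continuous_mor i j := by
    have h := (φ.continuous_mor i.1 j.1).comp (by fun_prop : Continuous fun t : {t //
      (∃ h : t ∈ c.U i.1, c.obj i.1 t h ∈ F.N i.2) ∧
        ∃ h : t ∈ c'.U j.1, c'.obj j.1 t h ∈ F.N j.2} =>
        (⟨t.1, t.2.1.1, t.2.2.1⟩ : {t // t ∈ c.U i.1 ∧ t ∈ c'.U j.1}))
    exact (F.continuous_mor i.2 j.2).comp (h.subtype_mk fun t =>
      ⟨by dsimp; rw [φ.src_mor]; exact t.2.1.2, by dsimp; rw [φ.tgt_mor]; exact t.2.2.2⟩)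
  src_mor i j t hi hj := (F.src_mor _ _ _ _ _).trans (F.obj_congr (φ.src_mor _ _ _ _ _) _ _)
  tgt_mor i j t hi hj := (F.tgt_mor _ _ _ _ _).trans (F.obj_congr (φ.tgt_mor _ _ _ _ _) _ _)
  left_comp i j k t hi hj hk := F.comp_mor' _ (φ.left_comp _ _ _ _ _ _ _) _ _ _ _ _ _ _
  comp_right i j k t hi hj hk := F.comp_mor' _ (φ.comp_right _ _ _ _ _ _ _) _ _ _ _ _ _ _

/-- The functor on cocycles. -/
def functor (T : Type u) [TopologicalSpace T] : Cocycle 𝒰 T ⥤ Cocycle 𝒢 T where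
  obj := F.cocycle
  map := F.hom
  map_id _ := rfl
  map_comp {c c' c''} φ ψ := by
    refine Cocycle.Hom.ext ?_
    funext i j t hi hj
    obtain ⟨k, hk⟩ := (F.cocycle c').cover t
    refine Eq.trans ?_ (Cocycle.Hom.comp_mor (F.hom φ) (F.hom ψ) i k j t hi hk hj).symm
    exact (F.comp_mor' _ (Cocycle.Hom.comp_mor φ ψ i.1 k.1 j.1 t hi.1 hk.1 hj.1).symm
      _ _ _ _ _ _ _).symm

/-- The induced map of stacks. -/
noncomputable def strongTrans : Pseudofunctor.StrongTrans 𝒰.stack 𝒢.stack where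
  app a := (F.functor a.as.unop).toCatHom
  naturality {a b} f := Cat.Hom.isoMk (NatIso.ofComponents
    (F := Cocycle.pullbackFunctor 𝒰 f.as.unop.hom ⋙ F.functor b.as.unop)
    (G := F.functor a.as.unop ⋙ Cocycle.pullbackFunctor 𝒢 f.as.unop.hom)
    (fun c => Iso.refl ((F.cocycle c).pullback f.as.unop.hom)) (fun φ =>
      (Category.comp_id (obj := Cocycle 𝒢 b.as.unop) (F.hom (φ.pullback f.as.unop.hom))).trans
        (Category.id_comp (obj := Cocycle 𝒢 b.as.unop)
          ((F.hom φ).pullback f.as.unop.hom)).symm))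
  naturality_naturality {a b f g} η := by
    obtain rfl : f = g := LocallyDiscrete.eq_of_hom η
    obtain rfl : η = 𝟙 _ := Subsingleton.elim _ _
    have h1 : Bicategory.whiskerRight (𝒰.stack.map₂ (𝟙 f)) (F.functor b.as.unop).toCatHom =
        𝟙 _ :=
      (congrArg (fun η => Bicategory.whiskerRight η _) (PrelaxFunctor.map₂_id _ _)).trans
        (Bicategory.id_whiskerRight _ _)
    have h2 : Bicategory.whiskerLeft (F.functor a.as.unop).toCatHom
        (𝒢.stack.map₂ (𝟙 f)) = 𝟙 _ :=
      (congrArg _ (PrelaxFunctor.map₂_id _ _)).trans (Bicategory.whiskerLeft_id _ _)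
    refine (congrArg (· ≫ _) h1).trans ((Category.id_comp _).trans ?_)
    exact ((congrArg (_ ≫ ·) h2).trans (Category.comp_id _)).symm
  naturality_id a := by
    refine Cat.Hom₂.ext (NatTrans.ext (funext fun c => ?_))
    have h1 := 𝒢.stack_mapId_hom_app a (F.cocycle c)
    have h2 : 𝟙 (F.cocycle c) =
        (F.functor a.as.unop).map ((𝒰.stack.mapId a).hom.toNatTrans.app c) :=
      ((congrArg (F.functor a.as.unop).map (𝒰.stack_mapId_hom_app a c)).trans
        ((F.functor a.as.unop).map_id c)).symm
    exact comp_id_eq_of_eq' (C := Cocycle 𝒢 a.as.unop) h1 rfl rfl h2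
  naturality_comp {a b c} f g := by
    refine Cat.Hom₂.ext (NatTrans.ext (funext fun z => ?_))
    have h1 := 𝒢.stack_mapComp_hom_app f g (F.cocycle z)
    let w : Cocycle 𝒢 c.as.unop := F.cocycle ((𝒰.stack.map (f ≫ g)).toFunctor.obj z)
    have h3 : (F.functor c.as.unop).map ((𝒰.stack.mapComp f g).hom.toNatTrans.app z) = 𝟙 w :=
      (congrArg (F.functor c.as.unop).map (𝒰.stack_mapComp_hom_app f g z)).trans
        ((F.functor c.as.unop).map_id _)
    have h2 : 𝟙 w = (F.functor c.as.unop).map ((𝒰.stack.mapComp f g).hom.toNatTrans.app z) ≫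
        𝟙 w ≫ 𝟙 w := by
      refine Eq.symm ?_
      refine (congrArg (fun η => CategoryStruct.comp (Z := w) η (𝟙 w ≫ 𝟙 w)) h3).trans ?_
      exact (Category.id_comp _).trans (Category.id_comp _)
    exact comp_id_eq_of_eq (C := Cocycle 𝒢 c.as.unop) h1 rfl rfl rfl h2

/-- A functor which is injective on the arrows with given ends induces a faithful map of
stacks. -/
theorem hom_injective (H : ∀ k k' r r' h₁ h₂ h₁' h₂', 𝒰.src r = 𝒰.src r' → 𝒰.tgt r = 𝒰.tgt r' →
    F.mor k k' r h₁ h₂ = F.mor k k' r' h₁' h₂' → r = r') {c c' : Cocycle 𝒰 T} :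
    Function.Injective (F.hom : Cocycle.Hom c c' → _) := by
  intro φ ψ h
  refine Cocycle.Hom.ext ?_
  funext i j t hi hj
  obtain ⟨k, hk⟩ := F.cover (c.obj i t hi)
  obtain ⟨k', hk'⟩ := F.cover (c'.obj j t hj)
  have := congrArg (fun φ : Cocycle.Hom (F.cocycle c) (F.cocycle c') =>
    φ.mor (i, k) (j, k') t ⟨hi, hk⟩ ⟨hj, hk'⟩) h
  exact H _ _ _ _ _ _ _ _ (by rw [φ.src_mor, ψ.src_mor]) (by rw [φ.tgt_mor, ψ.tgt_mor]) this

end CechFunctor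

namespace TopPrestack

variable {X : TopPrestack.{u}} [∀ T : TopCat.{u}, IsGroupoid (X.Fib T)]

/-- A functor on the Čech groupoid of a cover of an atlas of `X`, injective on arrows with given
ends, induces a map of stacks which is injective on isotropy groups. -/
theorem Presentation.exists_injectiveOnIsotropy {P : X.Presentation} (hP : P.HasLifts)
    {𝒢 : TopGroupoid.{u}} (F : CechFunctor P.groupoid 𝒢)
    (H : ∀ k k' r r' h₁ h₂ h₁' h₂', P.p r = P.p r' → P.q r = P.q r' →
      F.mor k k' r h₁ h₂ = F.mor k k' r' h₁' h₂' → r = r') :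
    ∃ f : Pseudofunctor.StrongTrans X 𝒢.stack, InjectiveOnIsotropy f := by
  refine ⟨(toStack hP).vcomp F.strongTrans, fun x a b h => ?_⟩
  have h1 := congrArg Iso.hom h
  refine Iso.ext (toStack_map_injective hP ?_)
  exact F.hom_injective H h1

end TopPrestack

/-! ### Families of subsets of products of groups -/

section Families

variable {A : Type u}

/-- A family of subsets `s a b ⊆ Γ a × Γ b`, recording the relative position of frames. -/
@[ext]
structure Family (Γ : A → Type u) where
  rel : ∀ a b, Set (Γ a × Γ b)

variable {Γ : A → Type u} [∀ a, Group (Γ a)]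

namespace Family

/-- Right translation of the factors, which makes a left action because it is applied to the
elements of the subsets, not to the subsets. -/
instance : MulAction (∀ a, Γ a) (Family Γ) where
  smul k s := ⟨fun a b => {w | (w.1 * k a, w.2 * k b) ∈ s.rel a b}⟩
  one_smul s := by
    ext a b w
    change (w.1 * 1, w.2 * 1) ∈ s.rel a b ↔ _
    simp
  mul_smul k k' s := by
    ext a b w
    change (w.1 * (k a * k' a), w.2 * (k b * k' b)) ∈ s.rel a b ↔
      (w.1 * k a * k' a, w.2 * k b * k' b) ∈ s.rel a b
    simp [mul_assoc]

theorem mem_smul (k : ∀ a, Γ a) (s : Family Γ) (a b : A) (w : Γ a × Γ b) :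
    w ∈ (k • s).rel a b ↔ (w.1 * k a, w.2 * k b) ∈ s.rel a b := Iff.rfl

/-- The part of a family indexed by the elements of `σ`. -/
def restrict (σ : Finset A) (s : Family Γ) : Family Γ :=
  ⟨fun a b => {w | a ∈ σ ∧ b ∈ σ ∧ w ∈ s.rel a b}⟩

theorem mem_restrict (σ : Finset A) (s : Family Γ) (a b : A) (w : Γ a × Γ b) :
    w ∈ (restrict σ s).rel a b ↔ a ∈ σ ∧ b ∈ σ ∧ w ∈ s.rel a b := Iff.rfl

theorem restrict_restrict {ρ σ : Finset A} (h : ρ ⊆ σ) (s : Family Γ) :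
    restrict ρ (restrict σ s) = restrict ρ s := by
  ext a b w
  simp only [mem_restrict]
  have h₁ : a ∈ ρ → a ∈ σ := fun h' => h h'
  have h₂ : b ∈ ρ → b ∈ σ := fun h' => h h'
  tauto

theorem restrict_smul (σ : Finset A) (k : ∀ a, Γ a) (s : Family Γ) :
    restrict σ (k • s) = k • restrict σ s := rfl

open Classical in
/-- The projection to the factors indexed by `σ`, as an endomorphism of the full product. -/
noncomputable def proj (Γ : A → Type u) [∀ a, Group (Γ a)] (σ : Finset A) :
    (∀ a, Γ a) →* (∀ a, Γ a) where
  toFun k a := if a ∈ σ then k a else 1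
  map_one' := by ext a; simp
  map_mul' k k' := by
    ext a
    by_cases h : a ∈ σ <;> simp [h]

theorem proj_apply_of_mem {σ : Finset A} {a : A} (h : a ∈ σ) (k : ∀ a, Γ a) :
    proj Γ σ k a = k a := if_pos h

theorem proj_apply_of_notMem {σ : Finset A} {a : A} (h : a ∉ σ) (k : ∀ a, Γ a) :
    proj Γ σ k a = 1 := if_neg h

theorem proj_proj {ρ σ : Finset A} (h : ρ ⊆ σ) (k : ∀ a, Γ a) :
    proj Γ ρ (proj Γ σ k) = proj Γ ρ k := by
  ext a
  by_cases ha : a ∈ ρ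
  · rw [proj_apply_of_mem ha, proj_apply_of_mem ha, proj_apply_of_mem (h ha)]
  · rw [proj_apply_of_notMem ha, proj_apply_of_notMem ha]

theorem proj_smul_restrict (σ : Finset A) (k : ∀ a, Γ a) (s : Family Γ) :
    proj Γ σ k • restrict σ s = k • restrict σ s := by
  ext a b w
  simp only [mem_smul, mem_restrict]
  refine and_congr_right fun ha => and_congr_right fun hb => ?_
  rw [proj_apply_of_mem ha, proj_apply_of_mem hb]

end Family

open Family

/-! ### The barycentric complex of groups of a collection of families -/

/-- A collection of families indexed by finite subsets of `A`; the groups `Γ a` act freely on their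
off-diagonal components. -/
structure TypeSystem (Γ : A → Type u) [∀ a, Group (Γ a)] where
  Realized : Finset A → Family Γ → Prop
  nonempty : ∀ {τ s}, Realized τ s → τ.Nonempty
  restrict_eq : ∀ {τ s}, Realized τ s → restrict τ s = s
  rel_self : ∀ {τ s}, Realized τ s → ∀ a ∈ τ, s.rel a a = Set.univ
  free : ∀ {τ s}, Realized τ s → ∀ a ∈ τ, ∀ b ∈ τ, ∀ k : ∀ a, Γ a,
    (k • s).rel a b = s.rel a b → k a = 1 → k b = 1

namespace TypeSystem

variable (𝒯 : TypeSystem Γ)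

/-- The vertices: finite subsets `τ` of `A` with an isomorphism class of families indexed
by `τ`. -/
def Vertex : Type u :=
  {x : Finset A × MulAction.orbitRel.Quotient (∀ a, Γ a) (Family Γ) //
    ∃ s, 𝒯.Realized x.1 s ∧ (Quotient.mk'' s : MulAction.orbitRel.Quotient _ _) = x.2}

variable {𝒯}

namespace Vertex

/-- The underlying subset of `A`. -/
def set (π : 𝒯.Vertex) : Finset A := π.1.1

/-- The isomorphism class. -/
def type (π : 𝒯.Vertex) : MulAction.orbitRel.Quotient (∀ a, Γ a) (Family Γ) := π.1.2

/-- A representative of the isomorphism class. -/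
noncomputable def rep (π : 𝒯.Vertex) : Family Γ := π.2.choose

theorem realized (π : 𝒯.Vertex) : 𝒯.Realized π.set π.rep := π.2.choose_spec.1

theorem mk_rep (π : 𝒯.Vertex) :
    (Quotient.mk'' π.rep : MulAction.orbitRel.Quotient _ _) = π.type := π.2.choose_spec.2

theorem restrict_rep (π : 𝒯.Vertex) : restrict π.set π.rep = π.rep := 𝒯.restrict_eq π.realized

/-- An element of the underlying subset. -/
noncomputable def base (π : 𝒯.Vertex) : A := (𝒯.nonempty π.realized).choose

theorem base_mem (π : 𝒯.Vertex) : π.base ∈ π.set := (𝒯.nonempty π.realized).choose_spec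

theorem mk_eq_type_iff (π : 𝒯.Vertex) (s : Family Γ) :
    (Quotient.mk'' s : MulAction.orbitRel.Quotient (∀ a, Γ a) (Family Γ)) = π.type ↔
      ∃ g : ∀ a, Γ a, s = g • π.rep := by
  rw [← mk_rep, Quotient.eq'', MulAction.orbitRel_apply, MulAction.mem_orbit_iff]
  exact exists_congr fun g => eq_comm

/-- `π ≤ π'` if the families of `π'` restrict to those of `π`. -/
instance : PartialOrder 𝒯.Vertex where
  le π π' := π.set ⊆ π'.set ∧ ∃ g : ∀ a, Γ a, restrict π.set π'.rep = g • π.rep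
  le_refl π := ⟨subset_rfl, 1, by rw [restrict_rep, one_smul]⟩
  le_trans π π' π'' := by
    rintro ⟨h, g, hg⟩ ⟨h', g', hg'⟩
    refine ⟨h.trans h', g' * g, ?_⟩
    rw [← restrict_restrict h, hg', restrict_smul, hg, mul_smul]
  le_antisymm π π' := by
    rintro ⟨h, g, hg⟩ ⟨h', -⟩
    have e : π.set = π'.set := h.antisymm h'
    refine Subtype.ext (Prod.ext e ?_)
    change π.type = π'.type
    rw [← mk_rep π']
    refine ((mk_eq_type_iff π π'.rep).2 ⟨g, ?_⟩).symm
    rw [← hg, e, restrict_rep]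

theorem eq_of_le_of_set_eq {π π' : 𝒯.Vertex} (h : π ≤ π') (e : π.set = π'.set) : π = π' :=
  le_antisymm h (by
    obtain ⟨-, g, hg⟩ := h
    refine ⟨e.ge, g⁻¹, ?_⟩
    rw [e, restrict_rep] at hg
    rw [← e, restrict_rep, hg, inv_smul_smul])

end Vertex

variable (𝒯)

/-- The simplices are the finite chains of vertices. -/
def complex : AbstractSimplicialComplex 𝒯.Vertex where
  faces := {C | C.Nonempty ∧ IsChain (· ≤ ·) (C : Set 𝒯.Vertex)}
  isRelLowerSet_faces := fun C hC => ⟨hC.1, fun D hD hne =>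
    ⟨hne, hC.2.mono (Finset.coe_subset.2 hD)⟩⟩
  singleton_mem v := ⟨Finset.singleton_nonempty v, by simp⟩

variable {𝒯}

theorem exists_top (C : 𝒯.complex) : ∃ π ∈ C.1, ∀ π' ∈ C.1, π' ≤ π := by
  obtain ⟨π, hπ⟩ := C.1.exists_maximal C.2.1
  refine ⟨π, hπ.1, fun π' h' => ?_⟩
  rcases C.2.2.total hπ.1 h' with h | h
  · exact hπ.2 h' h
  · exact h

/-- The largest element of a chain. -/
noncomputable def top (C : 𝒯.complex) : 𝒯.Vertex := (exists_top C).choose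

theorem top_mem (C : 𝒯.complex) : top C ∈ C.1 := (exists_top C).choose_spec.1

theorem le_top (C : 𝒯.complex) {π : 𝒯.Vertex} (h : π ∈ C.1) : π ≤ top C :=
  (exists_top C).choose_spec.2 π h

theorem top_mono {C D : 𝒯.complex} (h : C ≤ D) : top C ≤ top D := le_top D (h (top_mem C))

/-- The subset of `A` carrying the group of a chain: a point for a chain with one element, and
otherwise the subset underlying the largest element. The point is chosen to make the vertex groups
equal to groups `Γ a`, since `rel_self` makes every element of `Γ a` an automorphism. -/
noncomputable def core (C : 𝒯.complex) : Finset A :=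
  if C.1.card = 1 then {(top C).base} else (top C).set

theorem core_subset_top (C : 𝒯.complex) : core C ⊆ (top C).set := by
  unfold core
  split_ifs
  · simpa using (top C).base_mem
  · exact subset_rfl

theorem core_nonempty (C : 𝒯.complex) : (core C).Nonempty := by
  unfold core
  split_ifs
  · simp
  · exact ⟨_, (top C).base_mem⟩

theorem core_mono {C D : 𝒯.complex} (h : C ≤ D) : core C ⊆ core D := by
  by_cases hD : D.1.card = 1
  · have : C = D := Subtype.ext (Finset.eq_of_subset_of_card_le h
      (hD.le.trans (Finset.card_pos.2 C.2.1)))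
    rw [this]
  · refine (core_subset_top C).trans ((top_mono h).1.trans ?_)
    rw [core, if_neg hD]

/-- The family of a chain. -/
noncomputable def family (C : 𝒯.complex) : Family Γ := restrict (core C) (top C).rep

theorem restrict_family (C : 𝒯.complex) : restrict (core C) (family C) = family C :=
  restrict_restrict subset_rfl _

theorem exists_transport {C D : 𝒯.complex} (h : C ≤ D) :
    ∃ g : ∀ a, Γ a, restrict (core C) (family D) = g • family C := by
  obtain ⟨-, g, hg⟩ := top_mono h
  refine ⟨g, ?_⟩
  rw [family, restrict_restrict (core_mono h), ← restrict_restrict (core_subset_top C), hg]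
  rfl

/-- An isomorphism between the family of `C` and the restriction of the family of `D ≥ C`. -/
noncomputable def transport {C D : 𝒯.complex} (h : C ≤ D) : ∀ a, Γ a :=
  proj Γ (core C) (exists_transport h).choose

theorem proj_transport {C D : 𝒯.complex} (h : C ≤ D) :
    proj Γ (core C) (transport h) = transport h := proj_proj subset_rfl _

theorem restrict_family_eq {C D : 𝒯.complex} (h : C ≤ D) :
    restrict (core C) (family D) = transport h • family C := by
  refine (exists_transport h).choose_spec.trans ?_
  have := proj_smul_restrict (core C) (exists_transport h).choose (family C)
  rw [restrict_family] at this
  exact this.symm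

/-- The automorphisms of the family of `C`, as elements of the product which are trivial outside
`core C`. -/
noncomputable def stabilizer (C : 𝒯.complex) : Subgroup (∀ a, Γ a) where
  carrier := {k | proj Γ (core C) k = k ∧ k • family C = family C}
  one_mem' := ⟨map_one _, one_smul _ _⟩
  mul_mem' {k k'} hk hk' := ⟨by rw [map_mul, hk.1, hk'.1], by rw [mul_smul, hk'.2, hk.2]⟩
  inv_mem' {k} hk := ⟨by rw [map_inv, hk.1], by rw [inv_smul_eq_iff, hk.2]⟩

theorem proj_smul_family {C D : 𝒯.complex} (k : ∀ a, Γ a) :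
    proj Γ (core C) k • restrict (core C) (family D) = restrict (core C) (k • family D) :=
  proj_smul_restrict _ _ _

theorem conj_proj_mem {C D : 𝒯.complex} (h : C ≤ D) {k : ∀ a, Γ a} (hk : k ∈ stabilizer D) :
    (transport h)⁻¹ * proj Γ (core C) k * transport h ∈ stabilizer C := by
  constructor
  · rw [map_mul, map_mul, map_inv, proj_transport, proj_proj subset_rfl]
  · rw [mul_smul, mul_smul, ← restrict_family_eq h, proj_smul_family, hk.2, restrict_family_eq h,
      inv_smul_smul]

/-- The transports along `C₀ ≤ C₁ ≤ C₂` and along `C₀ ≤ C₂` differ by an automorphism. -/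
theorem twist_mem {C₀ C₁ C₂ : 𝒯.complex} (h : C₀ ≤ C₁) (h' : C₁ ≤ C₂) :
    (transport (h.trans h'))⁻¹ * proj Γ (core C₀) (transport h') * transport h ∈
      stabilizer C₀ := by
  constructor
  · rw [map_mul, map_mul, map_inv, proj_transport, proj_transport, proj_proj subset_rfl]
  · rw [mul_smul, mul_smul, ← restrict_family_eq, proj_smul_family, ← restrict_family_eq,
      restrict_restrict (core_mono h), restrict_family_eq (h.trans h'), inv_smul_smul]

/-- An automorphism of a family is determined by any of its components, since the groups act freely
on off-diagonal components. -/
theorem eq_one_of_proj_eq_one {C D : 𝒯.complex} (h : C ≤ D) {k : ∀ a, Γ a}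
    (hk : k ∈ stabilizer D) (hk' : proj Γ (core C) k = 1) : k = 1 := by
  obtain ⟨a, ha⟩ := core_nonempty C
  have ha1 : k a = 1 := by rw [← proj_apply_of_mem ha k, hk', Pi.one_apply]
  have ha' := core_mono h ha
  ext b
  by_cases hb : b ∈ core D
  · refine 𝒯.free (top D).realized a (core_subset_top D ha') b (core_subset_top D hb) k ?_ ha1
    ext w
    have := congrArg (fun s : Family Γ => w ∈ s.rel a b) hk.2
    simpa only [mem_smul, family, mem_restrict, ha', hb, true_and, eq_iff_iff] using this
  · rw [← hk.1, proj_apply_of_notMem hb, Pi.one_apply]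

variable (𝒯)

/-- The complex of groups formed by the automorphism groups of the families. -/
noncomputable abbrev complexOfGroups : ComplexOfGroups 𝒯.Vertex where
  Z := 𝒯.complex
  G C := stabilizer C
  res {C D} h := {
    toFun k := ⟨_, conj_proj_mem h k.2⟩
    map_one' := Subtype.ext (by simp)
    map_mul' k k' := Subtype.ext (by simp [mul_assoc]) }
  res_injective {C D} h := (injective_iff_map_eq_one _).2 fun k hk => by
    have h1 : (transport h)⁻¹ * proj Γ (core C) k.1 * transport h = 1 := congrArg Subtype.val hk
    refine Subtype.ext (eq_one_of_proj_eq_one h k.2 ?_)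
    rwa [mul_assoc, inv_mul_eq_one, right_eq_mul] at h1
  tw h h' := ⟨_, twist_mem h h'⟩
  res_eq {C₀ C₁ C₂} h h' k := Subtype.ext (by
    change _ * proj Γ (core C₀) k.1 * _ =
      _ * (_ * proj Γ (core C₀) (_ * proj Γ (core C₁) k.1 * _) * _) * _⁻¹
    simp only [map_mul, map_inv, proj_proj (core_mono h)]
    group)
  tw_cocycle {C₀ C₁ C₂ C₃} h₁ h₂ h₃ := Subtype.ext (by
    change _ * (_ * proj Γ (core C₀) (_ * proj Γ (core C₁) _ * _) * _) * _⁻¹ * _⁻¹ = 1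
    simp only [map_mul, map_inv, proj_proj (core_mono h₁)]
    group)

variable {𝒯}

theorem top_vert (π : 𝒯.Vertex) : top (𝒯.complexOfGroups.vert π) = π := by
  exact Finset.mem_singleton.1 (top_mem (𝒯.complexOfGroups.vert π))

theorem core_vert (π : 𝒯.Vertex) : core (𝒯.complexOfGroups.vert π) = {π.base} := by
  refine (if_pos (Finset.card_singleton π)).trans ?_
  rw [top_vert]

theorem mem_stabilizer_vert {π : 𝒯.Vertex} {k : ∀ a, Γ a} :
    k ∈ stabilizer (𝒯.complexOfGroups.vert π) ↔
      proj Γ (core (𝒯.complexOfGroups.vert π)) k = k := by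
  refine ⟨fun h => h.1, fun h => ⟨h, ?_⟩⟩
  ext a b w
  simp only [mem_smul, family, mem_restrict, core_vert, top_vert, Finset.mem_singleton]
  refine and_congr_right fun ha => and_congr_right fun hb => ?_
  subst ha hb
  rw [𝒯.rel_self π.realized _ π.base_mem]
  simp

/-- The vertex groups are the groups `Γ a`. -/
theorem nonempty_vertexGroup_mulEquiv (π : 𝒯.Vertex) :
    Nonempty (𝒯.complexOfGroups.vertexGroup π ≃* Γ π.base) := by
  classical
  refine ⟨MulEquiv.ofBijective (((Pi.evalMonoidHom Γ π.base).comp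
    (stabilizer (𝒯.complexOfGroups.vert π)).subtype)) ⟨?_, fun x => ?_⟩⟩
  · rintro ⟨k, hk⟩ ⟨k', hk'⟩ h
    change k π.base = k' π.base at h
    refine Subtype.ext (funext fun a => ?_)
    change k a = k' a
    by_cases ha : a = π.base
    · subst ha; exact h
    · have ha' : a ∉ core (𝒯.complexOfGroups.vert π) := by rwa [core_vert, Finset.mem_singleton]
      rw [← hk.1, ← hk'.1, proj_apply_of_notMem ha', proj_apply_of_notMem ha']
  · refine ⟨⟨Pi.mulSingle π.base x, mem_stabilizer_vert.2 ?_⟩,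
      Pi.mulSingle_eq_same (M := Γ) π.base x⟩
    ext a
    by_cases ha : a = π.base
    · subst ha
      rw [proj_apply_of_mem (by rw [core_vert, Finset.mem_singleton])]
    · have ha' : a ∉ core (𝒯.complexOfGroups.vert π) := by rwa [core_vert, Finset.mem_singleton]
      rw [proj_apply_of_notMem ha', Pi.mulSingle_eq_of_ne ha]

/-- A chain is at most as long as the largest set in it. -/
theorem card_le_card_top (C : 𝒯.complex) : C.1.card ≤ (top C).set.card := by
  have hinj : Set.InjOn (fun π : 𝒯.Vertex => π.set.card) (C.1 : Set 𝒯.Vertex) := by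
    have key : ∀ π π' : 𝒯.Vertex, π ≤ π' → π.set.card = π'.set.card → π = π' := fun π π' h e =>
      Vertex.eq_of_le_of_set_eq h (Finset.eq_of_subset_of_card_le h.1 e.ge)
    intro π hπ π' hπ' e
    rcases C.2.2.total hπ hπ' with h | h
    · exact key π π' h e
    · exact (key π' π h e.symm).symm
  have := Finset.card_le_card_of_injOn (t := Finset.Icc 1 (top C).set.card) _ (fun π hπ =>
    Finset.mem_coe.2 (Finset.mem_Icc.2 ⟨Finset.card_pos.2 ⟨_, π.base_mem⟩,
      Finset.card_le_card (le_top C hπ).1⟩)) hinj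
  simpa using this

end TypeSystem

end Families

/-! ### Continuity of maps to realizations -/

/-- A map to a realization is continuous at `t₀` if it meets finitely many simplices near `t₀` and,
for each of them, agrees near `t₀` with a fixed chart on the set mapped to the closed simplex. That
set is closed, so only the closed simplices containing the image of `t₀` matter. -/
theorem CellSystem.continuousAt_of_eventually_eq_chart {V : Type u}
    {Z : AbstractSimplicialComplex V} {S : CellSystem Z} {D : Type*} [TopologicalSpace D]
    {f : D → S.Realization} {p : D → RealPt Z} (hp : ∀ v, Continuous fun t => (p t).coord v)
    {b : S.B} (hb : ∀ t, S.base b ⊆ ((p t).supp.1 : Set V)) {t₀ : D} {Q : Set Z} (hQ : Q.Finite)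
    (hsupp : ∀ᶠ t in 𝓝 t₀, (p t).supp ∈ Q)
    (H : ∀ C ∈ Q, ∀ hC : S.base b ⊆ (C.1 : Set V), ∃ a : S.F b C hC, ∀ᶠ t in 𝓝 t₀,
      ∀ h : (p t).supp ≤ C, f t = S.chart b C hC a ⟨p t, h, hb t⟩) :
    ContinuousAt f t₀ := by
  refine tendsto_nhds.2 fun W hW hW₀ => ?_
  have key : ∀ C ∈ Q, ∀ᶠ t in 𝓝 t₀, (p t).supp ≤ C → f t ∈ W := by
    intro C hC
    have hclosed : IsClosed {t : D | (p t).supp ≤ C} := by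
      have : {t : D | (p t).supp ≤ C} = ⋂ v ∈ {v | v ∉ C.1}, {t | (p t).coord v = 0} := by
        ext t
        simp only [Set.mem_ofPred_eq, Set.mem_iInter]
        constructor
        · exact fun h v hv => (p t).coord_eq_zero v fun h' => hv (h h')
        · intro h v hv
          by_contra hn
          exact ((p t).coord_pos v hv).ne' (h v hn)
      rw [this]
      exact isClosed_biInter fun v _ => isClosed_eq (hp v) continuous_const
    by_cases h₀ : (p t₀).supp ≤ C
    · have hbC := (hb t₀).trans (Finset.coe_subset.2 h₀)
      obtain ⟨a, ha⟩ := H C hC hbC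
      have hWC := (isOpen_iff W).1 hW b C hbC a
      obtain ⟨O, hO, hOe⟩ := isOpen_induced_iff.1 hWC
      have hmem : ∀ t (h : (p t).supp ≤ C), (p t).coord ∈ O ↔
          S.chart b C hbC a ⟨p t, h, hb t⟩ ∈ W :=
        fun t h => Set.ext_iff.1 hOe (⟨p t, h, hb t⟩ : Cell Z C (S.base b))
      have h1 : (p t₀).coord ∈ O := by
        rw [hmem t₀ h₀, ← ha.self_of_nhds h₀]
        exact hW₀
      filter_upwards [ha, (hO.preimage (continuous_pi hp)).mem_nhds h1] with t ht ht' h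
      rw [ht h, ← hmem t h]
      exact ht'
    · filter_upwards [hclosed.isOpen_compl.mem_nhds h₀] with t ht h
      exact absurd h ht
  filter_upwards [hsupp, (Filter.eventually_all_finite hQ).2 key] with t ht ht'
  exact ht' _ ht le_rfl

/-! ### Framed covers -/

namespace TopGroupoid

variable (𝒰 : TopGroupoid.{u})

open Classical in
/-- The composition of arrows, with the value `r` if it is not defined. -/
noncomputable def mul (r m : 𝒰.M) : 𝒰.M := if h : 𝒰.tgt r = 𝒰.src m then 𝒰.comp r m h else r

variable {𝒰}

theorem mul_eq {r m : 𝒰.M} (h : 𝒰.tgt r = 𝒰.src m) : 𝒰.mul r m = 𝒰.comp r m h := dif_pos h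

theorem src_mul {r m : 𝒰.M} (h : 𝒰.tgt r = 𝒰.src m) : 𝒰.src (𝒰.mul r m) = 𝒰.src r := by
  rw [mul_eq h, 𝒰.src_comp]

theorem tgt_mul {r m : 𝒰.M} (h : 𝒰.tgt r = 𝒰.src m) : 𝒰.tgt (𝒰.mul r m) = 𝒰.tgt m := by
  rw [mul_eq h, 𝒰.tgt_comp]

theorem mul_assoc {r m n : 𝒰.M} (h : 𝒰.tgt r = 𝒰.src m) (h' : 𝒰.tgt m = 𝒰.src n) :
    𝒰.mul (𝒰.mul r m) n = 𝒰.mul r (𝒰.mul m n) := by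
  rw [mul_eq (r := 𝒰.mul r m) (by rwa [tgt_mul h]), mul_eq (m := 𝒰.mul m n) (by rwa [src_mul h'])]
  rw [𝒰.comp_congr (mul_eq h) rfl _ (by rw [𝒰.tgt_comp, h']),
    𝒰.comp_congr rfl (mul_eq h') _ (by rw [𝒰.src_comp, h])]
  exact 𝒰.assoc _ _ _ _ _ _ _

theorem one_mul {m : 𝒰.M} {y : 𝒰.O} (h : y = 𝒰.src m) : 𝒰.mul (𝒰.one y) m = m := by
  subst h
  rw [mul_eq (𝒰.tgt_one _), 𝒰.one_comp]

theorem mul_one {m : 𝒰.M} {y : 𝒰.O} (h : 𝒰.tgt m = y) : 𝒰.mul m (𝒰.one y) = m := by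
  subst h
  rw [mul_eq (𝒰.src_one _).symm, 𝒰.comp_one]

theorem inv_mul {m : 𝒰.M} : 𝒰.mul (𝒰.inv m) m = 𝒰.one (𝒰.tgt m) := by
  rw [mul_eq (𝒰.tgt_inv _), 𝒰.inv_comp]

theorem mul_inv {m : 𝒰.M} : 𝒰.mul m (𝒰.inv m) = 𝒰.one (𝒰.src m) := by
  rw [mul_eq (𝒰.src_inv _).symm, 𝒰.comp_inv]

theorem continuousWithinAt_mul {D : Type*} [TopologicalSpace D] {t₀ : D} {r m : D → 𝒰.M}
    (hr : ContinuousAt r t₀) (hm : ContinuousAt m t₀) (h₀ : 𝒰.tgt (r t₀) = 𝒰.src (m t₀)) :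
    ContinuousWithinAt (fun t => 𝒰.mul (r t) (m t)) {t | 𝒰.tgt (r t) = 𝒰.src (m t)} t₀ := by
  have hc : ContinuousAt (fun t : {t : D // 𝒰.tgt (r t) = 𝒰.src (m t)} =>
      𝒰.comp (r t) (m t) t.2) ⟨t₀, h₀⟩ := by
    have h1 : ContinuousAt (fun t : {t : D // 𝒰.tgt (r t) = 𝒰.src (m t)} =>
        (⟨(r t, m t), t.2⟩ : {p : 𝒰.M × 𝒰.M // 𝒰.tgt p.1 = 𝒰.src p.2})) ⟨t₀, h₀⟩ := by
      refine Topology.IsInducing.subtypeVal.continuousAt_iff.2 ?_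
      exact (hr.prodMk hm).comp (f := Subtype.val) (x := ⟨t₀, h₀⟩)
        continuous_subtype_val.continuousAt
    exact 𝒰.continuous_comp.continuousAt.comp h1
  refine (continuousWithinAt_iff_continuousAt_domRestrict _
    (show t₀ ∈ {t | 𝒰.tgt (r t) = 𝒰.src (m t)} from h₀)).2 ?_
  refine hc.congr (Filter.Eventually.of_forall fun t => ?_)
  exact (mul_eq t.2).symm

theorem continuousAt_mul {D : Type*} [TopologicalSpace D] {t₀ : D} {r m : D → 𝒰.M}
    (hr : ContinuousAt r t₀) (hm : ContinuousAt m t₀)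
    (h : ∀ᶠ t in 𝓝 t₀, 𝒰.tgt (r t) = 𝒰.src (m t)) :
    ContinuousAt (fun t => 𝒰.mul (r t) (m t)) t₀ :=
  (continuousWithinAt_mul hr hm h.self_of_nhds).continuousAt h

end TopGroupoid

/-- A locally finite cover of the objects of `𝒰` by invariant open sets, with a partition of unity
`φ`, groups `Γ a`, and the following data. A frame of `a` at `y` is an arrow from `y` to `Y a`.
Two frames of `a` differ by an element `lam a m m'` of `Γ a`. The relative position of frames `m` of
`a` and `m'` of `b` is the subset `rel a b m m'` of `Γ a × Γ b`. Nothing is required of `lam` and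
`rel` for arrows which are not frames at the same point. -/
structure FramedCover (𝒰 : TopGroupoid.{u}) where
  A : Type u
  Γ : A → Type u
  [group : ∀ a, Group (Γ a)]
  Y : A → Set 𝒰.O
  isOpen_Y : ∀ a, IsOpen (Y a)
  lam : ∀ a, 𝒰.M → 𝒰.M → Γ a
  lam_mul_lam : ∀ a m m' m'', 𝒰.src m = 𝒰.src m' → 𝒰.src m' = 𝒰.src m'' → 𝒰.tgt m ∈ Y a →
    𝒰.tgt m' ∈ Y a → 𝒰.tgt m'' ∈ Y a → lam a m m' * lam a m' m'' = lam a m m''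
  lam_mul_left : ∀ a r m m', 𝒰.tgt r = 𝒰.src m → 𝒰.tgt r = 𝒰.src m' → 𝒰.tgt m ∈ Y a →
    𝒰.tgt m' ∈ Y a → lam a (𝒰.mul r m) (𝒰.mul r m') = lam a m m'
  lam_eventually : ∀ a m₀ m₀', 𝒰.src m₀ = 𝒰.src m₀' → 𝒰.tgt m₀ ∈ Y a → 𝒰.tgt m₀' ∈ Y a →
    ∀ᶠ m in 𝓝 (m₀, m₀'), 𝒰.src m.1 = 𝒰.src m.2 → lam a m.1 m.2 = lam a m₀ m₀'
  eq_of_lam_eq_one : ∀ a m m', 𝒰.src m = 𝒰.src m' → 𝒰.tgt m ∈ Y a → 𝒰.tgt m' ∈ Y a →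
    lam a m m' = 1 → m = m'
  rel : ∀ a b, 𝒰.M → 𝒰.M → Set (Γ a × Γ b)
  rel_self : ∀ a m, rel a a m m = Set.univ
  rel_mul_left : ∀ a b r m m', 𝒰.tgt r = 𝒰.src m → 𝒰.tgt r = 𝒰.src m' → 𝒰.tgt m ∈ Y a →
    𝒰.tgt m' ∈ Y b → rel a b (𝒰.mul r m) (𝒰.mul r m') = rel a b m m'
  rel_eventually : ∀ a b m₀ m₀', 𝒰.src m₀ = 𝒰.src m₀' → 𝒰.tgt m₀ ∈ Y a → 𝒰.tgt m₀' ∈ Y b →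
    ∀ᶠ m in 𝓝 (m₀, m₀'), 𝒰.src m.1 = 𝒰.src m.2 → rel a b m.1 m.2 = rel a b m₀ m₀'
  mem_rel_iff : ∀ a b m n m' n', 𝒰.src m = 𝒰.src n → 𝒰.src m' = 𝒰.src m → 𝒰.src n' = 𝒰.src m →
    𝒰.tgt m ∈ Y a → 𝒰.tgt n ∈ Y b → 𝒰.tgt m' ∈ Y a → 𝒰.tgt n' ∈ Y b →
    ∀ w, w ∈ rel a b m' n' ↔ (w.1 * lam a m' m, w.2 * lam b n' n) ∈ rel a b m n
  rel_free : ∀ a b, a ≠ b → ∀ m m', 𝒰.src m = 𝒰.src m' → 𝒰.tgt m ∈ Y a → 𝒰.tgt m' ∈ Y b →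
    ∀ k, (∀ w : Γ a × Γ b, (w.1, w.2 * k) ∈ rel a b m m' ↔ w ∈ rel a b m m') → k = 1
  φ : A → 𝒰.O → ℝ
  continuous_φ : ∀ a, Continuous (φ a)
  φ_nonneg : ∀ a y, 0 ≤ φ a y
  φ_invariant : ∀ a r, φ a (𝒰.src r) = φ a (𝒰.tgt r)
  locallyFinite : LocallyFinite fun a => Function.support (φ a)
  sum_φ : ∀ y, ∑ᶠ a, φ a y = 1
  exists_frame : ∀ a y, y ∈ tsupport (φ a) → ∃ m, 𝒰.src m = y ∧ 𝒰.tgt m ∈ Y a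

attribute [instance] FramedCover.group

namespace FramedCover

open Family TypeSystem

variable {𝒰 : TopGroupoid.{u}} (𝓕 : FramedCover 𝒰)

/-- Frames at `y`, for all elements of `σ`. -/
def IsFrame (σ : Finset 𝓕.A) (y : 𝒰.O) (m : 𝓕.A → 𝒰.M) : Prop :=
  ∀ a ∈ σ, 𝒰.src (m a) = y ∧ 𝒰.tgt (m a) ∈ 𝓕.Y a

/-- The family of relative positions of frames. -/
def type (m : 𝓕.A → 𝒰.M) : Family 𝓕.Γ := ⟨fun a b => 𝓕.rel a b (m a) (m b)⟩

/-- The differences of frames. -/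
def diff (m m' : 𝓕.A → 𝒰.M) : ∀ a, 𝓕.Γ a := fun a => 𝓕.lam a (m a) (m' a)

variable {𝓕}

theorem IsFrame.mono {σ τ : Finset 𝓕.A} {y : 𝒰.O} {m : 𝓕.A → 𝒰.M} (h : 𝓕.IsFrame τ y m)
    (hσ : σ ⊆ τ) : 𝓕.IsFrame σ y m := fun a ha => h a (hσ ha)

theorem IsFrame.mul {σ : Finset 𝓕.A} {r : 𝒰.M} {m : 𝓕.A → 𝒰.M}
    (h : 𝓕.IsFrame σ (𝒰.tgt r) m) : 𝓕.IsFrame σ (𝒰.src r) fun a => 𝒰.mul r (m a) := fun a ha =>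
  ⟨TopGroupoid.src_mul (h a ha).1.symm, by
    rw [TopGroupoid.tgt_mul (h a ha).1.symm]; exact (h a ha).2⟩

theorem proj_diff_mul {σ : Finset 𝓕.A} {y : 𝒰.O} {m m' m'' : 𝓕.A → 𝒰.M} (h : 𝓕.IsFrame σ y m)
    (h' : 𝓕.IsFrame σ y m') (h'' : 𝓕.IsFrame σ y m'') :
    proj 𝓕.Γ σ (𝓕.diff m m') * proj 𝓕.Γ σ (𝓕.diff m' m'') = proj 𝓕.Γ σ (𝓕.diff m m'') := by
  rw [← map_mul]
  ext a
  by_cases ha : a ∈ σ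
  · rw [proj_apply_of_mem ha, proj_apply_of_mem ha]
    exact 𝓕.lam_mul_lam a _ _ _ ((h a ha).1.trans (h' a ha).1.symm)
      ((h' a ha).1.trans (h'' a ha).1.symm) (h a ha).2 (h' a ha).2 (h'' a ha).2
  · rw [proj_apply_of_notMem ha, proj_apply_of_notMem ha]

theorem proj_diff_mul_left {σ : Finset 𝓕.A} {r : 𝒰.M} {m m' : 𝓕.A → 𝒰.M}
    (h : 𝓕.IsFrame σ (𝒰.tgt r) m) (h' : 𝓕.IsFrame σ (𝒰.tgt r) m') :
    proj 𝓕.Γ σ (𝓕.diff (fun a => 𝒰.mul r (m a)) fun a => 𝒰.mul r (m' a)) =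
      proj 𝓕.Γ σ (𝓕.diff m m') := by
  ext a
  by_cases ha : a ∈ σ
  · rw [proj_apply_of_mem ha, proj_apply_of_mem ha]
    exact 𝓕.lam_mul_left a _ _ _ (h a ha).1.symm (h' a ha).1.symm (h a ha).2 (h' a ha).2
  · rw [proj_apply_of_notMem ha, proj_apply_of_notMem ha]

/-- Changing frames acts on the family of relative positions. -/
theorem restrict_type {σ : Finset 𝓕.A} {y : 𝒰.O} {m m' : 𝓕.A → 𝒰.M} (h : 𝓕.IsFrame σ y m)
    (h' : 𝓕.IsFrame σ y m') :
    restrict σ (𝓕.type m') = 𝓕.diff m' m • restrict σ (𝓕.type m) := by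
  ext a b w
  simp only [mem_smul, mem_restrict]
  refine and_congr_right fun ha => and_congr_right fun hb => ?_
  exact 𝓕.mem_rel_iff a b _ _ _ _ ((h a ha).1.trans (h b hb).1.symm)
    ((h' a ha).1.trans (h a ha).1.symm) ((h' b hb).1.trans (h a ha).1.symm)
    (h a ha).2 (h b hb).2 (h' a ha).2 (h' b hb).2 w

theorem restrict_type_mul {σ : Finset 𝓕.A} {r : 𝒰.M} {m : 𝓕.A → 𝒰.M}
    (h : 𝓕.IsFrame σ (𝒰.tgt r) m) :
    restrict σ (𝓕.type fun a => 𝒰.mul r (m a)) = restrict σ (𝓕.type m) := by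
  ext a b w
  simp only [mem_restrict]
  refine and_congr_right fun ha => and_congr_right fun hb => ?_
  change w ∈ 𝓕.rel a b _ _ ↔ w ∈ 𝓕.rel a b _ _
  rw [𝓕.rel_mul_left a b _ _ _ (h a ha).1.symm (h b hb).1.symm (h a ha).2 (h b hb).2]

variable (𝓕)

/-- The families of relative positions of frames at the points of `𝒰`. -/
def typeSystem : TypeSystem 𝓕.Γ where
  Realized τ s := τ.Nonempty ∧ ∃ y m, 𝓕.IsFrame τ y m ∧ s = restrict τ (𝓕.type m)
  nonempty h := h.1
  restrict_eq := by
    rintro τ s ⟨-, y, m, -, rfl⟩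
    exact restrict_restrict subset_rfl _
  rel_self := by
    rintro τ s ⟨-, y, m, -, rfl⟩ a ha
    ext w
    simp [mem_restrict, ha, type, 𝓕.rel_self]
  free := by
    rintro τ s ⟨-, y, m, hm, rfl⟩ a ha b hb k hk h1
    by_cases hab : a = b
    · rwa [← hab]
    refine 𝓕.rel_free a b hab (m a) (m b) ((hm a ha).1.trans (hm b hb).1.symm) (hm a ha).2
      (hm b hb).2 _ fun w => ?_
    have := Set.ext_iff.1 hk w
    simp only [mem_smul, mem_restrict, ha, hb, true_and, h1, _root_.mul_one] at this
    exact this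

/-- The vertices whose type is the one given by the frames `m`, for a subset of `σ`. -/
def vertices (σ : Finset 𝓕.A) (m : 𝓕.A → 𝒰.M) : Set 𝓕.typeSystem.Vertex :=
  {π | π.set ⊆ σ ∧ (Quotient.mk'' (restrict π.set (𝓕.type m)) :
    MulAction.orbitRel.Quotient (∀ a, 𝓕.Γ a) _) = π.type}

variable {𝓕}

theorem finite_vertices (σ : Finset 𝓕.A) (m : 𝓕.A → 𝒰.M) : (𝓕.vertices σ m).Finite := by
  refine Set.Finite.of_finite_image (f := fun π => π.set)
    (σ.powerset.finite_toSet.subset ?_) ?_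
  · rintro _ ⟨π, hπ, rfl⟩
    exact Finset.mem_coe.2 (Finset.mem_powerset.2 hπ.1)
  · intro π hπ π' hπ' e
    refine Subtype.ext (Prod.ext e ?_)
    change π.type = π'.type
    change π.set = π'.set at e
    rw [← hπ.2, ← hπ'.2, e]

theorem exists_eq_smul_rep {σ : Finset 𝓕.A} {m : 𝓕.A → 𝒰.M} {π : 𝓕.typeSystem.Vertex}
    (h : π ∈ 𝓕.vertices σ m) : ∃ g : ∀ a, 𝓕.Γ a, restrict π.set (𝓕.type m) = g • π.rep :=
  (Vertex.mk_eq_type_iff π _).1 h.2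

theorem le_of_mem_vertices {σ : Finset 𝓕.A} {m : 𝓕.A → 𝒰.M} {π π' : 𝓕.typeSystem.Vertex}
    (h : π ∈ 𝓕.vertices σ m) (h' : π' ∈ 𝓕.vertices σ m) (hs : π.set ⊆ π'.set) : π ≤ π' := by
  obtain ⟨g, hg⟩ := exists_eq_smul_rep h
  obtain ⟨g', hg'⟩ := exists_eq_smul_rep h'
  refine ⟨hs, g'⁻¹ * g, ?_⟩
  rw [mul_smul, ← hg, ← restrict_restrict hs (𝓕.type m), hg', restrict_smul, inv_smul_smul]

theorem mem_vertices_congr {σ : Finset 𝓕.A} {y : 𝒰.O} {m m' : 𝓕.A → 𝒰.M} (h : 𝓕.IsFrame σ y m)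
    (h' : 𝓕.IsFrame σ y m') {π : 𝓕.typeSystem.Vertex} (hπ : π ∈ 𝓕.vertices σ m) :
    π ∈ 𝓕.vertices σ m' := by
  obtain ⟨g, hg⟩ := exists_eq_smul_rep hπ
  refine ⟨hπ.1, (Vertex.mk_eq_type_iff π _).2 ⟨𝓕.diff m' m * g, ?_⟩⟩
  rw [restrict_type (h.mono hπ.1) (h'.mono hπ.1), hg, mul_smul]

/-! ### Framings and labels -/

variable (𝓕)

/-- Frames `m` at `y` with an isomorphism `g` between the family of the simplex `C` and the family
of relative positions of `m`. -/
structure IsFraming (C : 𝓕.typeSystem.complex) (y : 𝒰.O) (m : 𝓕.A → 𝒰.M)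
    (g : ∀ a, 𝓕.Γ a) : Prop where
  isFrame : 𝓕.IsFrame (core C) y m
  restrict_type : restrict (core C) (𝓕.type m) = g • family C

/-- The complex of groups of a framed cover. -/
noncomputable abbrev 𝒵 : ComplexOfGroups 𝓕.typeSystem.Vertex := 𝓕.typeSystem.complexOfGroups

variable {𝓕}

theorem exists_isFraming {σ : Finset 𝓕.A} {m : 𝓕.A → 𝒰.M} {C : 𝓕.typeSystem.complex}
    (hC : ∀ π ∈ C.1, π ∈ 𝓕.vertices σ m) :
    ∃ g, ∀ y m', 𝓕.IsFrame σ y m' →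
      restrict σ (𝓕.type m') = restrict σ (𝓕.type m) → 𝓕.IsFraming C y m' g := by
  obtain ⟨g, hg⟩ := exists_eq_smul_rep (hC _ (top_mem C))
  have hσ := (hC _ (top_mem C)).1
  refine ⟨g, fun y m' hm' e => ⟨hm'.mono ((core_subset_top C).trans hσ), ?_⟩⟩
  rw [← restrict_restrict ((core_subset_top C).trans hσ), e,
    restrict_restrict ((core_subset_top C).trans hσ),
    ← restrict_restrict (core_subset_top C), hg]
  rfl

/-- The label of frames `e` at a vertex relative to the framing `(m, g)` of a simplex `C`: the
frames `m` are compared with `e` by `diff e m`, with the family of `C` by `g`, and the latter with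
the family of the vertex by the transport. -/
noncomputable def label {v : 𝓕.typeSystem.Vertex} {C : 𝓕.𝒵.Z} (h : 𝓕.𝒵.vert v ≤ C)
    (m : 𝓕.A → 𝒰.M) (g : ∀ a, 𝓕.Γ a) (e : 𝓕.A → 𝒰.M) : 𝓕.𝒵.vertexGroup v :=
  ⟨proj 𝓕.Γ (core (𝓕.𝒵.vert v)) (𝓕.diff e m * g) * transport h, mem_stabilizer_vert.2 (by
    rw [map_mul, proj_proj subset_rfl, proj_transport])⟩

/-- Two framings differ by an element of the group of the simplex, so labels are well-defined
cosets. -/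
theorem IsFraming.exists_label_eq {C : 𝓕.𝒵.Z} {y : 𝒰.O} {m m' : 𝓕.A → 𝒰.M} {g g' : ∀ a, 𝓕.Γ a}
    (h : 𝓕.IsFraming C y m g) (h' : 𝓕.IsFraming C y m' g') :
    ∃ x : 𝓕.𝒵.G C, ∀ (v : 𝓕.typeSystem.Vertex) (hv : 𝓕.𝒵.vert v ≤ C) (e : 𝓕.A → 𝒰.M),
      𝓕.IsFrame (core (𝓕.𝒵.vert v)) y e → label hv m' g' e = label hv m g e * 𝓕.𝒵.res hv x := by
  refine ⟨⟨proj 𝓕.Γ (core C) (g⁻¹ * 𝓕.diff m m' * g'), proj_proj subset_rfl _, ?_⟩,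
    fun v hv e he => ?_⟩
  · rw [← restrict_family, proj_smul_restrict, restrict_family, mul_smul, mul_smul,
      ← h'.restrict_type, ← FramedCover.restrict_type h'.isFrame h.isFrame, h.restrict_type,
      inv_smul_smul]
  · refine Subtype.ext ?_
    change _ * _ = _ * _ * (_ * proj 𝓕.Γ _ (proj 𝓕.Γ _ _) * _)
    rw [proj_proj (core_mono hv)]
    simp only [map_mul, map_inv]
    rw [← proj_diff_mul he (h.isFrame.mono (core_mono hv)) (h'.isFrame.mono (core_mono hv))]
    group

theorem IsFraming.restrict {C D : 𝓕.𝒵.Z} {y : 𝒰.O} {m : 𝓕.A → 𝒰.M} {g : ∀ a, 𝓕.Γ a}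
    (h : 𝓕.IsFraming D y m g) (hCD : C ≤ D) :
    𝓕.IsFraming C y m (proj 𝓕.Γ (core C) g * transport hCD) := by
  refine ⟨h.isFrame.mono (core_mono hCD), ?_⟩
  rw [mul_smul, ← restrict_family_eq hCD, proj_smul_family, ← h.restrict_type,
    restrict_restrict (core_mono hCD)]

theorem label_restrict {v : 𝓕.typeSystem.Vertex} {C D : 𝓕.𝒵.Z} (hv : 𝓕.𝒵.vert v ≤ C)
    (hCD : C ≤ D) (m : 𝓕.A → 𝒰.M) (g : ∀ a, 𝓕.Γ a) (e : 𝓕.A → 𝒰.M) :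
    label hv m (proj 𝓕.Γ (core C) g * transport hCD) e =
      label (hv.trans hCD) m g e * 𝓕.𝒵.tw hv hCD := by
  refine Subtype.ext ?_
  change _ * _ = _ * _ * (_ * _ * _)
  simp only [map_mul, proj_proj (core_mono hv)]
  group

theorem IsFraming.mul {C : 𝓕.𝒵.Z} {r : 𝒰.M} {m : 𝓕.A → 𝒰.M} {g : ∀ a, 𝓕.Γ a}
    (h : 𝓕.IsFraming C (𝒰.tgt r) m g) :
    𝓕.IsFraming C (𝒰.src r) (fun a => 𝒰.mul r (m a)) g :=
  ⟨h.isFrame.mul, by rw [restrict_type_mul h.isFrame, h.restrict_type]⟩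

theorem label_mul {v : 𝓕.typeSystem.Vertex} {C : 𝓕.𝒵.Z} (hv : 𝓕.𝒵.vert v ≤ C) {r : 𝒰.M}
    {m : 𝓕.A → 𝒰.M} (g : ∀ a, 𝓕.Γ a) {e : 𝓕.A → 𝒰.M} (hm : 𝓕.IsFrame (core C) (𝒰.tgt r) m)
    (he : 𝓕.IsFrame (core (𝓕.𝒵.vert v)) (𝒰.tgt r) e) :
    label hv (fun a => 𝒰.mul r (m a)) g (fun a => 𝒰.mul r (e a)) = label hv m g e := by
  refine Subtype.ext ?_
  change _ * _ = _ * _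
  rw [map_mul, map_mul, proj_diff_mul_left he (hm.mono (core_mono hv))]

end FramedCover

/-- The point of the realization of `Z` with barycentric coordinates proportional to `f`. -/
noncomputable def RealPt.ofWeights {V : Type u} {Z : AbstractSimplicialComplex V} (f : V → ℝ)
    (hf : ∀ v, 0 ≤ f v) (hfin : (Function.support f).Finite) (hZ : hfin.toFinset ∈ Z) :
    RealPt Z where
  supp := ⟨hfin.toFinset, hZ⟩
  coord v := f v / ∑ᶠ w, f w
  coord_pos v hv := by
    have hv' : v ∈ hfin.toFinset := hv
    rw [Set.Finite.mem_toFinset, Function.mem_support] at hv'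
    have hpos : 0 < f v := (hf v).lt_of_ne' hv'
    refine div_pos hpos (hpos.trans_le ?_)
    rw [finsum_eq_sum_of_support_subset f (s := hfin.toFinset) (by simp)]
    exact Finset.single_le_sum (fun w _ => hf w) (by simpa using hv')
  coord_eq_zero v hv := by
    have hv' : v ∉ hfin.toFinset := hv
    rw [Set.Finite.mem_toFinset, Function.notMem_support] at hv'
    rw [hv', zero_div]
  sum_coord := by
    rw [← Finset.sum_div, finsum_eq_sum_of_support_subset f (s := hfin.toFinset) (by simp)]
    refine div_self (Finset.sum_pos (fun v hv => (hf v).lt_of_ne' (by simpa using hv)) ?_).ne'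
    exact Z.isRelLowerSet_faces hZ |>.1

theorem RealPt.ofWeights_congr {V : Type u} {Z : AbstractSimplicialComplex V} {f f' : V → ℝ}
    (e : f = f') (hf : ∀ v, 0 ≤ f v) (hfin : (Function.support f).Finite)
    (hZ : hfin.toFinset ∈ Z) (hf' : ∀ v, 0 ≤ f' v) (hfin' : (Function.support f').Finite)
    (hZ' : hfin'.toFinset ∈ Z) :
    RealPt.ofWeights f hf hfin hZ = RealPt.ofWeights f' hf' hfin' hZ' := by
  subst e; rfl

namespace FramedCover

open Family TypeSystem

variable {𝒰 : TopGroupoid.{u}} (𝓕 : FramedCover 𝒰)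

/-! ### Barycentric coordinates -/

/-- The weight of a finite subset of `A`. If it is positive at `y`, then `φ b y < φ a y` for all
`a ∈ τ` and `b ∉ τ`, since `φ b y ≤ 1 - ∑ c ∈ τ, φ c y`. So the subsets of positive weight at `y`
form a chain. The support of `φ · y` has positive weight. -/
noncomputable def weight (τ : Finset 𝓕.A) (y : 𝒰.O) : ℝ :=
  ∏ a ∈ τ, max 0 (𝓕.φ a y + ∑ b ∈ τ, 𝓕.φ b y - 1)

theorem continuous_weight (τ : Finset 𝓕.A) : Continuous (𝓕.weight τ) := by
  have := 𝓕.continuous_φ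
  unfold weight
  fun_prop

theorem weight_nonneg (τ : Finset 𝓕.A) (y : 𝒰.O) : 0 ≤ 𝓕.weight τ y :=
  Finset.prod_nonneg fun _ _ => le_max_left _ _

variable {𝓕}

theorem support_finite (y : 𝒰.O) : (Function.support fun a => 𝓕.φ a y).Finite :=
  𝓕.locallyFinite.point_finite y

theorem sum_add_sum_le_one (y : 𝒰.O) {σ τ : Finset 𝓕.A} (h : Disjoint σ τ) :
    ∑ a ∈ σ, 𝓕.φ a y + ∑ a ∈ τ, 𝓕.φ a y ≤ 1 := by
  classical
  rw [← 𝓕.sum_φ y, ← Finset.sum_union h,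
    finsum_eq_sum_of_support_subset (fun a => 𝓕.φ a y) (s := (σ ∪ τ) ∪ (support_finite y).toFinset)
      (by intro a ha; simp only [Finset.coe_union, Set.Finite.coe_toFinset]; exact Or.inr ha)]
  exact Finset.sum_le_sum_of_subset_of_nonneg Finset.subset_union_left
    fun a _ _ => 𝓕.φ_nonneg a y

theorem weight_ne_zero_iff {τ : Finset 𝓕.A} {y : 𝒰.O} :
    𝓕.weight τ y ≠ 0 ↔ ∀ a ∈ τ, 1 < 𝓕.φ a y + ∑ b ∈ τ, 𝓕.φ b y := by
  rw [weight, Finset.prod_ne_zero_iff]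
  refine forall₂_congr fun a _ => ?_
  constructor
  · intro h
    by_contra hn
    exact h (max_eq_left (by linarith))
  · intro h
    rw [max_eq_right (by linarith)]
    linarith

theorem φ_ne_zero_of_weight_ne_zero {τ : Finset 𝓕.A} {y : 𝒰.O} (h : 𝓕.weight τ y ≠ 0) {a : 𝓕.A}
    (ha : a ∈ τ) : 𝓕.φ a y ≠ 0 := by
  have h1 := weight_ne_zero_iff.1 h a ha
  have h2 := sum_add_sum_le_one (𝓕 := 𝓕) y (Finset.disjoint_empty_right τ)
  rw [Finset.sum_empty, add_zero] at h2
  linarith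

theorem subset_or_subset_of_weight_ne_zero {τ τ' : Finset 𝓕.A} {y : 𝒰.O}
    (h : 𝓕.weight τ y ≠ 0) (h' : 𝓕.weight τ' y ≠ 0) : τ ⊆ τ' ∨ τ' ⊆ τ := by
  by_contra hn
  push Not at hn
  obtain ⟨a, ha, ha'⟩ := Finset.not_subset.1 hn.1
  obtain ⟨b, hb, hb'⟩ := Finset.not_subset.1 hn.2
  have h1 := weight_ne_zero_iff.1 h a ha
  have h2 := weight_ne_zero_iff.1 h' b hb
  have h3 := sum_add_sum_le_one (𝓕 := 𝓕) y (Finset.disjoint_singleton_right.2 hb')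
  have h4 := sum_add_sum_le_one (𝓕 := 𝓕) y (Finset.disjoint_singleton_right.2 ha')
  rw [Finset.sum_singleton] at h3 h4
  linarith

theorem weight_support_ne_zero (y : 𝒰.O) : 𝓕.weight (support_finite y).toFinset y ≠ 0 := by
  rw [weight_ne_zero_iff]
  intro a ha
  have : ∑ b ∈ (support_finite y).toFinset, 𝓕.φ b y = 1 := by
    rw [← 𝓕.sum_φ y, finsum_eq_sum_of_support_subset _ (s := (support_finite y).toFinset) (by simp)]
  rw [this]
  have h := (𝓕.φ_nonneg a y).lt_of_ne' (by simpa using ha)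
  linarith

theorem weight_invariant (τ : Finset 𝓕.A) (r : 𝒰.M) :
    𝓕.weight τ (𝒰.src r) = 𝓕.weight τ (𝒰.tgt r) := by
  simp only [weight, 𝓕.φ_invariant]

theorem nearSet_finite (y : 𝒰.O) : {a | y ∈ tsupport (𝓕.φ a)}.Finite :=
  𝓕.locallyFinite.closure.point_finite y

variable (𝓕)

/-- The elements `a` such that `y` is in the closed support of `φ a`. -/
noncomputable def nearSet (y : 𝒰.O) : Finset 𝓕.A := (𝓕.nearSet_finite y).toFinset

open Classical in
/-- A choice of frames at `y`; the value is irrelevant for `a ∉ nearSet y`. -/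
noncomputable def frameAt (y : 𝒰.O) (a : 𝓕.A) : 𝒰.M :=
  if h : y ∈ tsupport (𝓕.φ a) then (𝓕.exists_frame a y h).choose else 𝒰.one y

variable {𝓕}

theorem isFrame_frameAt (y : 𝒰.O) : 𝓕.IsFrame (𝓕.nearSet y) y (𝓕.frameAt y) := by
  intro a ha
  have ha' : y ∈ tsupport (𝓕.φ a) := by simpa [nearSet] using ha
  rw [frameAt, dif_pos ha']
  exact (𝓕.exists_frame a y ha').choose_spec

theorem mem_nearSet {y : 𝒰.O} {a : 𝓕.A} (h : 𝓕.φ a y ≠ 0) : a ∈ 𝓕.nearSet y := by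
  rw [nearSet, Set.Finite.mem_toFinset]
  exact subset_closure (s := Function.support (𝓕.φ a)) h

theorem eventually_mem_nearSet (y : 𝒰.O) :
    ∀ᶠ y' in 𝓝 y, ∀ a, 𝓕.φ a y' ≠ 0 → a ∈ 𝓕.nearSet y := by
  filter_upwards [𝓕.locallyFinite.closure.eventually_subset (fun _ => isClosed_closure) y]
    with y' h a ha
  rw [nearSet, Set.Finite.mem_toFinset]
  exact h (subset_closure (s := Function.support (𝓕.φ a)) ha)

variable (𝓕)

open Classical in
/-- The coordinate of `y` at a vertex, up to normalization: the weight of the underlying subset if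
the vertex has the isomorphism class of the relative positions at `y`. -/
noncomputable def weightAt (π : 𝓕.typeSystem.Vertex) (y : 𝒰.O) : ℝ :=
  if π ∈ 𝓕.vertices (𝓕.nearSet y) (𝓕.frameAt y) then 𝓕.weight π.set y else 0

variable {𝓕}

open Classical in
theorem weightAt_eq {σ : Finset 𝓕.A} {y : 𝒰.O} {m : 𝓕.A → 𝒰.M} (hm : 𝓕.IsFrame σ y m)
    (hσ : ∀ a, 𝓕.φ a y ≠ 0 → a ∈ σ) (π : 𝓕.typeSystem.Vertex) :
    𝓕.weightAt π y = if π ∈ 𝓕.vertices σ m then 𝓕.weight π.set y else 0 := by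
  by_cases hw : 𝓕.weight π.set y = 0
  · simp [weightAt, hw]
  have h1 : π.set ⊆ σ := fun a ha => hσ a (φ_ne_zero_of_weight_ne_zero hw ha)
  have h2 : π.set ⊆ 𝓕.nearSet y := fun a ha => mem_nearSet (φ_ne_zero_of_weight_ne_zero hw ha)
  have key : π ∈ 𝓕.vertices (𝓕.nearSet y) (𝓕.frameAt y) ↔ π ∈ 𝓕.vertices σ m := by
    have hm' := (isFrame_frameAt (𝓕 := 𝓕) y).mono h2
    constructor
    · intro h
      exact ⟨h1, (mem_vertices_congr hm' (hm.mono h1)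
        (⟨subset_rfl, h.2⟩ : π ∈ 𝓕.vertices π.set _)).2⟩
    · intro h
      exact ⟨h2, (mem_vertices_congr (hm.mono h1) hm'
        (⟨subset_rfl, h.2⟩ : π ∈ 𝓕.vertices π.set _)).2⟩
  unfold weightAt
  simp only [key]

theorem weightAt_nonneg (π : 𝓕.typeSystem.Vertex) (y : 𝒰.O) : 0 ≤ 𝓕.weightAt π y := by
  unfold weightAt
  split_ifs
  · exact 𝓕.weight_nonneg _ _
  · exact le_rfl

theorem mem_vertices_of_weightAt_ne_zero {σ : Finset 𝓕.A} {y : 𝒰.O} {m : 𝓕.A → 𝒰.M}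
    (hm : 𝓕.IsFrame σ y m) (hσ : ∀ a, 𝓕.φ a y ≠ 0 → a ∈ σ) {π : 𝓕.typeSystem.Vertex}
    (h : 𝓕.weightAt π y ≠ 0) : π ∈ 𝓕.vertices σ m ∧ 𝓕.weight π.set y ≠ 0 := by
  rw [weightAt_eq hm hσ] at h
  by_cases h' : π ∈ 𝓕.vertices σ m
  · exact ⟨h', by rwa [if_pos h'] at h⟩
  · exact absurd (if_neg h') h

theorem weightAt_support_subset (y : 𝒰.O) : (Function.support fun π => 𝓕.weightAt π y) ⊆
    𝓕.vertices (𝓕.nearSet y) (𝓕.frameAt y) := fun _ h =>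
  (mem_vertices_of_weightAt_ne_zero (isFrame_frameAt y) (fun _ => mem_nearSet) h).1

theorem weightAt_support_finite (y : 𝒰.O) : (Function.support fun π => 𝓕.weightAt π y).Finite :=
  (finite_vertices _ _).subset (weightAt_support_subset y)

theorem exists_weightAt_ne_zero (y : 𝒰.O) : ∃ π, 𝓕.weightAt π y ≠ 0 := by
  let τ : Finset 𝓕.A := (support_finite y).toFinset
  have hτ : τ ⊆ 𝓕.nearSet y := fun a ha => mem_nearSet (by simpa [τ] using ha)
  have hw : 𝓕.weight τ y ≠ 0 := weight_support_ne_zero y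
  have hne : τ.Nonempty := by
    rw [Finset.nonempty_iff_ne_empty]
    intro h
    have h1 := 𝓕.sum_φ y
    rw [finsum_eq_sum_of_support_subset (fun a => 𝓕.φ a y) (s := τ) (by simp [τ]), h] at h1
    simp at h1
  let π : 𝓕.typeSystem.Vertex := ⟨(τ, Quotient.mk'' (restrict τ (𝓕.type (𝓕.frameAt y)))),
    _, ⟨hne, y, 𝓕.frameAt y, (isFrame_frameAt y).mono hτ, rfl⟩, rfl⟩
  have hπ : π ∈ 𝓕.vertices (𝓕.nearSet y) (𝓕.frameAt y) := ⟨hτ, rfl⟩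
  refine ⟨π, ?_⟩
  rw [weightAt, if_pos hπ]
  exact hw

theorem weightAt_support_mem (y : 𝒰.O) :
    (weightAt_support_finite (𝓕 := 𝓕) y).toFinset ∈ 𝓕.typeSystem.complex := by
  obtain ⟨π, hπ⟩ := exists_weightAt_ne_zero (𝓕 := 𝓕) y
  refine ⟨⟨π, by simpa using hπ⟩, fun π₁ h₁ π₂ h₂ _ => ?_⟩
  have h₁' : 𝓕.weightAt π₁ y ≠ 0 := by simpa using h₁
  have h₂' : 𝓕.weightAt π₂ y ≠ 0 := by simpa using h₂
  obtain ⟨hv₁, hw₁⟩ :=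
    mem_vertices_of_weightAt_ne_zero (isFrame_frameAt y) (fun _ => mem_nearSet) h₁'
  obtain ⟨hv₂, hw₂⟩ :=
    mem_vertices_of_weightAt_ne_zero (isFrame_frameAt y) (fun _ => mem_nearSet) h₂'
  rcases subset_or_subset_of_weight_ne_zero hw₁ hw₂ with h | h
  · exact Or.inl (le_of_mem_vertices hv₁ hv₂ h)
  · exact Or.inr (le_of_mem_vertices hv₂ hv₁ h)

variable (𝓕)

/-- The point of the realization of the barycentric complex given by the coordinates `weightAt`. -/
noncomputable def pt (y : 𝒰.O) : RealPt 𝓕.𝒵.Z :=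
  RealPt.ofWeights (Z := 𝓕.typeSystem.complex) (fun π => 𝓕.weightAt π y)
    (fun π => weightAt_nonneg π y) (weightAt_support_finite y) (weightAt_support_mem y)

variable {𝓕}

theorem mem_supp_pt {y : 𝒰.O} {π : 𝓕.typeSystem.Vertex} :
    π ∈ (𝓕.pt y).supp.1 ↔ 𝓕.weightAt π y ≠ 0 := by
  change π ∈ (weightAt_support_finite y).toFinset ↔ _
  rw [Set.Finite.mem_toFinset, Function.mem_support]

theorem vertices_congr {σ : Finset 𝓕.A} {m m' : 𝓕.A → 𝒰.M}
    (h : restrict σ (𝓕.type m) = restrict σ (𝓕.type m')) :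
    𝓕.vertices σ m = 𝓕.vertices σ m' := by
  ext π
  refine and_congr_right fun hπ => ?_
  rw [← restrict_restrict hπ (𝓕.type m), h, restrict_restrict hπ]

theorem weightAt_invariant (π : 𝓕.typeSystem.Vertex) (r : 𝒰.M) :
    𝓕.weightAt π (𝒰.src r) = 𝓕.weightAt π (𝒰.tgt r) := by
  have hm := isFrame_frameAt (𝓕 := 𝓕) (𝒰.tgt r)
  rw [weightAt_eq hm (fun _ => mem_nearSet), weightAt_eq hm.mul (fun a ha => mem_nearSet (by
    rwa [𝓕.φ_invariant] at ha)), weight_invariant, vertices_congr (restrict_type_mul hm)]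

theorem pt_invariant (r : 𝒰.M) : 𝓕.pt (𝒰.src r) = 𝓕.pt (𝒰.tgt r) :=
  RealPt.ofWeights_congr (funext fun π => weightAt_invariant π r) _ _ _ _ _ _

/-! ### Local sections -/

/-- Frames extend to continuous families of frames. -/
theorem exists_local_frames (hsrc : IsLocalHomeomorph 𝒰.src) {σ : Finset 𝓕.A} {y₀ : 𝒰.O}
    {m : 𝓕.A → 𝒰.M} (hm : 𝓕.IsFrame σ y₀ m) :
    ∃ (N : Set 𝒰.O) (e : 𝓕.A → 𝒰.O → 𝒰.M), IsOpen N ∧ y₀ ∈ N ∧ (∀ a ∈ σ, e a y₀ = m a) ∧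
      (∀ a ∈ σ, ContinuousOn (e a) N) ∧ ∀ y ∈ N, 𝓕.IsFrame σ y fun a => e a y := by
  have key : ∀ a : 𝓕.A, ∃ (N : Set 𝒰.O) (e : 𝒰.O → 𝒰.M), IsOpen N ∧ y₀ ∈ N ∧ (a ∈ σ →
      e y₀ = m a ∧ ContinuousOn e N ∧ ∀ y ∈ N, 𝒰.src (e y) = y ∧ 𝒰.tgt (e y) ∈ 𝓕.Y a) := by
    intro a
    by_cases ha : a ∈ σ
    · obtain ⟨f, hf, hfe⟩ := hsrc (m a)
      have h0 : f (m a) = y₀ := by rw [← hfe]; exact (hm a ha).1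
      have h1 : f.symm y₀ = m a := by rw [← h0]; exact f.left_inv hf
      have hN := f.symm.isOpen_inter_preimage ((𝓕.isOpen_Y a).preimage 𝒰.continuous_tgt)
      refine ⟨_, f.symm, hN, ⟨?_, ?_⟩, fun _ => ⟨h1, ?_, ?_⟩⟩
      · change y₀ ∈ f.target
        rw [← h0]
        exact f.map_source hf
      · change 𝒰.tgt (f.symm y₀) ∈ 𝓕.Y a
        exact (congrArg (fun m => 𝒰.tgt m ∈ 𝓕.Y a) h1).mpr (hm a ha).2
      · exact f.symm.continuousOn.mono Set.inter_subset_left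
      · intro y hy
        exact ⟨by rw [hfe]; exact f.right_inv hy.1, hy.2⟩
    · exact ⟨Set.univ, fun _ => m a, isOpen_univ, trivial, fun h => absurd h ha⟩
  choose N e hN hy he using key
  refine ⟨⋂ a ∈ σ, N a, e, isOpen_biInter_finset fun a _ => hN a, by simp [hy],
    fun a ha => (he a ha).1, fun a ha => ?_, fun y hy a ha => ?_⟩
  · exact (he a ha).2.1.mono (Set.biInter_subset_of_mem ha)
  · exact (he a ha).2.2 y (Set.mem_iInter₂.1 hy a ha)

theorem eventually_restrict_type_eq {σ : Finset 𝓕.A} {y₀ : 𝒰.O} {N : Set 𝒰.O}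
    {e : 𝓕.A → 𝒰.O → 𝒰.M} (hN : N ∈ 𝓝 y₀) (he : ∀ a ∈ σ, ContinuousAt (e a) y₀)
    (hf : ∀ y ∈ N, 𝓕.IsFrame σ y fun a => e a y) :
    ∀ᶠ y in 𝓝 y₀, restrict σ (𝓕.type fun a => e a y) = restrict σ (𝓕.type fun a => e a y₀) := by
  have h₀ := hf y₀ (mem_of_mem_nhds hN)
  have h1 : ∀ a ∈ σ, ∀ b ∈ σ, ∀ᶠ y in 𝓝 y₀,
      𝓕.rel a b (e a y) (e b y) = 𝓕.rel a b (e a y₀) (e b y₀) := by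
    intro a ha b hb
    have := ((he a ha).prodMk (he b hb)).eventually (𝓕.rel_eventually a b _ _
      ((h₀ a ha).1.trans (h₀ b hb).1.symm) (h₀ a ha).2 (h₀ b hb).2)
    filter_upwards [this, hN] with y hy hyN
    exact hy (((hf y hyN) a ha).1.trans ((hf y hyN) b hb).1.symm)
  have h2 := (Filter.eventually_all_finset σ).2 fun a ha =>
    (Filter.eventually_all_finset σ).2 (h1 a ha)
  filter_upwards [h2] with y hy
  ext a b w
  simp only [mem_restrict]
  refine and_congr_right fun ha => and_congr_right fun hb => ?_
  change w ∈ 𝓕.rel a b _ _ ↔ w ∈ 𝓕.rel a b _ _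
  rw [hy a ha b hb]

theorem restrict_type_eq_of_eqOn {σ : Finset 𝓕.A} {m m' : 𝓕.A → 𝒰.M} (h : ∀ a ∈ σ, m a = m' a) :
    restrict σ (𝓕.type m) = restrict σ (𝓕.type m') := by
  ext a b w
  simp only [mem_restrict]
  refine and_congr_right fun ha => and_congr_right fun hb => ?_
  change w ∈ 𝓕.rel a b _ _ ↔ w ∈ 𝓕.rel a b _ _
  rw [h a ha, h b hb]

/-- Near `y₀` there is a continuous family of frames with constant relative positions. -/
theorem exists_frames_near (hsrc : IsLocalHomeomorph 𝒰.src) (y₀ : 𝒰.O) :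
    ∃ e : 𝓕.A → 𝒰.O → 𝒰.M, (∀ a ∈ 𝓕.nearSet y₀, ContinuousAt (e a) y₀) ∧
      ∀ᶠ y in 𝓝 y₀, 𝓕.IsFrame (𝓕.nearSet y₀) y (fun a => e a y) ∧
        restrict (𝓕.nearSet y₀) (𝓕.type fun a => e a y) =
          restrict (𝓕.nearSet y₀) (𝓕.type (𝓕.frameAt y₀)) := by
  obtain ⟨N, e, hN, hy, he₀, he, hf⟩ := exists_local_frames hsrc (isFrame_frameAt (𝓕 := 𝓕) y₀)
  have he' : ∀ a ∈ 𝓕.nearSet y₀, ContinuousAt (e a) y₀ := fun a ha =>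
    (he a ha).continuousAt (hN.mem_nhds hy)
  refine ⟨e, he', ?_⟩
  filter_upwards [eventually_restrict_type_eq (hN.mem_nhds hy) he' hf, hN.mem_nhds hy] with y h1 h2
  exact ⟨hf y h2, h1.trans (restrict_type_eq_of_eqOn he₀)⟩

open Classical in
theorem eventually_weightAt_eq (hsrc : IsLocalHomeomorph 𝒰.src) (y₀ : 𝒰.O) :
    ∀ᶠ y in 𝓝 y₀, ∀ π, 𝓕.weightAt π y =
      if π ∈ 𝓕.vertices (𝓕.nearSet y₀) (𝓕.frameAt y₀) then 𝓕.weight π.set y else 0 := by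
  obtain ⟨e, -, he⟩ := exists_frames_near (𝓕 := 𝓕) hsrc y₀
  filter_upwards [he, eventually_mem_nearSet y₀] with y h1 h2 π
  rw [weightAt_eq h1.1 h2, vertices_congr h1.2]

theorem continuous_weightAt (hsrc : IsLocalHomeomorph 𝒰.src) (π : 𝓕.typeSystem.Vertex) :
    Continuous (𝓕.weightAt π) := by
  refine continuous_iff_continuousAt.2 fun y₀ => ?_
  have h := (eventually_weightAt_eq (𝓕 := 𝓕) hsrc y₀).mono fun y hy => hy π
  refine ContinuousAt.congr ?_ (h.mono fun y hy => hy.symm)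
  split_ifs
  · exact (𝓕.continuous_weight _).continuousAt
  · exact continuousAt_const

theorem eventually_supp_pt_subset (hsrc : IsLocalHomeomorph 𝒰.src) (y₀ : 𝒰.O) :
    ∀ᶠ y in 𝓝 y₀, ∀ π ∈ (𝓕.pt y).supp.1, π ∈ 𝓕.vertices (𝓕.nearSet y₀) (𝓕.frameAt y₀) := by
  filter_upwards [eventually_weightAt_eq (𝓕 := 𝓕) hsrc y₀] with y hy π hπ
  rw [mem_supp_pt, hy] at hπ
  by_contra hn
  exact hπ (if_neg hn)

theorem continuous_coord (hsrc : IsLocalHomeomorph 𝒰.src) (π : 𝓕.typeSystem.Vertex) :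
    Continuous fun y => (𝓕.pt y).coord π := by
  change Continuous fun y => 𝓕.weightAt π y / ∑ᶠ π', 𝓕.weightAt π' y
  refine (continuous_weightAt hsrc π).div
    (continuous_finsum (fun π => continuous_weightAt hsrc π) fun y₀ => ?_) fun y => ?_
  · refine ⟨_, eventually_supp_pt_subset (𝓕 := 𝓕) hsrc y₀,
      (finite_vertices (𝓕.nearSet y₀) (𝓕.frameAt y₀)).subset ?_⟩
    rintro π ⟨y, hy, hy'⟩
    exact hy' π (mem_supp_pt.2 hy)
  · obtain ⟨π', hπ'⟩ := exists_weightAt_ne_zero (𝓕 := 𝓕) y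
    refine (finsum_pos (fun π => weightAt_nonneg π y)
      ⟨π', (weightAt_nonneg π' y).lt_of_ne' hπ'⟩ (weightAt_support_finite y)).ne'

variable (𝓕)

/-! ### The functor to the barycentric complex of groups -/

theorem exists_isFraming_supp (y : 𝒰.O) :
    ∃ x : (𝓕.A → 𝒰.M) × ∀ a, 𝓕.Γ a, 𝓕.IsFraming (𝓕.pt y).supp y x.1 x.2 := by
  obtain ⟨g, hg⟩ := exists_isFraming (𝓕 := 𝓕) (C := (𝓕.pt y).supp) (σ := 𝓕.nearSet y)
    (m := 𝓕.frameAt y) fun π hπ => weightAt_support_subset y (mem_supp_pt.1 hπ)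
  exact ⟨(𝓕.frameAt y, g), hg y _ (isFrame_frameAt y) rfl⟩

/-- A choice of a framing at `y` of the simplex supporting the image of `y`. -/
noncomputable def framing (y : 𝒰.O) : (𝓕.A → 𝒰.M) × ∀ a, 𝓕.Γ a :=
  (𝓕.exists_isFraming_supp y).choose

variable {𝓕}

theorem isFraming_framing (y : 𝒰.O) :
    𝓕.IsFraming (𝓕.pt y).supp y (𝓕.framing y).1 (𝓕.framing y).2 :=
  (𝓕.exists_isFraming_supp y).choose_spec

theorem single_subset_iff {v : 𝓕.typeSystem.Vertex} {C : 𝓕.𝒵.Z} :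
    𝓕.𝒵.objSystem.base v ⊆ (C.1 : Set 𝓕.typeSystem.Vertex) ↔ v ∈ C.1 := by
  change ({v} : Set _) ⊆ (C.1 : Set 𝓕.typeSystem.Vertex) ↔ _
  rw [Set.singleton_subset_iff, Finset.mem_coe]

theorem pair_subset {v v' : 𝓕.typeSystem.Vertex} {C : 𝓕.𝒵.Z} (h : v ∈ C.1) (h' : v' ∈ C.1) :
    𝓕.𝒵.morSystem.base (v, v') ⊆ (C.1 : Set 𝓕.typeSystem.Vertex) :=
  Set.union_subset (by simpa using h) (by simpa using h')

theorem vert_le {v : 𝓕.typeSystem.Vertex} {C : 𝓕.𝒵.Z} (h : v ∈ C.1) : 𝓕.𝒵.vert v ≤ C :=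
  𝓕.𝒵.vert_le (by simpa using h)

/-- The point of the chart at `v` over `p` with the label of the frames `e`. -/
noncomputable def objPt (v : 𝓕.typeSystem.Vertex) (p : RealPt 𝓕.𝒵.Z) (h : v ∈ p.supp.1)
    (x : (𝓕.A → 𝒰.M) × ∀ a, 𝓕.Γ a) (e : 𝓕.A → 𝒰.M) : 𝓕.𝒵.objSystem.Realization :=
  ⟨v, p, single_subset_iff.2 h, 𝓕.𝒵.objMk (single_subset_iff.2 h) (label (vert_le h) x.1 x.2 e)⟩

/-- The arrow over `p` with the labels of the frames `e` and `e'`. -/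
noncomputable def morPt (v v' : 𝓕.typeSystem.Vertex) (p : RealPt 𝓕.𝒵.Z) (h : v ∈ p.supp.1)
    (h' : v' ∈ p.supp.1) (x : (𝓕.A → 𝒰.M) × ∀ a, 𝓕.Γ a) (e e' : 𝓕.A → 𝒰.M) :
    𝓕.𝒵.morSystem.Realization :=
  ⟨(v, v'), p, pair_subset h h', 𝓕.𝒵.morMk (b := (v, v')) (pair_subset h h')
    (label (vert_le h) x.1 x.2 e) (label (vert_le h') x.1 x.2 e')⟩

theorem objPt_congr {v : 𝓕.typeSystem.Vertex} {p p' : RealPt 𝓕.𝒵.Z} (hp : p = p')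
    {h : v ∈ p.supp.1} {h' : v ∈ p'.supp.1} {y : 𝒰.O} {x x' : (𝓕.A → 𝒰.M) × ∀ a, 𝓕.Γ a}
    (hx : 𝓕.IsFraming p.supp y x.1 x.2) (hx' : 𝓕.IsFraming p'.supp y x'.1 x'.2)
    {e : 𝓕.A → 𝒰.M} (he : 𝓕.IsFrame (core (𝓕.𝒵.vert v)) y e) :
    objPt v p h x e = objPt v p' h' x' e := by
  subst hp
  obtain ⟨k, hk⟩ := hx.exists_label_eq hx'
  unfold objPt
  congr 1
  exact (𝓕.𝒵.objMk_eq _ _ _).2 ⟨k, hk v _ e he⟩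

theorem morPt_congr {v v' : 𝓕.typeSystem.Vertex} {p p' : RealPt 𝓕.𝒵.Z} (hp : p = p')
    {h₁ : v ∈ p.supp.1} {h₂ : v' ∈ p.supp.1} {h₁' : v ∈ p'.supp.1} {h₂' : v' ∈ p'.supp.1}
    {y : 𝒰.O} {x x' : (𝓕.A → 𝒰.M) × ∀ a, 𝓕.Γ a}
    (hx : 𝓕.IsFraming p.supp y x.1 x.2) (hx' : 𝓕.IsFraming p'.supp y x'.1 x'.2)
    {e e' : 𝓕.A → 𝒰.M} (he : 𝓕.IsFrame (core (𝓕.𝒵.vert v)) y e)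
    (he' : 𝓕.IsFrame (core (𝓕.𝒵.vert v')) y e') :
    morPt v v' p h₁ h₂ x e e' = morPt v v' p' h₁' h₂' x' e e' := by
  subst hp
  obtain ⟨k, hk⟩ := hx.exists_label_eq hx'
  unfold morPt
  congr 1
  exact (𝓕.𝒵.morMk_eq _ _ _ _ _).2 ⟨k, hk v _ e he, hk v' _ e' he'⟩

theorem objPt_mul {v : 𝓕.typeSystem.Vertex} {p : RealPt 𝓕.𝒵.Z} (h : v ∈ p.supp.1) {r : 𝒰.M}
    {x : (𝓕.A → 𝒰.M) × ∀ a, 𝓕.Γ a} (hx : 𝓕.IsFraming p.supp (𝒰.tgt r) x.1 x.2) {e : 𝓕.A → 𝒰.M}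
    (he : 𝓕.IsFrame (core (𝓕.𝒵.vert v)) (𝒰.tgt r) e) :
    objPt v p h (fun a => 𝒰.mul r (x.1 a), x.2) (fun a => 𝒰.mul r (e a)) = objPt v p h x e := by
  unfold objPt
  congr 2
  exact label_mul _ _ hx.isFrame he

theorem morPt_mul {v v' : 𝓕.typeSystem.Vertex} {p : RealPt 𝓕.𝒵.Z} (h : v ∈ p.supp.1)
    (h' : v' ∈ p.supp.1) {r : 𝒰.M}
    {x : (𝓕.A → 𝒰.M) × ∀ a, 𝓕.Γ a} (hx : 𝓕.IsFraming p.supp (𝒰.tgt r) x.1 x.2)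
    {e e' : 𝓕.A → 𝒰.M} (he : 𝓕.IsFrame (core (𝓕.𝒵.vert v)) (𝒰.tgt r) e)
    (he' : 𝓕.IsFrame (core (𝓕.𝒵.vert v')) (𝒰.tgt r) e') :
    morPt v v' p h h' (fun a => 𝒰.mul r (x.1 a), x.2) (fun a => 𝒰.mul r (e a))
      (fun a => 𝒰.mul r (e' a)) = morPt v v' p h h' x e e' := by
  unfold morPt
  congr 2
  · exact label_mul _ _ hx.isFrame he
  · exact label_mul _ _ hx.isFrame he'

theorem label_eq_of_eqOn {v : 𝓕.typeSystem.Vertex} {C : 𝓕.𝒵.Z} (hv : 𝓕.𝒵.vert v ≤ C)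
    (m : 𝓕.A → 𝒰.M) (g : ∀ a, 𝓕.Γ a) {e e' : 𝓕.A → 𝒰.M}
    (h : ∀ a ∈ core (𝓕.𝒵.vert v), e a = e' a) : label hv m g e = label hv m g e' := by
  refine Subtype.ext ?_
  change _ * _ = _ * _
  congr 1
  ext a
  by_cases ha : a ∈ core (𝓕.𝒵.vert v)
  · rw [proj_apply_of_mem ha, proj_apply_of_mem ha]
    change 𝓕.lam a _ _ * _ = 𝓕.lam a _ _ * _
    rw [h a ha]
  · rw [proj_apply_of_notMem ha, proj_apply_of_notMem ha]

theorem morPt_eq_of_eqOn {v v' : 𝓕.typeSystem.Vertex} {p : RealPt 𝓕.𝒵.Z} (h : v ∈ p.supp.1)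
    (h' : v' ∈ p.supp.1) (x : (𝓕.A → 𝒰.M) × ∀ a, 𝓕.Γ a) {e₁ e₁' e₂ e₂' : 𝓕.A → 𝒰.M}
    (he : ∀ a ∈ core (𝓕.𝒵.vert v), e₁ a = e₂ a) (he' : ∀ a ∈ core (𝓕.𝒵.vert v'), e₁' a = e₂' a) :
    morPt v v' p h h' x e₁ e₁' = morPt v v' p h h' x e₂ e₂' := by
  unfold morPt
  rw [label_eq_of_eqOn _ _ _ he, label_eq_of_eqOn _ _ _ he']

theorem morPt_eq_chart {v v' : 𝓕.typeSystem.Vertex} {p : RealPt 𝓕.𝒵.Z} (h : v ∈ p.supp.1)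
    (h' : v' ∈ p.supp.1) {C : 𝓕.𝒵.Z} (hC : p.supp ≤ C) (m : 𝓕.A → 𝒰.M) (g : ∀ a, 𝓕.Γ a)
    (e e' : 𝓕.A → 𝒰.M) :
    morPt v v' p h h' (m, proj 𝓕.Γ (core p.supp) g * transport hC) e e' =
      𝓕.𝒵.morSystem.chart (v, v') C (pair_subset (hC h) (hC h'))
        (𝓕.𝒵.morMk (b := (v, v')) (pair_subset (hC h) (hC h')) (label (vert_le (hC h)) m g e)
          (label (vert_le (hC h')) m g e')) ⟨p, hC, pair_subset h h'⟩ := by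
  unfold morPt CellSystem.chart
  congr 1
  refine Eq.trans ?_ (𝓕.𝒵.morRes_mk (b := (v, v')) hC (pair_subset h h') _ _).symm
  congr 1
  · exact label_restrict _ _ _ _ _
  · exact label_restrict _ _ _ _ _

variable (𝓕)

/-- A continuous family of frames over an open subset of the star of a vertex. -/
structure LocalFrame where
  v : 𝓕.typeSystem.Vertex
  N : Set 𝒰.O
  isOpen_N : IsOpen N
  mem_supp : ∀ y ∈ N, v ∈ (𝓕.pt y).supp.1
  e : 𝓕.A → 𝒰.O → 𝒰.M
  continuousOn_e : ∀ a ∈ core (𝓕.𝒵.vert v), ContinuousOn (e a) N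
  isFrame : ∀ y ∈ N, 𝓕.IsFrame (core (𝓕.𝒵.vert v)) y fun a => e a y

variable {𝓕}

theorem core_vert_subset {σ : Finset 𝓕.A} {m : 𝓕.A → 𝒰.M} {v : 𝓕.typeSystem.Vertex}
    (h : v ∈ 𝓕.vertices σ m) : core (𝓕.𝒵.vert v) ⊆ σ := by
  rw [core_vert]
  exact Finset.singleton_subset_iff.2 (h.1 v.base_mem)

theorem LocalFrame.exists_mem (hsrc : IsLocalHomeomorph 𝒰.src) (y : 𝒰.O) :
    ∃ k : 𝓕.LocalFrame, y ∈ k.N := by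
  obtain ⟨v, hv⟩ := exists_weightAt_ne_zero (𝓕 := 𝓕) y
  have hm := (isFrame_frameAt (𝓕 := 𝓕) y).mono (core_vert_subset (weightAt_support_subset y hv))
  obtain ⟨N, e, hN, hy, -, he, hf⟩ := exists_local_frames hsrc hm
  refine ⟨⟨v, N ∩ {y | 𝓕.weightAt v y ≠ 0},
    hN.inter (isOpen_ne_fun (continuous_weightAt hsrc v) continuous_const),
    fun y hy => mem_supp_pt.2 hy.2, e, fun a ha => (he a ha).mono Set.inter_subset_left,
    fun y hy => hf y hy.1⟩, hy, hv⟩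

/-- The image of an arrow `r`: over the image of its source, the labels of the frames at the source
and of the frames at the target transported along `r`. -/
noncomputable def morAt (k k' : 𝓕.LocalFrame) (r : 𝒰.M) (h : 𝒰.src r ∈ k.N)
    (h' : 𝒰.tgt r ∈ k'.N) : 𝓕.𝒵.morSystem.Realization :=
  morPt k.v k'.v (𝓕.pt (𝒰.src r)) (k.mem_supp _ h)
    (by rw [pt_invariant]; exact k'.mem_supp _ h') (𝓕.framing (𝒰.src r))
    (fun a => k.e a (𝒰.src r)) (fun a => 𝒰.mul r (k'.e a (𝒰.tgt r)))

theorem morAt_eq {k k' : 𝓕.LocalFrame} {r : 𝒰.M} {h : 𝒰.src r ∈ k.N} {h' : 𝒰.tgt r ∈ k'.N}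
    {p : RealPt 𝓕.𝒵.Z} (hp : 𝓕.pt (𝒰.src r) = p) (h₁ : k.v ∈ p.supp.1) (h₂ : k'.v ∈ p.supp.1)
    {x : (𝓕.A → 𝒰.M) × ∀ a, 𝓕.Γ a} (hx : 𝓕.IsFraming p.supp (𝒰.src r) x.1 x.2) :
    morAt k k' r h h' = morPt k.v k'.v p h₁ h₂ x (fun a => k.e a (𝒰.src r))
      (fun a => 𝒰.mul r (k'.e a (𝒰.tgt r))) :=
  morPt_congr hp (isFraming_framing _) hx (k.isFrame _ h) (k'.isFrame _ h').mul

theorem morAt_eq_of_tgt {k k' : 𝓕.LocalFrame} {r r' : 𝒰.M} (hr : 𝒰.tgt r = 𝒰.src r')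
    {h : 𝒰.src r' ∈ k.N} {h' : 𝒰.tgt r' ∈ k'.N} {p : RealPt 𝓕.𝒵.Z} (hp : 𝓕.pt (𝒰.src r) = p)
    (h₁ : k.v ∈ p.supp.1) (h₂ : k'.v ∈ p.supp.1)
    {x : (𝓕.A → 𝒰.M) × ∀ a, 𝓕.Γ a} (hx : 𝓕.IsFraming p.supp (𝒰.src r) x.1 x.2) :
    morAt k k' r' h h' = morPt k.v k'.v p h₁ h₂ x (fun a => 𝒰.mul r (k.e a (𝒰.src r')))
      (fun a => 𝒰.mul r (𝒰.mul r' (k'.e a (𝒰.tgt r')))) := by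
  have hp' : 𝓕.pt (𝒰.src r') = p := by rw [← hr, ← pt_invariant, hp]
  subst hp'
  have hf : 𝓕.IsFraming (𝓕.pt (𝒰.src r')).supp (𝒰.tgt r) (𝓕.framing (𝒰.src r')).1
      (𝓕.framing (𝒰.src r')).2 := by
    rw [hr]; exact isFraming_framing _
  have he : 𝓕.IsFrame (core (𝓕.𝒵.vert k.v)) (𝒰.tgt r) fun a => k.e a (𝒰.src r') := by
    rw [hr]; exact k.isFrame _ h
  have he' : 𝓕.IsFrame (core (𝓕.𝒵.vert k'.v)) (𝒰.tgt r)
      fun a => 𝒰.mul r' (k'.e a (𝒰.tgt r')) := by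
    rw [hr]; exact (k'.isFrame _ h').mul
  exact (morPt_mul h₁ h₂ hf he he').symm.trans (morPt_congr rfl hf.mul hx he.mul he'.mul)

theorem isComp_morPt {v v' v'' : 𝓕.typeSystem.Vertex} {p : RealPt 𝓕.𝒵.Z} (h : v ∈ p.supp.1)
    (h' : v' ∈ p.supp.1) (h'' : v'' ∈ p.supp.1) (x : (𝓕.A → 𝒰.M) × ∀ a, 𝓕.Γ a)
    (e e' e'' : 𝓕.A → 𝒰.M) :
    𝓕.𝒵.IsComp (morPt v v' p h h' x e e') (morPt v' v'' p h' h'' x e' e'')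
      (morPt v v'' p h h'' x e e'') :=
  ComplexOfGroups.IsComp.mk _ _ _ _ _ _ _ _ _ _

/-- The labels of a continuous family of frames, relative to another one, are locally constant. -/
theorem eventually_label_eq {v : 𝓕.typeSystem.Vertex} {C : 𝓕.𝒵.Z} (hv : 𝓕.𝒵.vert v ≤ C)
    (g : ∀ a, 𝓕.Γ a) {D : Type*} [TopologicalSpace D] {t₀ : D} {e m : D → 𝓕.A → 𝒰.M} {y : D → 𝒰.O}
    (he : ∀ a ∈ core (𝓕.𝒵.vert v), ContinuousAt (fun t => e t a) t₀)
    (hm : ∀ a ∈ core (𝓕.𝒵.vert v), ContinuousAt (fun t => m t a) t₀)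
    (hf : ∀ᶠ t in 𝓝 t₀, 𝓕.IsFrame (core (𝓕.𝒵.vert v)) (y t) (e t) ∧
      𝓕.IsFrame (core (𝓕.𝒵.vert v)) (y t) (m t)) :
    ∀ᶠ t in 𝓝 t₀, label hv (m t) g (e t) = label hv (m t₀) g (e t₀) := by
  have h₀ := hf.self_of_nhds
  have h1 : ∀ a ∈ core (𝓕.𝒵.vert v), ∀ᶠ t in 𝓝 t₀,
      𝓕.lam a (e t a) (m t a) = 𝓕.lam a (e t₀ a) (m t₀ a) := by
    intro a ha
    have := ((he a ha).prodMk (hm a ha)).eventually (𝓕.lam_eventually a _ _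
      ((h₀.1 a ha).1.trans (h₀.2 a ha).1.symm) (h₀.1 a ha).2 (h₀.2 a ha).2)
    filter_upwards [this, hf] with t ht hft
    exact ht ((hft.1 a ha).1.trans (hft.2 a ha).1.symm)
  filter_upwards [(Filter.eventually_all_finset _).2 h1] with t ht
  refine Subtype.ext ?_
  change _ * _ = _ * _
  congr 1
  ext a
  by_cases ha : a ∈ core (𝓕.𝒵.vert v)
  · rw [proj_apply_of_mem ha, proj_apply_of_mem ha]
    exact congrArg (· * g a) (ht a ha)
  · rw [proj_apply_of_notMem ha, proj_apply_of_notMem ha]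

theorem continuous_morAt (hsrc : IsLocalHomeomorph 𝒰.src) (k k' : 𝓕.LocalFrame) :
    Continuous fun r : {r : 𝒰.M // 𝒰.src r ∈ k.N ∧ 𝒰.tgt r ∈ k'.N} =>
      morAt k k' r.1 r.2.1 r.2.2 := by
  refine continuous_iff_continuousAt.2 fun r₀ => ?_
  let D := {r : 𝒰.M // 𝒰.src r ∈ k.N ∧ 𝒰.tgt r ∈ k'.N}
  have hs : Continuous fun r : D => 𝒰.src r.1 := 𝒰.continuous_src.comp continuous_subtype_val
  have ht : Continuous fun r : D => 𝒰.tgt r.1 := 𝒰.continuous_tgt.comp continuous_subtype_val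
  let y₀ := 𝒰.src r₀.1
  have hfin := finite_vertices (𝓕.nearSet y₀) (𝓕.frameAt y₀)
  obtain ⟨m, hmc, hm⟩ := exists_frames_near (𝓕 := 𝓕) hsrc y₀
  have hv : ∀ r : D, k.v ∈ (𝓕.pt (𝒰.src r.1)).supp.1 := fun r => k.mem_supp _ r.2.1
  have hv' : ∀ r : D, k'.v ∈ (𝓕.pt (𝒰.src r.1)).supp.1 := fun r => by
    rw [pt_invariant]; exact k'.mem_supp _ r.2.2
  refine CellSystem.continuousAt_of_eventually_eq_chart (S := 𝓕.𝒵.morSystem)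
    (p := fun r : D => 𝓕.pt (𝒰.src r.1))
    (fun v => (continuous_coord hsrc v).comp hs) (b := (k.v, k'.v))
    (fun r => pair_subset (hv r) (hv' r))
    (Q := {C | ∀ π ∈ C.1, π ∈ 𝓕.vertices (𝓕.nearSet y₀) (𝓕.frameAt y₀)}) ?_ ?_ ?_
  · refine Set.Finite.of_finite_image (f := Subtype.val) (hfin.toFinset.powerset.finite_toSet.subset
      ?_) Subtype.val_injective.injOn
    rintro _ ⟨C, hC, rfl⟩
    refine Finset.mem_coe.2 (Finset.mem_powerset.2 fun π hπ => ?_)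
    exact (Set.Finite.mem_toFinset _).2 (hC π hπ)
  · exact hs.continuousAt.eventually (eventually_supp_pt_subset (𝓕 := 𝓕) hsrc y₀)
  · intro C hC hb
    have hvC : k.v ∈ C.1 := hb (Or.inl rfl)
    have hvC' : k'.v ∈ C.1 := hb (Or.inr rfl)
    obtain ⟨g, hg⟩ := exists_isFraming (𝓕 := 𝓕) (C := C) hC
    have hcore := core_vert_subset (hC _ hvC)
    have hcore' := core_vert_subset (hC _ hvC')
    let e : D → 𝓕.A → 𝒰.M := fun r a => k.e a (𝒰.src r.1)
    let e' : D → 𝓕.A → 𝒰.M := fun r a => 𝒰.mul r.1 (k'.e a (𝒰.tgt r.1))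
    have hms : ∀ a ∈ 𝓕.nearSet y₀, ContinuousAt (fun r : D => m a (𝒰.src r.1)) r₀ := fun a ha =>
      (hmc a ha).comp (f := fun r : D => 𝒰.src r.1) hs.continuousAt
    have hm' := hs.continuousAt.eventually hm
    have h1 := eventually_label_eq (vert_le hvC) g (t₀ := r₀) (e := e)
      (m := fun r a => m a (𝒰.src r.1)) (y := fun r => 𝒰.src r.1)
      (fun a ha => ((k.continuousOn_e a ha).continuousAt (k.isOpen_N.mem_nhds r₀.2.1)).comp
        (f := fun r : D => 𝒰.src r.1) hs.continuousAt)
      (fun a ha => hms a (hcore ha))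
      (hm'.mono fun r hr => ⟨k.isFrame _ r.2.1, hr.1.mono hcore⟩)
    have h2 := eventually_label_eq (vert_le hvC') g (t₀ := r₀) (e := e')
      (m := fun r a => m a (𝒰.src r.1)) (y := fun r => 𝒰.src r.1)
      (fun a ha => TopGroupoid.continuousAt_mul continuous_subtype_val.continuousAt
        (((k'.continuousOn_e a ha).continuousAt (k'.isOpen_N.mem_nhds r₀.2.2)).comp
          (f := fun r : D => 𝒰.tgt r.1) ht.continuousAt)
        (Filter.Eventually.of_forall fun r => (k'.isFrame _ r.2.2 a ha).1.symm))
      (fun a ha => hms a (hcore' ha))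
      (hm'.mono fun r hr => ⟨(k'.isFrame _ r.2.2).mul, hr.1.mono hcore'⟩)
    refine ⟨𝓕.𝒵.morMk (b := (k.v, k'.v)) hb
      (label (vert_le hvC) (fun a => m a (𝒰.src r₀.1)) g (e r₀))
      (label (vert_le hvC') (fun a => m a (𝒰.src r₀.1)) g (e' r₀)), ?_⟩
    filter_upwards [h1, h2, hm'] with r hr1 hr2 hr3 hle
    have hfr := hg _ _ hr3.1 hr3.2
    rw [← hr1, ← hr2]
    exact (morAt_eq rfl (hv r) (hv' r) (x := (_, _)) (hfr.restrict hle)).trans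
      (morPt_eq_chart (hv r) (hv' r) hle _ _ _ _)

variable (𝓕)

/-- The functor from the Čech groupoid of the cover by local frames. -/
noncomputable def cechFunctor (hsrc : IsLocalHomeomorph 𝒰.src) :
    CechFunctor 𝒰 𝓕.𝒵.groupoid where
  K := 𝓕.LocalFrame
  N k := k.N
  isOpen_N k := k.isOpen_N
  cover := LocalFrame.exists_mem hsrc
  obj k y h := objPt k.v (𝓕.pt y) (k.mem_supp _ h) (𝓕.framing y) fun a => k.e a y
  mor := morAt
  continuous_obj k := by
    have h1 : Continuous fun y : k.N => (⟨𝒰.one y.1, by rw [𝒰.src_one]; exact y.2,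
        by rw [𝒰.tgt_one]; exact y.2⟩ : {r : 𝒰.M // 𝒰.src r ∈ k.N ∧ 𝒰.tgt r ∈ k.N}) :=
      (𝒰.continuous_one.comp continuous_subtype_val).subtype_mk _
    refine (𝓕.𝒵.srcMap.continuous_real.comp ((continuous_morAt hsrc k k).comp h1)).congr
      fun y => ?_
    have key : ∀ (y' : 𝒰.O) (h : y' = y.1) (h' : y' ∈ k.N),
        objPt k.v (𝓕.pt y') (k.mem_supp _ h') (𝓕.framing y') (fun a => k.e a y') =
          objPt k.v (𝓕.pt y.1) (k.mem_supp _ y.2) (𝓕.framing y.1) fun a => k.e a y.1 := by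
      rintro y' rfl h'; rfl
    exact key _ (𝒰.src_one _) (by rw [𝒰.src_one]; exact y.2)
  continuous_mor := continuous_morAt hsrc
  src_mor k k' r h h' := rfl
  tgt_mor k k' r h h' := by
    have hv' : k'.v ∈ (𝓕.pt (𝒰.tgt r)).supp.1 := k'.mem_supp _ h'
    have hv : k'.v ∈ (𝓕.pt (𝒰.src r)).supp.1 := by rwa [pt_invariant]
    have hf := isFraming_framing (𝓕 := 𝓕) (𝒰.tgt r)
    have e1 := objPt_congr (pt_invariant r) (h := hv) (h' := hv') (isFraming_framing (𝒰.src r))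
      (x' := (fun a => 𝒰.mul r ((𝓕.framing (𝒰.tgt r)).1 a), (𝓕.framing (𝒰.tgt r)).2)) hf.mul
      (k'.isFrame _ h').mul
    exact e1.trans (objPt_mul hv' hf (k'.isFrame _ h'))
  comp_mor k k' k'' r r' hr h₁ h₂ h₁' h₂' H h h' := by
    have hv := k.mem_supp _ h₁
    have hv' : k'.v ∈ (𝓕.pt (𝒰.src r)).supp.1 := by rw [pt_invariant]; exact k'.mem_supp _ h₂
    have hv'' : k''.v ∈ (𝓕.pt (𝒰.src r)).supp.1 := by
      rw [pt_invariant, hr, pt_invariant]; exact k''.mem_supp _ h₂'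
    have hf := isFraming_framing (𝓕 := 𝓕) (𝒰.src r)
    have e1 := morAt_eq_of_tgt hr (h := h₁') (h' := h₂') rfl hv' hv'' hf
    have e2 : morAt k k'' (𝒰.comp r r' hr) h h' = morPt k.v k''.v (𝓕.pt (𝒰.src r)) hv hv''
        (𝓕.framing (𝒰.src r)) (fun a => k.e a (𝒰.src r))
        (fun a => 𝒰.mul r (𝒰.mul r' (k''.e a (𝒰.tgt r')))) := by
      refine (morAt_eq (by rw [𝒰.src_comp]) hv hv'' (x := 𝓕.framing (𝒰.src r))
        (by rw [𝒰.src_comp]; exact hf)).trans ?_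
      refine morPt_eq_of_eqOn _ _ _ (fun a _ => by rw [𝒰.src_comp]) fun a ha => ?_
      have h3 := ((k''.isFrame _ h₂') a ha).1
      rw [𝒰.tgt_comp, ← TopGroupoid.mul_eq hr, TopGroupoid.mul_assoc hr h3.symm]
    have e0 := morAt_eq (k := k) (k' := k') (h := h₁) (h' := h₂) rfl hv hv' hf
    rw [← hr] at e1
    have e3 : 𝓕.𝒵.IsComp (morAt k k' r h₁ h₂) (morAt k' k'' r' h₁' h₂')
        (morAt k k'' (𝒰.comp r r' hr) h h') := by
      rw [e0, e1, e2]
      exact isComp_morPt hv hv' hv'' _ _ _ _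
    exact 𝓕.𝒵.eq_comp H e3

/-- If the labels of the source frames agree, then the ambiguity in the labels is trivial because
restriction maps are injective. Then the transports along `r` and `r'` of the frame at the target
have trivial difference, so they are equal. -/
theorem cechFunctor_injective (hsrc : IsLocalHomeomorph 𝒰.src) (k k' : 𝓕.LocalFrame) (r r' : 𝒰.M)
    (h₁ : 𝒰.src r ∈ k.N) (h₂ : 𝒰.tgt r ∈ k'.N) (h₁' : 𝒰.src r' ∈ k.N) (h₂' : 𝒰.tgt r' ∈ k'.N)
    (hs : 𝒰.src r = 𝒰.src r') (ht : 𝒰.tgt r = 𝒰.tgt r')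
    (H : (𝓕.cechFunctor hsrc).mor k k' r h₁ h₂ = (𝓕.cechFunctor hsrc).mor k k' r' h₁' h₂') :
    r = r' := by
  have hv := k.mem_supp _ h₁
  have hv' : k'.v ∈ (𝓕.pt (𝒰.src r)).supp.1 := by rw [pt_invariant]; exact k'.mem_supp _ h₂
  have hf := isFraming_framing (𝓕 := 𝓕) (𝒰.src r)
  have e1 := morAt_eq (k := k) (k' := k') (h := h₁) (h' := h₂) rfl hv hv' hf
  have e2 := morAt_eq (k := k) (k' := k') (h := h₁') (h' := h₂') (by rw [hs]) hv hv'
    (x := 𝓕.framing (𝒰.src r)) (by rw [← hs]; exact hf)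
  have e3 := CellSystem.Realization.a_inj (e1.symm.trans (H.trans e2))
  obtain ⟨x, hx₁, hx₂⟩ := (𝓕.𝒵.morMk_eq _ _ _ _ _).1 e3
  rw [← hs, left_eq_mul] at hx₁
  have hx : x = 1 := 𝓕.𝒵.res_injective _ (hx₁.trans (map_one _).symm)
  rw [hx, map_one, mul_one] at hx₂
  have ha : k'.v.base ∈ core (𝓕.𝒵.vert k'.v) := by rw [core_vert]; simp
  have hx₃ := congrFun (mul_right_cancel (congrArg Subtype.val hx₂)) k'.v.base
  rw [proj_apply_of_mem ha, proj_apply_of_mem ha] at hx₃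
  have hx₄ := mul_right_cancel hx₃
  have hm := hf.isFrame _ (core_mono (vert_le hv') ha)
  have hr := ((k'.isFrame _ h₂).mul) _ ha
  have hr' := ((k'.isFrame _ h₂').mul) _ ha
  have h5 := 𝓕.lam_mul_lam _ _ _ _ (hr.1.trans hm.1.symm) (hm.1.trans hr.1.symm) hr.2 hm.2 hr.2
  have h6 := 𝓕.lam_mul_lam _ _ _ _ (hr'.1.trans (hs.symm.trans hm.1.symm)) (hm.1.trans hr.1.symm)
    hr'.2 hm.2 hr.2
  have h7 := 𝓕.lam_mul_lam _ _ _ _ rfl rfl hr.2 hr.2 hr.2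
  have h8 := 𝓕.eq_of_lam_eq_one _ _ _ (hr'.1.trans (hs.symm.trans hr.1.symm)) hr'.2 hr.2
    (by rw [← h6, ← left_eq_mul.1 h7.symm, ← h5]; exact congrArg (· * _) hx₄)
  have hk : 𝒰.src (k'.e k'.v.base (𝒰.tgt r)) = 𝒰.tgt r := ((k'.isFrame _ h₂) _ ha).1
  have h9 : 𝒰.mul r (k'.e k'.v.base (𝒰.tgt r)) = 𝒰.mul r' (k'.e k'.v.base (𝒰.tgt r)) := by
    rw [ht]
    exact (h8.trans (by rw [ht])).symm
  rw [TopGroupoid.mul_eq hk.symm, TopGroupoid.mul_eq (by rw [← ht, hk])] at h9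
  exact 𝒰.comp_right_cancel h9

end FramedCover

/-! ### Étale proper groupoids -/

namespace TopGroupoid

variable (𝒰 : TopGroupoid.{u})

/-- The groupoids presenting orbispaces: the source is étale, and the diagonal is separated and
proper. -/
structure IsEtaleProper : Prop where
  isLocalHomeomorph_src : IsLocalHomeomorph 𝒰.src
  isSeparatedMap : IsSeparatedMap fun m => (𝒰.src m, 𝒰.tgt m)
  isProperMap : IsProperMap fun m => (𝒰.src m, 𝒰.tgt m)

/-- The arrows from `y` to itself. -/
def Isotropy (y : 𝒰.O) : Type u := {m : 𝒰.M // 𝒰.src m = y ∧ 𝒰.tgt m = y}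

variable {𝒰}

namespace Isotropy

variable {y : 𝒰.O}

theorem tgt_eq_src (γ δ : 𝒰.Isotropy y) : 𝒰.tgt γ.1 = 𝒰.src δ.1 := γ.2.2.trans δ.2.1.symm

noncomputable instance : Group (𝒰.Isotropy y) where
  mul γ δ := ⟨𝒰.mul γ.1 δ.1, (src_mul (tgt_eq_src γ δ)).trans γ.2.1,
    (tgt_mul (tgt_eq_src γ δ)).trans δ.2.2⟩
  one := ⟨𝒰.one y, 𝒰.src_one y, 𝒰.tgt_one y⟩
  inv γ := ⟨𝒰.inv γ.1, (𝒰.src_inv _).trans γ.2.2, (𝒰.tgt_inv _).trans γ.2.1⟩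
  mul_assoc γ δ ε := Subtype.ext (TopGroupoid.mul_assoc (tgt_eq_src γ δ) (tgt_eq_src δ ε))
  one_mul γ := Subtype.ext (TopGroupoid.one_mul γ.2.1.symm)
  mul_one γ := Subtype.ext (TopGroupoid.mul_one γ.2.2)
  inv_mul_cancel γ := Subtype.ext (inv_mul.trans (congrArg 𝒰.one γ.2.2))

theorem coe_mul (γ δ : 𝒰.Isotropy y) : (γ * δ).1 = 𝒰.mul γ.1 δ.1 := rfl

end Isotropy

theorem inv_inv (m : 𝒰.M) : 𝒰.inv (𝒰.inv m) = m := by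
  rw [← TopGroupoid.mul_one (m := 𝒰.inv (𝒰.inv m)) ((𝒰.tgt_inv _).trans (𝒰.src_inv m)),
    ← inv_mul (m := m), ← TopGroupoid.mul_assoc (𝒰.tgt_inv _) (𝒰.tgt_inv m), inv_mul,
    TopGroupoid.one_mul (𝒰.tgt_inv m)]

theorem isLocalHomeomorph_src_of_tgt (h : IsLocalHomeomorph 𝒰.tgt) : IsLocalHomeomorph 𝒰.src := by
  let i : 𝒰.M ≃ₜ 𝒰.M := ⟨⟨𝒰.inv, 𝒰.inv, inv_inv, inv_inv⟩, 𝒰.continuous_inv, 𝒰.continuous_inv⟩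
  have : 𝒰.src = 𝒰.tgt ∘ i := funext fun m => (𝒰.tgt_inv m).symm
  rw [this]
  exact h.comp i.isLocalHomeomorph

namespace IsEtaleProper

variable (h𝒰 : 𝒰.IsEtaleProper)
include h𝒰

theorem finite_isotropy (y : 𝒰.O) : Finite (𝒰.Isotropy y) := by
  have hc : IsCompact {m : 𝒰.M | 𝒰.src m = y ∧ 𝒰.tgt m = y} := by
    have := h𝒰.isProperMap.isCompact_preimage (isCompact_singleton (x := (y, y)))
    convert this using 1
    ext m
    simp [Prod.ext_iff]
  refine Set.finite_coe_iff.2 (hc.finite (isDiscrete_iff_forall_mem_exists_isOpen.2 fun m hm => ?_))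
  obtain ⟨f, hf, hfe⟩ := h𝒰.isLocalHomeomorph_src m
  refine ⟨f.source, f.open_source, ?_⟩
  ext m'
  refine ⟨fun h => f.injOn h.1 hf ?_, fun h => ?_⟩
  · rw [← hfe]
    exact h.2.1.trans hm.1.symm
  · obtain rfl : m' = m := h
    exact ⟨hf, hm⟩

/-- A property of arrows which holds near the isotropy group of `y` holds for all arrows between
points close to `y`. -/
theorem exists_isOpen_forall {y : 𝒰.O} {p : 𝒰.M → Prop}
    (hp : ∀ γ : 𝒰.Isotropy y, ∀ᶠ m in 𝓝 γ.1, p m) :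
    ∃ Y : Set 𝒰.O, IsOpen Y ∧ y ∈ Y ∧ ∀ m, 𝒰.src m ∈ Y → 𝒰.tgt m ∈ Y → p m := by
  have := h𝒰.isProperMap.isClosedMap.eventually_nhds_fiber (p := p) (y, y) fun m hm =>
    hp ⟨m, congrArg Prod.fst hm, congrArg Prod.snd hm⟩
  rw [nhds_prod_eq] at this
  obtain ⟨N, hN, H⟩ := Filter.mem_prod_self_iff.1 this
  obtain ⟨Y, hYN, hY, hy⟩ := mem_nhds_iff.1 hN
  exact ⟨Y, hY, hy, fun m h h' => H (Set.mk_mem_prod (hYN h) (hYN h')) m rfl⟩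

theorem eventually_eq_one (y : 𝒰.O) : ∀ᶠ m in 𝓝 (𝒰.one y), m = 𝒰.one (𝒰.src m) := by
  obtain ⟨f, hf, hfe⟩ := h𝒰.isLocalHomeomorph_src (𝒰.one y)
  have hc : ContinuousAt (fun m => 𝒰.one (𝒰.src m)) (𝒰.one y) :=
    (𝒰.continuous_one.comp 𝒰.continuous_src).continuousAt
  have h1 : f.source ∈ 𝓝 (𝒰.one (𝒰.src (𝒰.one y))) := by
    rw [𝒰.src_one]
    exact f.open_source.mem_nhds hf
  filter_upwards [f.open_source.mem_nhds hf, hc h1] with m h h'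
  refine f.injOn h h' ?_
  rw [← hfe]
  exact (𝒰.src_one _).symm

/-- An arrow lies on a local section of the source. -/
theorem exists_section (m : 𝒰.M) : ∃ e : 𝒰.O → 𝒰.M, e (𝒰.src m) = m ∧
    ContinuousAt e (𝒰.src m) ∧
    ∀ᶠ z in 𝓝 (𝒰.src m), 𝒰.src (e z) = z ∧ ContinuousAt e z := by
  obtain ⟨f, hf, hfe⟩ := h𝒰.isLocalHomeomorph_src m
  have ht : 𝒰.src m ∈ f.target := by
    rw [hfe]
    exact f.map_source hf
  refine ⟨f.symm, ?_, f.symm.continuousAt ht, ?_⟩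
  · rw [hfe]
    exact f.left_inv hf
  · filter_upwards [f.open_target.mem_nhds ht] with z hz
    exact ⟨by rw [hfe]; exact f.right_inv hz, f.symm.continuousAt hz⟩

end IsEtaleProper

variable (𝒰) in
/-- A chart at `y`: on the arrows between points of the neighbourhood `Y` there is a locally
constant homomorphism `hol` to the isotropy group of `y`, with trivial kernel. -/
structure Chart (y : 𝒰.O) where
  Y : Set 𝒰.O
  isOpen_Y : IsOpen Y
  mem_Y : y ∈ Y
  hol : 𝒰.M → 𝒰.Isotropy y
  hol_eventually : ∀ m, 𝒰.src m ∈ Y → 𝒰.tgt m ∈ Y → ∀ᶠ m' in 𝓝 m, hol m' = hol m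
  hol_mul : ∀ m m', 𝒰.src m ∈ Y → 𝒰.tgt m ∈ Y → 𝒰.tgt m' ∈ Y → 𝒰.tgt m = 𝒰.src m' →
    hol (𝒰.mul m m') = hol m * hol m'
  eq_one : ∀ m, 𝒰.src m ∈ Y → 𝒰.tgt m ∈ Y → hol m = 1 → m = 𝒰.one (𝒰.src m)

/-- The isotropy group is finite, so its elements have disjoint neighbourhoods which can be chosen
compatible with composition; all arrows between points close to `y` lie in one of them. -/
theorem IsEtaleProper.nonempty_chart (h𝒰 : 𝒰.IsEtaleProper) (y : 𝒰.O) : Nonempty (𝒰.Chart y) := by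
  classical
  have := h𝒰.finite_isotropy y
  have hdisj : Pairwise (Function.onFun Disjoint fun γ : 𝒰.Isotropy y => 𝓝 γ.1) := fun γ δ h =>
    isSeparatedMap_iff_disjoint_nhds.1 h𝒰.isSeparatedMap _ _
      (Prod.ext (γ.2.1.trans δ.2.1.symm) (γ.2.2.trans δ.2.2.symm)) fun e => h (Subtype.ext e)
  obtain ⟨A, hA, hAd⟩ := hdisj.exists_mem_filter_of_disjoint
  have hmul : ∀ γ δ : 𝒰.Isotropy y, ∃ S ∈ 𝓝 γ.1, ∃ T ∈ 𝓝 δ.1, ∀ m ∈ S, ∀ m' ∈ T,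
      𝒰.tgt m = 𝒰.src m' → 𝒰.mul m m' ∈ A (γ * δ) := by
    intro γ δ
    have hc := continuousWithinAt_mul (t₀ := (γ.1, δ.1)) continuousAt_fst continuousAt_snd
      (Isotropy.tgt_eq_src γ δ)
    have h1 := eventually_nhdsWithin_iff.1 (hc (hA (γ * δ)))
    rw [nhds_prod_eq] at h1
    obtain ⟨S, hS, T, hT, h2⟩ := Filter.mem_prod_iff.1 h1
    exact ⟨S, hS, T, hT, fun m hm m' hm' h => h2 (Set.mk_mem_prod hm hm') h⟩
  choose S hS T hT hST using hmul
  let B : 𝒰.Isotropy y → Set 𝒰.M := fun γ =>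
    (A γ ∩ {m | γ = 1 → m = 𝒰.one (𝒰.src m)}) ∩ ((⋂ δ, S γ δ) ∩ ⋂ δ, T δ γ)
  have hB : ∀ γ, B γ ∈ 𝓝 γ.1 := by
    intro γ
    refine Filter.inter_mem (Filter.inter_mem (hA γ) ?_)
      (Filter.inter_mem (Filter.iInter_mem.2 (hS γ)) (Filter.iInter_mem.2 fun δ => hT δ γ))
    by_cases h : γ = 1
    · subst h
      filter_upwards [h𝒰.eventually_eq_one y] with m hm _ using hm
    · exact Filter.Eventually.of_forall fun m h' => absurd h' h
  obtain ⟨Y, hY, hy, H⟩ := h𝒰.exists_isOpen_forall (y := y) (p := fun m => ∃ γ, B γ ∈ 𝓝 m)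
    fun γ => (eventually_mem_nhds_iff.2 (hB γ)).mono fun m hm => ⟨γ, hm⟩
  let hol : 𝒰.M → 𝒰.Isotropy y := fun m => if h : ∃ γ, m ∈ A γ then h.choose else 1
  have hhol : ∀ {m γ}, m ∈ A γ → hol m = γ := by
    intro m γ h
    have h' : ∃ γ, m ∈ A γ := ⟨γ, h⟩
    have e : hol m = h'.choose := dif_pos h'
    rw [e]
    by_contra hne
    exact Set.disjoint_left.1 (hAd hne) h'.choose_spec h
  refine ⟨⟨Y, hY, hy, hol, fun m h h' => ?_, fun m m' h h' h'' e => ?_, fun m h h' e => ?_⟩⟩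
  · obtain ⟨γ, hγ⟩ := H m h h'
    filter_upwards [hγ] with m' hm'
    rw [hhol hm'.1.1, hhol (mem_of_mem_nhds hγ).1.1]
  · obtain ⟨γ, hγ⟩ := H m h h'
    obtain ⟨δ, hδ⟩ := H m' (e ▸ h') h''
    have hγ := mem_of_mem_nhds hγ
    have hδ := mem_of_mem_nhds hδ
    rw [hhol hγ.1.1, hhol hδ.1.1]
    exact hhol (hST γ δ m (Set.mem_iInter.1 hγ.2.1 δ) m' (Set.mem_iInter.1 hδ.2.2 γ) e)
  · obtain ⟨γ, hγ⟩ := H m h h'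
    have hγ := mem_of_mem_nhds hγ
    exact hγ.1.2 ((hhol hγ.1.1).symm.trans e)

namespace Chart

variable {y : 𝒰.O} (c : 𝒰.Chart y)

/-- The difference of two arrows to `Y` with the same source. -/
noncomputable def diff (m m' : 𝒰.M) : 𝒰.Isotropy y := c.hol (𝒰.mul (𝒰.inv m) m')

variable {c}

theorem tgt_inv_eq {m m' : 𝒰.M} (h : 𝒰.src m = 𝒰.src m') : 𝒰.tgt (𝒰.inv m) = 𝒰.src m' :=
  (𝒰.tgt_inv m).trans h

theorem src_inv_mul {m m' : 𝒰.M} (h : 𝒰.src m = 𝒰.src m') :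
    𝒰.src (𝒰.mul (𝒰.inv m) m') = 𝒰.tgt m := by
  rw [src_mul (tgt_inv_eq h), 𝒰.src_inv]

theorem tgt_inv_mul {m m' : 𝒰.M} (h : 𝒰.src m = 𝒰.src m') :
    𝒰.tgt (𝒰.mul (𝒰.inv m) m') = 𝒰.tgt m' := tgt_mul (tgt_inv_eq h)

theorem inv_mul_mul_inv_mul {m m' m'' : 𝒰.M} (h : 𝒰.src m = 𝒰.src m')
    (h' : 𝒰.src m' = 𝒰.src m'') :
    𝒰.mul (𝒰.mul (𝒰.inv m) m') (𝒰.mul (𝒰.inv m') m'') = 𝒰.mul (𝒰.inv m) m'' := by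
  rw [mul_assoc (tgt_inv_eq h) (src_inv_mul h').symm, ← mul_assoc (𝒰.src_inv m').symm
    (tgt_inv_eq h'), mul_inv, one_mul h']

theorem diff_mul_diff {m m' m'' : 𝒰.M} (h : 𝒰.src m = 𝒰.src m') (h' : 𝒰.src m' = 𝒰.src m'')
    (hm : 𝒰.tgt m ∈ c.Y) (hm' : 𝒰.tgt m' ∈ c.Y) (hm'' : 𝒰.tgt m'' ∈ c.Y) :
    c.diff m m' * c.diff m' m'' = c.diff m m'' := by
  rw [diff, diff, ← c.hol_mul _ _ (by rwa [src_inv_mul h]) (by rwa [tgt_inv_mul h])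
    (by rwa [tgt_inv_mul h']) (by rw [tgt_inv_mul h, src_inv_mul h']), inv_mul_mul_inv_mul h h',
    diff]

theorem inv_mul_mul_left {r m m' : 𝒰.M} (h : 𝒰.tgt r = 𝒰.src m) (h' : 𝒰.tgt r = 𝒰.src m') :
    𝒰.mul (𝒰.inv (𝒰.mul r m)) (𝒰.mul r m') = 𝒰.mul (𝒰.inv m) m' := by
  have e : 𝒰.mul (𝒰.inv (𝒰.mul r m)) r = 𝒰.inv m := by
    have h1 : 𝒰.tgt (𝒰.inv (𝒰.mul r m)) = 𝒰.src r := by rw [𝒰.tgt_inv, src_mul h]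
    rw [← TopGroupoid.mul_one (m := 𝒰.mul _ r) ((tgt_mul h1).trans h), ← mul_inv (m := m),
      ← mul_assoc ((tgt_mul h1).trans h) (𝒰.src_inv m).symm, mul_assoc h1 h, inv_mul,
      TopGroupoid.one_mul (by rw [𝒰.src_inv, tgt_mul h])]
  rw [← mul_assoc (by rw [𝒰.tgt_inv, src_mul h]) h', e]

theorem diff_mul_left {r m m' : 𝒰.M} (h : 𝒰.tgt r = 𝒰.src m) (h' : 𝒰.tgt r = 𝒰.src m') :
    c.diff (𝒰.mul r m) (𝒰.mul r m') = c.diff m m' := by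
  rw [diff, inv_mul_mul_left h h', diff]

theorem eq_of_diff_eq_one {m m' : 𝒰.M} (h : 𝒰.src m = 𝒰.src m') (hm : 𝒰.tgt m ∈ c.Y)
    (hm' : 𝒰.tgt m' ∈ c.Y) (e : c.diff m m' = 1) : m = m' := by
  have e := c.eq_one _ (by rwa [src_inv_mul h]) (by rwa [tgt_inv_mul h]) e
  rw [src_inv_mul h] at e
  have := congrArg (𝒰.mul m) e
  rw [TopGroupoid.mul_one rfl, ← mul_assoc (𝒰.src_inv m).symm (tgt_inv_eq h), mul_inv,
    one_mul h] at this
  exact this.symm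

theorem diff_eventually {D : Type*} [TopologicalSpace D] {t₀ : D} {m m' : D → 𝒰.M}
    (hm : ContinuousAt m t₀) (hm' : ContinuousAt m' t₀) (h₀ : 𝒰.src (m t₀) = 𝒰.src (m' t₀))
    (h : 𝒰.tgt (m t₀) ∈ c.Y) (h' : 𝒰.tgt (m' t₀) ∈ c.Y) :
    ∀ᶠ t in 𝓝 t₀, 𝒰.src (m t) = 𝒰.src (m' t) → c.diff (m t) (m' t) = c.diff (m t₀) (m' t₀) := by
  have hc := continuousWithinAt_mul (𝒰.continuous_inv.continuousAt.comp hm) hm' (tgt_inv_eq h₀)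
  have h1 := eventually_nhdsWithin_iff.1 (hc.eventually
    (c.hol_eventually _ ((src_inv_mul h₀).symm ▸ h) ((tgt_inv_mul h₀).symm ▸ h')))
  filter_upwards [h1] with t ht e using ht (tgt_inv_eq e)

end Chart

end TopGroupoid

/-! ### Local models -/

namespace TopGroupoid

variable {𝒰 : TopGroupoid.{u}}

/-- A common model, near a point, for the charts `𝒞 i`, `i ∈ I`: an open set `W` with sections `e i`
of frames, such that all arrows between points of `W` are seen by the charts, simultaneously,
through the embeddings `κ i` of a single group `G`. -/
structure LocalModel (𝒞 : ∀ i, 𝒰.Chart i) (I : Set 𝒰.O) where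
  W : Set 𝒰.O
  isOpen_W : IsOpen W
  G : Type u
  [group : Group G]
  e : 𝒰.O → 𝒰.O → 𝒰.M
  src_e : ∀ i ∈ I, ∀ z ∈ W, 𝒰.src (e i z) = z
  tgt_e : ∀ i ∈ I, ∀ z ∈ W, 𝒰.tgt (e i z) ∈ (𝒞 i).Y
  continuousAt_e : ∀ i ∈ I, ∀ z ∈ W, ContinuousAt (e i) z
  κ : ∀ i, G → 𝒰.Isotropy i
  κ_mul : ∀ i ∈ I, ∀ γ δ, κ i (γ * δ) = κ i γ * κ i δ
  eq_one_of_κ : ∀ i ∈ I, ∀ γ, κ i γ = 1 → γ = 1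
  exists_diff_eq : ∀ r, 𝒰.src r ∈ W → 𝒰.tgt r ∈ W →
    ∃ γ, ∀ i ∈ I, (𝒞 i).diff (e i (𝒰.src r)) (𝒰.mul r (e i (𝒰.tgt r))) = κ i γ

attribute [instance] LocalModel.group

/-- The isotropy group of `x` provides a local model at `x`. -/
theorem IsEtaleProper.exists_localModel (h𝒰 : 𝒰.IsEtaleProper) (𝒞 : ∀ i, 𝒰.Chart i)
    {I : Set 𝒰.O} (hI : I.Finite) {x : 𝒰.O}
    (hm : ∀ i ∈ I, ∃ m, 𝒰.src m = x ∧ 𝒰.tgt m ∈ (𝒞 i).Y) {N : Set 𝒰.O} (hN : N ∈ 𝓝 x) :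
    ∃ L : LocalModel 𝒞 I, x ∈ L.W ∧ L.W ⊆ N := by
  have : Nonempty 𝒰.M := ⟨𝒰.one x⟩
  choose! m hmx hmY using hm
  have hsec : ∀ i ∈ I, ∃ e : 𝒰.O → 𝒰.M, e x = m i ∧ ContinuousAt e x ∧
      ∀ᶠ z in 𝓝 x, 𝒰.src (e z) = z ∧ ContinuousAt e z := by
    intro i hi
    rw [← hmx i hi]
    exact h𝒰.exists_section (m i)
  choose! e hem hec hes using hsec
  have hsrc : ∀ γ : 𝒰.Isotropy x, ∀ i ∈ I, 𝒰.tgt γ.1 = 𝒰.src (m i) := fun γ i hi =>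
    γ.2.2.trans (hmx i hi).symm
  have hY : ∀ γ : 𝒰.Isotropy x, ∀ i ∈ I, 𝒰.tgt (𝒰.mul γ.1 (m i)) ∈ (𝒞 i).Y := fun γ i hi =>
    (tgt_mul (hsrc γ i hi)).symm ▸ hmY i hi
  have hgood : ∀ᶠ z in 𝓝 x, ∀ i ∈ I, 𝒰.src (e i z) = z ∧ ContinuousAt (e i) z ∧
      𝒰.tgt (e i z) ∈ (𝒞 i).Y := by
    refine (Filter.eventually_all_finite hI).2 fun i hi => ?_
    have ht : ∀ᶠ z in 𝓝 x, 𝒰.tgt (e i z) ∈ (𝒞 i).Y :=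
      (𝒰.continuous_tgt.continuousAt.comp (hec i hi)).eventually_mem
        ((𝒞 i).isOpen_Y.mem_nhds (by rw [Function.comp_apply, hem i hi]; exact hmY i hi))
    filter_upwards [hes i hi, ht] with z h h'
    exact ⟨h.1, h.2, h'⟩
  obtain ⟨W₁, hW₁, hxW₁, H⟩ := h𝒰.exists_isOpen_forall (y := x) (p := fun r =>
    ∃ γ : 𝒰.Isotropy x, ∀ i ∈ I, (𝒞 i).diff (e i (𝒰.src r)) (𝒰.mul r (e i (𝒰.tgt r))) =
      (𝒞 i).diff (m i) (𝒰.mul γ.1 (m i))) (by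
    intro γ
    have h1 : ∀ᶠ r in 𝓝 γ.1, ∀ i ∈ I,
        (𝒞 i).diff (e i (𝒰.src r)) (𝒰.mul r (e i (𝒰.tgt r))) =
          (𝒞 i).diff (m i) (𝒰.mul γ.1 (m i)) := by
      refine (Filter.eventually_all_finite hI).2 fun i hi => ?_
      have hs : ContinuousAt (fun r => e i (𝒰.src r)) γ.1 :=
        ContinuousAt.comp (by rw [γ.2.1]; exact hec i hi) 𝒰.continuous_src.continuousAt
      have ht : ContinuousAt (fun r => e i (𝒰.tgt r)) γ.1 :=
        ContinuousAt.comp (by rw [γ.2.2]; exact hec i hi) 𝒰.continuous_tgt.continuousAt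
      have es : ∀ᶠ r in 𝓝 γ.1, 𝒰.src (e i (𝒰.src r)) = 𝒰.src r :=
        𝒰.continuous_src.continuousAt.eventually
          (by rw [γ.2.1]; exact (hes i hi).mono fun z hz => hz.1)
      have et : ∀ᶠ r in 𝓝 γ.1, 𝒰.tgt r = 𝒰.src (e i (𝒰.tgt r)) :=
        𝒰.continuous_tgt.continuousAt.eventually (p := fun z => z = 𝒰.src (e i z))
          (by rw [γ.2.2]; exact (hes i hi).mono fun z hz => hz.1.symm)
      have e1 : e i (𝒰.src γ.1) = m i := by rw [γ.2.1, hem i hi]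
      have e2 : e i (𝒰.tgt γ.1) = m i := by rw [γ.2.2, hem i hi]
      have h2 := (𝒞 i).diff_eventually hs (continuousAt_mul continuousAt_id ht et)
        (by
          change 𝒰.src (e i (𝒰.src γ.1)) = 𝒰.src (𝒰.mul γ.1 (e i (𝒰.tgt γ.1)))
          rw [e1, e2, src_mul (hsrc γ i hi), γ.2.1, hmx i hi])
        (by rw [e1]; exact hmY i hi)
        (by
          change 𝒰.tgt (𝒰.mul γ.1 (e i (𝒰.tgt γ.1))) ∈ _
          rw [e2]; exact hY γ i hi)
      filter_upwards [h2, es, et] with r h3 h4 h5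
      refine (h3 ?_).trans ?_
      · exact h4.trans (src_mul h5).symm
      · change (𝒞 i).diff (e i (𝒰.src γ.1)) (𝒰.mul γ.1 (e i (𝒰.tgt γ.1))) = _
        rw [e1, e2]
    exact h1.mono fun r h => ⟨γ, h⟩)
  obtain ⟨W₂, hW₂, hW₂o, hxW₂⟩ := mem_nhds_iff.1 (hgood.and hN)
  refine ⟨⟨W₁ ∩ W₂, hW₁.inter hW₂o, 𝒰.Isotropy x, e, fun i hi z hz => ((hW₂ hz.2).1 i hi).1,
    fun i hi z hz => ((hW₂ hz.2).1 i hi).2.2, fun i hi z hz => ((hW₂ hz.2).1 i hi).2.1,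
    fun i γ => (𝒞 i).diff (m i) (𝒰.mul γ.1 (m i)), fun i hi γ δ => ?_, fun i hi γ h => ?_,
    fun r h h' => H r h.1 h'.1⟩, ⟨hxW₁, hxW₂⟩, fun z hz => (hW₂ hz.2).2⟩
  · rw [Isotropy.coe_mul, mul_assoc (Isotropy.tgt_eq_src γ δ) (hsrc δ i hi),
      ← (𝒞 i).diff_mul_left (r := γ.1) (m := m i) (m' := 𝒰.mul δ.1 (m i)) (hsrc γ i hi)
        ((Isotropy.tgt_eq_src γ δ).trans (src_mul (hsrc δ i hi)).symm)]
    refine (Chart.diff_mul_diff ?_ ?_ (hmY i hi) (hY γ i hi) ?_).symm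
    · rw [src_mul (hsrc γ i hi), γ.2.1, hmx i hi]
    · rw [src_mul (hsrc γ i hi), src_mul]
      exact (Isotropy.tgt_eq_src γ δ).trans (src_mul (hsrc δ i hi)).symm
    · rw [tgt_mul ((Isotropy.tgt_eq_src γ δ).trans (src_mul (hsrc δ i hi)).symm)]
      exact hY δ i hi
  · have e := Chart.eq_of_diff_eq_one
      (by rw [src_mul (hsrc γ i hi), γ.2.1, hmx i hi]) (hmY i hi) (hY γ i hi) h
    refine Subtype.ext ?_
    have : 𝒰.mul (m i) (𝒰.inv (m i)) = 𝒰.mul (𝒰.mul γ.1 (m i)) (𝒰.inv (m i)) :=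
      congrArg (fun r => 𝒰.mul r (𝒰.inv (m i))) e
    rw [mul_inv, mul_assoc (hsrc γ i hi) (𝒰.src_inv _).symm, mul_inv,
      mul_one (hsrc γ i hi), hmx i hi] at this
    exact this.symm

namespace LocalModel

variable {𝒞 : ∀ i, 𝒰.Chart i} {I : Set 𝒰.O} (L : LocalModel 𝒞 I)

/-- The section `e i` transported along the arrow `d`. -/
noncomputable def frame (i : 𝒰.O) (d : 𝒰.M) : 𝒰.M := 𝒰.mul d (L.e i (𝒰.tgt d))

variable {L}

section

variable {i : 𝒰.O} (hi : i ∈ I) {d : 𝒰.M} (hd : 𝒰.tgt d ∈ L.W)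
include hi hd

theorem tgt_eq_src_e : 𝒰.tgt d = 𝒰.src (L.e i (𝒰.tgt d)) := (L.src_e i hi _ hd).symm

theorem src_frame : 𝒰.src (L.frame i d) = 𝒰.src d := src_mul (tgt_eq_src_e hi hd)

theorem tgt_frame : 𝒰.tgt (L.frame i d) ∈ (𝒞 i).Y := by
  rw [frame, tgt_mul (tgt_eq_src_e hi hd)]
  exact L.tgt_e i hi _ hd

theorem frame_mul {r : 𝒰.M} (hr : 𝒰.tgt r = 𝒰.src d) :
    L.frame i (𝒰.mul r d) = 𝒰.mul r (L.frame i d) := by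
  rw [frame, frame, tgt_mul hr, mul_assoc hr (tgt_eq_src_e hi hd)]

end

theorem exists_diff_frame {d d' : 𝒰.M} (h : 𝒰.src d = 𝒰.src d') (hd : 𝒰.tgt d ∈ L.W)
    (hd' : 𝒰.tgt d' ∈ L.W) :
    ∃ γ, ∀ i ∈ I, (𝒞 i).diff (L.frame i d) (L.frame i d') = L.κ i γ := by
  have hs := Chart.src_inv_mul h
  have ht := Chart.tgt_inv_mul h
  obtain ⟨γ, hγ⟩ := L.exists_diff_eq (𝒰.mul (𝒰.inv d) d') (hs ▸ hd) (ht ▸ hd')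
  refine ⟨γ, fun i hi => (hγ i hi).symm.trans ?_ |>.symm⟩
  rw [hs, ht]
  rw [← (𝒞 i).diff_mul_left (r := d) (tgt_eq_src_e hi hd)]
  · rw [← mul_assoc hs.symm (ht.trans (tgt_eq_src_e hi hd')),
      ← mul_assoc (𝒰.src_inv d).symm (Chart.tgt_inv_eq h), mul_inv, one_mul h]
    rfl
  · rw [src_mul (ht.trans (tgt_eq_src_e hi hd')), hs]

variable (L)

/-- The relative position of frames `m` and `m'`: the pairs of differences from the frames of the
local model, transported along an arrow `d` to `W`, to `m` and `m'`, translated by elements of the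
group of the local model. -/
def rel (i j : 𝒰.O) (m m' : 𝒰.M) : Set (𝒰.Isotropy i × 𝒰.Isotropy j) :=
  {w | ∃ d, 𝒰.src d = 𝒰.src m ∧ 𝒰.tgt d ∈ L.W ∧ ∃ γ,
    w.1 = L.κ i γ * (𝒞 i).diff (L.frame i d) m ∧ w.2 = L.κ j γ * (𝒞 j).diff (L.frame j d) m'}

variable {L}

section

variable {i j : 𝒰.O} (hi : i ∈ I) (hj : j ∈ I) {m m' : 𝒰.M} (h : 𝒰.src m = 𝒰.src m')
  (hm : 𝒰.tgt m ∈ (𝒞 i).Y) (hm' : 𝒰.tgt m' ∈ (𝒞 j).Y)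
include hi hj h hm hm'

/-- The relative position can be computed with any arrow to `W`, since two of these differ by an
element of the group of the local model. -/
theorem mem_rel_iff_of_frame {d : 𝒰.M} (hs : 𝒰.src d = 𝒰.src m) (hd : 𝒰.tgt d ∈ L.W)
    {w : 𝒰.Isotropy i × 𝒰.Isotropy j} : w ∈ L.rel i j m m' ↔ ∃ γ,
      w.1 = L.κ i γ * (𝒞 i).diff (L.frame i d) m ∧
      w.2 = L.κ j γ * (𝒞 j).diff (L.frame j d) m' := by
  refine ⟨?_, fun H => ⟨d, hs, hd, H⟩⟩
  rintro ⟨d', hs', hd', γ, h1, h2⟩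
  obtain ⟨δ, hδ⟩ := exists_diff_frame (hs'.trans hs.symm) hd' hd
  refine ⟨γ * δ, ?_, ?_⟩
  · rw [L.κ_mul i hi, ← hδ i hi, _root_.mul_assoc, Chart.diff_mul_diff, h1]
    · rw [src_frame hi hd', src_frame hi hd, hs', hs]
    · rw [src_frame hi hd, hs]
    · exact tgt_frame hi hd'
    · exact tgt_frame hi hd
    · exact hm
  · rw [L.κ_mul j hj, ← hδ j hj, _root_.mul_assoc, Chart.diff_mul_diff, h2]
    · rw [src_frame hj hd', src_frame hj hd, hs', hs]
    · rw [src_frame hj hd, hs, h]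
    · exact tgt_frame hj hd'
    · exact tgt_frame hj hd
    · exact hm'

theorem rel_mul_left {d : 𝒰.M} (hs : 𝒰.src d = 𝒰.src m) (hd : 𝒰.tgt d ∈ L.W) {r : 𝒰.M}
    (hr : 𝒰.tgt r = 𝒰.src m) :
    L.rel i j (𝒰.mul r m) (𝒰.mul r m') = L.rel i j m m' := by
  ext w
  have hrd := hr.trans hs.symm
  rw [mem_rel_iff_of_frame hi hj h hm hm' hs hd,
    mem_rel_iff_of_frame hi hj (d := 𝒰.mul r d) (by rw [src_mul hr, src_mul (hr.trans h)])
      (by rwa [tgt_mul hr]) (by rwa [tgt_mul (hr.trans h)]) (by rw [src_mul hr, src_mul hrd])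
      (by rwa [tgt_mul hrd]), frame_mul hi hd hrd, frame_mul hj hd hrd,
    Chart.diff_mul_left (hrd.trans (src_frame hi hd).symm) hr,
    Chart.diff_mul_left (hrd.trans (src_frame hj hd).symm) (hr.trans h)]

theorem mem_rel_iff {d : 𝒰.M} (hs : 𝒰.src d = 𝒰.src m) (hd : 𝒰.tgt d ∈ L.W) {n n' : 𝒰.M}
    (hn : 𝒰.src n = 𝒰.src m) (hn' : 𝒰.src n' = 𝒰.src m) (hnY : 𝒰.tgt n ∈ (𝒞 i).Y)
    (hnY' : 𝒰.tgt n' ∈ (𝒞 j).Y) (w : 𝒰.Isotropy i × 𝒰.Isotropy j) :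
    w ∈ L.rel i j n n' ↔ (w.1 * (𝒞 i).diff n m, w.2 * (𝒞 j).diff n' m') ∈ L.rel i j m m' := by
  rw [mem_rel_iff_of_frame hi hj h hm hm' hs hd,
    mem_rel_iff_of_frame hi hj (hn.trans hn'.symm) hnY hnY' (hs.trans hn.symm) hd]
  refine exists_congr fun γ => ?_
  rw [← Chart.diff_mul_diff (c := 𝒞 i) (m := L.frame i d) (m' := n) (m'' := m)
      ((src_frame hi hd).trans (hs.trans hn.symm)) hn (tgt_frame hi hd) hnY hm,
    ← Chart.diff_mul_diff (c := 𝒞 j) (m := L.frame j d) (m' := n') (m'' := m')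
      ((src_frame hj hd).trans (hs.trans hn'.symm)) (hn'.trans h) (tgt_frame hj hd) hnY' hm',
    ← _root_.mul_assoc, ← _root_.mul_assoc, mul_left_inj, mul_left_inj]

theorem eq_one_of_rel {d : 𝒰.M} (hs : 𝒰.src d = 𝒰.src m) (hd : 𝒰.tgt d ∈ L.W)
    {k : 𝒰.Isotropy j}
    (H : ∀ w : 𝒰.Isotropy i × 𝒰.Isotropy j, (w.1, w.2 * k) ∈ L.rel i j m m' ↔
      w ∈ L.rel i j m m') : k = 1 := by
  have hκ : ∀ l ∈ I, L.κ l 1 = 1 := fun l hl => by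
    have := L.κ_mul l hl 1 1
    rwa [_root_.mul_one, left_eq_mul] at this
  have h1 : ((𝒞 i).diff (L.frame i d) m, (𝒞 j).diff (L.frame j d) m') ∈ L.rel i j m m' :=
    ⟨d, hs, hd, 1, by rw [hκ i hi, _root_.one_mul], by rw [hκ j hj, _root_.one_mul]⟩
  obtain ⟨γ, h2, h3⟩ := (mem_rel_iff_of_frame hi hj h hm hm' hs hd).1 ((H _).2 h1)
  obtain rfl := L.eq_one_of_κ i hi γ (right_eq_mul.1 h2)
  simpa [hκ j hj] using h3

theorem rel_eventually (h𝒰 : 𝒰.IsEtaleProper) {d : 𝒰.M} (hs : 𝒰.src d = 𝒰.src m)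
    (hd : 𝒰.tgt d ∈ L.W) :
    ∀ᶠ n in 𝓝 (m, m'), 𝒰.src n.1 = 𝒰.src n.2 → L.rel i j n.1 n.2 = L.rel i j m m' := by
  obtain ⟨e, he, hec, hes⟩ := h𝒰.exists_section d
  rw [hs] at he hec hes
  have c1 : ContinuousAt (fun n : 𝒰.M × 𝒰.M => e (𝒰.src n.1)) (m, m') :=
    ContinuousAt.comp (g := e) (f := fun n : 𝒰.M × 𝒰.M => 𝒰.src n.1) hec
      (𝒰.continuous_src.comp continuous_fst).continuousAt
  have c2 : Filter.Tendsto (fun n : 𝒰.M × 𝒰.M => 𝒰.src n.1) (𝓝 (m, m')) (𝓝 (𝒰.src m)) :=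
    (𝒰.continuous_src.comp continuous_fst).continuousAt
  have hW : ∀ᶠ n in 𝓝 (m, m'), 𝒰.tgt (e (𝒰.src n.1)) ∈ L.W :=
    (𝒰.continuous_tgt.continuousAt.comp c1).eventually_mem
      (L.isOpen_W.mem_nhds (by rw [Function.comp_apply, he]; exact hd))
  have hsrc : ∀ᶠ n in 𝓝 (m, m'), 𝒰.src (e (𝒰.src n.1)) = 𝒰.src n.1 :=
    c2.eventually (hes.mono fun z hz => hz.1)
  have hframe : ∀ l ∈ I, ContinuousAt (fun n : 𝒰.M × 𝒰.M => L.frame l (e (𝒰.src n.1))) (m, m') := by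
    intro l hl
    refine continuousAt_mul c1 (ContinuousAt.comp (g := L.e l)
      (f := fun n : 𝒰.M × 𝒰.M => 𝒰.tgt (e (𝒰.src n.1))) ?_
        (𝒰.continuous_tgt.continuousAt.comp c1)) (hW.mono fun n hn => tgt_eq_src_e hl hn)
    refine L.continuousAt_e l hl _ ?_
    rw [he]
    exact hd
  have hY : ∀ᶠ n in 𝓝 (m, m'), 𝒰.tgt n.1 ∈ (𝒞 i).Y ∧ 𝒰.tgt n.2 ∈ (𝒞 j).Y :=
    (((𝒞 i).isOpen_Y.preimage (𝒰.continuous_tgt.comp continuous_fst)).eventually_mem hm).and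
      (((𝒞 j).isOpen_Y.preimage (𝒰.continuous_tgt.comp continuous_snd)).eventually_mem hm')
  have e1 := Chart.diff_eventually (c := 𝒞 i) (hframe i hi) continuousAt_fst
    (by simp only [he]; rw [src_frame hi hd, hs]) (by simp only [he]; exact tgt_frame hi hd) hm
  have e2 := Chart.diff_eventually (c := 𝒞 j) (hframe j hj) continuousAt_snd
    (by simp only [he]; rw [src_frame hj hd, hs, h]) (by simp only [he]; exact tgt_frame hj hd) hm'
  filter_upwards [hW, hsrc, hY, e1, e2] with n h1 h2 h3 h4 h5 h6
  ext w
  rw [mem_rel_iff_of_frame hi hj h hm hm' hs hd,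
    mem_rel_iff_of_frame hi hj h6 h3.1 h3.2 h2 h1, h4 ((src_frame hi h1).trans h2),
    h5 ((src_frame hj h1).trans (h2.trans h6))]
  simp only [he]

end

end LocalModel

end TopGroupoid

/-! ### Construction of framed covers -/

open TopGroupoid

variable {𝒰 : TopGroupoid.{u}}

open Classical in
/-- The framed cover given by a partition of unity `f` on the quotient, charts `i a` and local
models `L a` over the members `t a` of the cover. The relative positions of frames of `a` and `b`
are those defined by the local model `L a`. -/
noncomputable def FramedCover.ofLocalModels (h𝒰 : 𝒰.IsEtaleProper) {Q : Type v} [TopologicalSpace Q]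
    {q : 𝒰.O → Q} (hqc : Continuous q) (hq : ∀ m, q (𝒰.src m) = q (𝒰.tgt m))
    (𝒞 : ∀ i, 𝒰.Chart i) {β : Type u} {t : β → Set Q} (ht : ∀ a, IsOpen (t a)) (i : β → 𝒰.O)
    {I : β → Set 𝒰.O} (hI : ∀ a b y, q y ∈ t a → q y ∈ t b → i b ∈ I a)
    (L : ∀ a, LocalModel 𝒞 (I a)) (hW : ∀ a y, q y ∈ t a → ∃ d, 𝒰.src d = y ∧ 𝒰.tgt d ∈ (L a).W)
    (hY : ∀ a y, q y ∈ t a → ∃ m, 𝒰.src m = y ∧ 𝒰.tgt m ∈ (𝒞 (i a)).Y)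
    (f : PartitionOfUnity β Q) (hf : f.IsSubordinate t) : FramedCover 𝒰 where
  A := β
  Γ a := 𝒰.Isotropy (i a)
  Y a := (𝒞 (i a)).Y ∩ q ⁻¹' t a
  isOpen_Y a := (𝒞 (i a)).isOpen_Y.inter ((ht a).preimage hqc)
  lam a := (𝒞 (i a)).diff
  lam_mul_lam a m m' m'' h h' hm hm' hm'' := Chart.diff_mul_diff h h' hm.1 hm'.1 hm''.1
  lam_mul_left a r m m' h h' _ _ := Chart.diff_mul_left h h'
  lam_eventually a m₀ m₀' h hm hm' :=
    Chart.diff_eventually continuousAt_fst continuousAt_snd h hm.1 hm'.1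
  eq_of_lam_eq_one a m m' h hm hm' e := Chart.eq_of_diff_eq_one h hm.1 hm'.1 e
  rel a b m m' := if a = b then Set.univ else (L a).rel (i a) (i b) m m'
  rel_self a m := if_pos rfl
  rel_mul_left a b r m m' hr hr' hm hm' := by
    by_cases hab : a = b
    · rw [if_pos hab, if_pos hab]
    · have h := hr.symm.trans hr'
      have ha : q (𝒰.src m) ∈ t a := hq m ▸ hm.2
      obtain ⟨d, hs, hd⟩ := hW a _ ha
      rw [if_neg hab, if_neg hab]
      exact LocalModel.rel_mul_left (hI a a _ ha ha) (hI a b _ ha (h ▸ hq m' ▸ hm'.2)) h hm.1 hm'.1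
        hs hd hr
  rel_eventually a b m m' h hm hm' := by
    by_cases hab : a = b
    · exact Filter.Eventually.of_forall fun n _ => (if_pos hab).trans (if_pos hab).symm
    · have ha : q (𝒰.src m) ∈ t a := hq m ▸ hm.2
      obtain ⟨d, hs, hd⟩ := hW a _ ha
      simp only [if_neg hab]
      exact LocalModel.rel_eventually (hI a a _ ha ha) (hI a b _ ha (h ▸ hq m' ▸ hm'.2)) h hm.1
        hm'.1 h𝒰 hs hd
  mem_rel_iff a b m n m' n' h h' h'' hm hn hm' hn' w := by
    by_cases hab : a = b
    · simp only [if_pos hab, Set.mem_univ]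
    · have ha : q (𝒰.src m) ∈ t a := hq m ▸ hm.2
      obtain ⟨d, hs, hd⟩ := hW a _ ha
      simp only [if_neg hab]
      exact LocalModel.mem_rel_iff (hI a a _ ha ha) (hI a b _ ha (h ▸ hq n ▸ hn.2)) h hm.1
        hn.1 hs hd h' h'' hm'.1 hn'.1 w
  rel_free a b hab m m' h hm hm' k H := by
    have ha : q (𝒰.src m) ∈ t a := hq m ▸ hm.2
    obtain ⟨d, hs, hd⟩ := hW a _ ha
    simp only [if_neg hab] at H
    exact LocalModel.eq_one_of_rel (hI a a _ ha ha) (hI a b _ ha (h ▸ hq m' ▸ hm'.2)) h hm.1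
      hm'.1 hs hd H
  φ a y := f a (q y)
  continuous_φ a := (f a).continuous.comp hqc
  φ_nonneg a y := f.nonneg a _
  φ_invariant a r := by rw [hq]
  locallyFinite := f.locallyFinite.preimage_continuous hqc
  sum_φ y := f.sum_eq_one (Set.mem_univ _)
  exists_frame a y h := by
    have hy : q y ∈ t a := hf a (tsupport_comp_subset_preimage (f a) hqc h)
    obtain ⟨m, hm, hmY⟩ := hY a y hy
    refine ⟨m, hm, hmY, ?_⟩
    rw [← hm, hq m] at hy
    exact hy

/-- Over a paracompact quotient, every sufficiently fine locally finite cover underlies a framed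
cover. Charts `𝒞 i` are used over the members of a locally finite cover `V`; over the sets `s x`,
all charts which are close to `x` have a common local model. -/
theorem TopGroupoid.IsEtaleProper.exists_framedCover (h𝒰 : 𝒰.IsEtaleProper)
    {Q : Type v} [TopologicalSpace Q] [ParacompactSpace Q] {q : 𝒰.O → Q} (hq : IsOpenQuotientMap q)
    (hrel : ∀ y y', q y = q y' ↔ ∃ m, 𝒰.src m = y ∧ 𝒰.tgt m = y') :
    ∃ s : 𝒰.O → Set Q, (∀ x, IsOpen (s x)) ∧ ⋃ x, s x = Set.univ ∧
      ∀ (β : Type u) (t : β → Set Q), IsLocallyFiniteRefinement s t →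
        ∃ 𝓕 : FramedCover 𝒰, (∀ a, ∃ y, Nonempty (𝓕.Γ a ≃* 𝒰.Isotropy y)) ∧
          ∀ d, NerveDimLE t d → ∀ σ y m, 𝓕.IsFrame σ y m → σ.card ≤ d + 1 := by
  have hqm : ∀ m, q (𝒰.src m) = q (𝒰.tgt m) := fun m => (hrel _ _).2 ⟨m, rfl, rfl⟩
  -- The equivalence relation of the open map `q` is the range of the closed map `(src, tgt)`.
  have : T2Space Q := by
    rw [t2Space_iff_of_isOpenQuotientMap hq]
    convert h𝒰.isProperMap.isClosedMap.isClosed_range using 1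
    ext ⟨y, y'⟩
    simp [hrel, Prod.ext_iff]
  have 𝒞 : ∀ i, 𝒰.Chart i := fun i => (h𝒰.nonempty_chart i).some
  have hcover : ⋃ i, q '' (𝒞 i).Y = Set.univ := by
    refine Set.eq_univ_of_forall fun p => ?_
    obtain ⟨y, rfl⟩ := hq.surjective p
    exact Set.mem_iUnion.2 ⟨y, y, (𝒞 y).mem_Y, rfl⟩
  obtain ⟨U, hUo, hU, hUf, hUY⟩ := precise_refinement (fun i => q '' (𝒞 i).Y)
    (fun i => hq.isOpenMap _ (𝒞 i).isOpen_Y) hcover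
  obtain ⟨V, hV, hVo, hVU⟩ := exists_iUnion_eq_closure_subset hUo hUf.point_finite hU
  have hVf : LocallyFinite fun i => closure (V i) := hUf.subset hVU
  have hframe : ∀ i y, q y ∈ closure (V i) → ∃ m, 𝒰.src m = y ∧ 𝒰.tgt m ∈ (𝒞 i).Y := by
    intro i y hy
    obtain ⟨z, hz, e⟩ := hUY i (hVU i hy)
    obtain ⟨m, hm, rfl⟩ := (hrel _ _).1 e.symm
    exact ⟨m, hm, hz⟩
  choose i hi using fun x => Set.mem_iUnion.1 (hV ▸ Set.mem_univ (q x) : q x ∈ ⋃ i, V i)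
  have hN : ∀ x, {z | q z ∈ V (i x) ∧ ∀ j, q z ∈ closure (V j) → q x ∈ closure (V j)} ∈ 𝓝 x := by
    intro x
    refine Filter.inter_mem (hq.continuous.continuousAt ((hVo _).mem_nhds (hi x))) ?_
    exact hq.continuous.continuousAt (hVf.eventually_subset (fun _ => isClosed_closure) (q x))
  -- The set of the `j` with `q x` in the closure of `V j` also contains all charts used near `x`.
  choose L hxL hL using fun x => h𝒰.exists_localModel 𝒞 (I := {j | q x ∈ closure (V j)})
    (hVf.point_finite (q x)) (fun j hj => hframe j x hj) (hN x)
  refine ⟨fun x => q '' (L x).W, fun x => hq.isOpenMap _ (L x).isOpen_W, ?_, fun β t ht => ?_⟩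
  · refine Set.eq_univ_of_forall fun p => ?_
    obtain ⟨y, rfl⟩ := hq.surjective p
    exact Set.mem_iUnion.2 ⟨y, y, hxL y, rfl⟩
  choose x hx using ht.refines
  have htV : ∀ a, t a ⊆ V (i (x a)) := fun a p hp => by
    obtain ⟨z, hz, rfl⟩ := hx a hp
    exact (hL _ hz).1
  obtain ⟨f, hf⟩ := PartitionOfUnity.exists_isSubordinate_of_locallyFinite isClosed_univ t
    ht.isOpen ht.locallyFinite ht.cover.ge
  refine ⟨FramedCover.ofLocalModels h𝒰 hq.continuous hqm 𝒞 ht.isOpen (fun a => i (x a))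
    (fun a b y ha hb => ?_) (fun a => L (x a)) (fun a y ha => ?_)
    (fun a y ha => hframe _ y (subset_closure (htV a ha))) f hf,
    fun a => ⟨i (x a), ⟨MulEquiv.refl _⟩⟩, fun d hd σ y m hm => hd σ ⟨q y, ?_⟩⟩
  · obtain ⟨z, hz, e⟩ := hx a ha
    refine (hL _ hz).2 _ ?_
    rw [e]
    exact subset_closure (htV b hb)
  · obtain ⟨z, hz, e⟩ := hx a ha
    obtain ⟨m, hm, rfl⟩ := (hrel _ _).1 e.symm
    exact ⟨m, hm, hz⟩
  · refine Set.mem_iInter₂.2 fun a ha => ?_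
    obtain ⟨hs, -, h⟩ := hm a ha
    rw [← hs, hqm]
    exact h

/-! ### Isotropy groups of presented stacks -/

namespace TopPrestack.Presentation

variable {X : TopPrestack.{u}} [∀ T : TopCat.{u}, IsGroupoid (X.Fib T)] {P : X.Presentation}

theorem nonempty_isotropy_mulEquiv (y : P.groupoid.O) :
    Nonempty (P.groupoid.Isotropy y ≃* Aut (X.fibreAt P.x y)) := by
  let F : Aut (X.fibreAt P.x y) → P.groupoid.Isotropy y := fun α =>
    ⟨P.ofHom α.inv, p_ofHom _, q_ofHom _⟩
  refine ⟨(MulEquiv.ofBijective (MonoidHom.mk' F fun α β => Subtype.ext ?_)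
    ⟨fun α β h => ?_, fun γ => ?_⟩).symm⟩
  · have h := TopGroupoid.Isotropy.tgt_eq_src (F α) (F β)
    refine Eq.trans ?_ (TopGroupoid.mul_eq h).symm
    exact (ofHom_arr_comp_arr rfl rfl h).symm
  · exact Iso.ext_inv (ofHom_injective (congrArg Subtype.val h))
  · exact ⟨(asIso (P.arr γ.1 y y γ.2.1 γ.2.2)).symm, Subtype.ext (ofHom_arr _ γ.2.1 γ.2.2)⟩

end TopPrestack.Presentation

/-! ### Refinements indexed by small types -/

/-- On a small space, a refinement can be indexed by a small type, by discarding repetitions. -/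
theorem IsLocallyFiniteRefinement.exists_small.{w, w'} {S : Type v} [TopologicalSpace S]
    [Small.{u} S] {α : Type w} {β : Type w'} {s : α → Set S} {t : β → Set S}
    (h : IsLocallyFiniteRefinement s t) :
    ∃ (β' : Type u) (t' : β' → Set S), IsLocallyFiniteRefinement s t' ∧
      ∀ d, NerveDimLE t d → NerveDimLE t' d := by
  have : Small.{u} (Set.range t) := small_subset (Set.subset_univ _)
  let β' := Shrink.{u} (Set.range t)
  let g : β' → β := fun b => ((equivShrink (Set.range t)).symm b).2.choose
  have hg : ∀ b, t (g b) = ((equivShrink (Set.range t)).symm b).1 := fun b =>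
    ((equivShrink (Set.range t)).symm b).2.choose_spec
  have hinj : Function.Injective g := fun b b' e =>
    (equivShrink (Set.range t)).symm.injective
      (Subtype.ext ((hg b).symm.trans ((congrArg t e).trans (hg b'))))
  refine ⟨β', t ∘ g, ⟨fun b => h.isOpen _, ?_, h.locallyFinite.comp_injective hinj,
    fun b => h.refines _⟩, fun d hd I hI => ?_⟩
  · refine Set.eq_univ_of_forall fun p => ?_
    obtain ⟨b, hb⟩ := Set.mem_iUnion.1 (h.cover ▸ Set.mem_univ p : p ∈ ⋃ b, t b)
    refine Set.mem_iUnion.2 ⟨equivShrink _ ⟨t b, b, rfl⟩, ?_⟩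
    rw [Function.comp_apply, hg, Equiv.symm_apply_apply]
    exact hb
  · rw [← Finset.card_map ⟨g, hinj⟩]
    refine hd _ ?_
    simpa using hI

/-! ### Maps from orbispaces to complexes of groups -/

/-- A fine enough cover of the coarse space gives a map to a complex of groups. -/
theorem TopPrestack.IsOrbispace.exists_cover {X : TopPrestack.{u}} (hX : X.IsOrbispace)
    [ParacompactSpace X.Coarse] :
    ∃ (α : Type u) (s : α → Set X.Coarse), (∀ a, IsOpen (s a)) ∧ ⋃ a, s a = Set.univ ∧
      ∀ (β : Type (u + 1)) (t : β → Set X.Coarse), IsLocallyFiniteRefinement s t →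
        ∃ (V : Type u) (𝒵 : ComplexOfGroups V) (f : Pseudofunctor.StrongTrans X 𝒵.realization),
          𝒵.VertexGroupsAreIsotropyOf X ∧ InjectiveOnIsotropy f ∧
            ∀ d, NerveDimLE t d → 𝒵.DimLE d := by
  have := hX.isGroupoid
  obtain ⟨P, hP, hq, hsep, hprop⟩ := hX.exists_presentation
  have h𝒰 : P.groupoid.IsEtaleProper :=
    ⟨TopGroupoid.isLocalHomeomorph_src_of_tgt hq, hsep, hprop⟩
  have hquot : IsOpenQuotientMap (X.toCoarse P.x) :=
    ⟨Presentation.toCoarse_surjective hP, continuous_toCoarse _,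
      Presentation.isOpenMap_toCoarse hP hq.isOpenMap⟩
  have : Small.{u} X.Coarse := small_of_surjective hquot.surjective
  obtain ⟨s, hs, hcover, H⟩ :=
    h𝒰.exists_framedCover hquot Presentation.toCoarse_eq_toCoarse_iff
  refine ⟨_, s, hs, hcover, fun β t ht => ?_⟩
  obtain ⟨β', t', ht', hdim⟩ := ht.exists_small
  obtain ⟨𝓕, hΓ, hcard⟩ := H β' t' ht'
  obtain ⟨f, hf⟩ := Presentation.exists_injectiveOnIsotropy hP
    (𝓕.cechFunctor h𝒰.isLocalHomeomorph_src) (𝓕.cechFunctor_injective h𝒰.isLocalHomeomorph_src)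
  refine ⟨_, 𝓕.𝒵, f, fun π => ?_, hf, fun d hd C => ?_⟩
  · obtain ⟨e⟩ := TypeSystem.nonempty_vertexGroup_mulEquiv π
    obtain ⟨y, ⟨e'⟩⟩ := hΓ π.base
    obtain ⟨e''⟩ := Presentation.nonempty_isotropy_mulEquiv (P := P) y
    exact ⟨_, ⟨(e.trans e').trans e''⟩⟩
  · obtain ⟨-, y, m, hm, -⟩ := (TypeSystem.top C).realized
    exact (TypeSystem.card_le_card_top C).trans (hcard d (hdim d hd) _ y m hm)

end Orbispaces

theorem proposition3 (X : Orbispaces.TopPrestack.{u}) (hX : X.IsOrbispace)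
    (hpara : ParacompactSpace X.Coarse) :
    (∃ (V : Type u) (𝒵 : Orbispaces.ComplexOfGroups V)
        (f : CategoryTheory.Pseudofunctor.StrongTrans X 𝒵.realization),
      𝒵.VertexGroupsAreIsotropyOf X ∧ Orbispaces.TopPrestack.InjectiveOnIsotropy f) ∧
    (Orbispaces.CoarselyFiniteDimensional X.Coarse →
      ∃ (V : Type u) (𝒵 : Orbispaces.ComplexOfGroups V)
        (f : CategoryTheory.Pseudofunctor.StrongTrans X 𝒵.realization),
      𝒵.VertexGroupsAreIsotropyOf X ∧ Orbispaces.TopPrestack.InjectiveOnIsotropy f ∧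
        ∃ d : ℕ, 𝒵.DimLE d) ∧
    (∀ d : ℕ, Orbispaces.CoarseDimLE X.Coarse d →
      ∃ (V : Type u) (𝒵 : Orbispaces.ComplexOfGroups V)
        (f : CategoryTheory.Pseudofunctor.StrongTrans X 𝒵.realization),
      𝒵.VertexGroupsAreIsotropyOf X ∧ Orbispaces.TopPrestack.InjectiveOnIsotropy f ∧
        𝒵.DimLE d) := by
  obtain ⟨α, s, hs, hcover, H⟩ := hX.exists_cover
  -- The hypotheses on `|X|` concern covers indexed by its own universe, which is one level higher.
  have hcover' : ⋃ a : ULift.{u + 1} α, s a.down = Set.univ := by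
    rw [← hcover]
    exact Equiv.ulift.surjective.iUnion_comp s
  have href : ∀ {β : Type (u + 1)} {t : β → Set X.Coarse},
      Orbispaces.IsLocallyFiniteRefinement (fun a : ULift.{u + 1} α => s a.down) t →
        Orbispaces.IsLocallyFiniteRefinement s t := fun h =>
    ⟨h.isOpen, h.cover, h.locallyFinite, fun b => (h.refines b).imp' ULift.down fun _ => id⟩
  refine ⟨?_, fun hfin => ?_, fun d hd => ?_⟩
  · obtain ⟨t, hto, htc, htf, hts⟩ :=
      precise_refinement _ (fun a : ULift.{u + 1} α => hs a.down) hcover'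
    obtain ⟨V, 𝒵, f, h1, h2, -⟩ := H _ t (href ⟨hto, htc, htf, fun a => ⟨a, hts a⟩⟩)
    exact ⟨V, 𝒵, f, h1, h2⟩
  · obtain ⟨β, t, ht, d, hd⟩ := hfin (ULift.{u + 1} α) _ (fun a => hs a.down) hcover'
    obtain ⟨V, 𝒵, f, h1, h2, h3⟩ := H β t (href ht)
    exact ⟨V, 𝒵, f, h1, h2, d, h3 d hd⟩
  · obtain ⟨β, t, ht, hdim⟩ := hd (ULift.{u + 1} α) _ (fun a => hs a.down) hcover'
    obtain ⟨V, 𝒵, f, h1, h2, h3⟩ := H β t (href ht)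
    exact ⟨V, 𝒵, f, h1, h2, h3 d hdim⟩
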